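/- **Theorem (asymptotic normality of the cross-fitted estimator).** *Setting.* A trajectory is $O=(X_1,A_1,Y_2,\dots,X_T,A_T,Y_{T+1})$ with $A_t\in\{0,1\}$, $Y_{t+1}\in\mathbb R$, and $X_t$ containing an availability indicator $I_t\in\{0,1\}$; $H_t=(X_1,A_1,Y_2,\dots,X_{t-1},A_{t-1},Y_t,X_t)$ is the history and $S_t$ is a given function of $H_t$. If $I_t=0$ then $A_t=0$; $p_t=p_t(H_t)=P(A_t=1\mid H_t)$ is known, and for some $\tau>0$ one has $\tau<p_t<1-\tau$ almost surely on $\{I_t=1\}$. Let $g$ be the identity or the logarithm, let $\gamma_t(s;\beta)$ be a given function, measurable in $s$ and twice continuously differentiable in $\beta\in\mathbb R^p$ with $\gamma_t,\partial_\beta\gamma_t,\partial_\beta^2\gamma_t$ bounded on bounded sets of $(s,\beta)$, let $\Theta\subset\mathbb R^p$, and suppose that $\beta^\star\in\Theta$ satisfies, for $t=1,\dots,T$ and almost surely on $\{I_t=1\}$, $$g[\mathbb E\{\mathbb E(Y_{t+1}\mid H_t,A_t=1)\mid S_t,I_t=1\}]-g[\mathbb E\{\mathbb E(Y_{t+1}\mid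 H_t,A_t=0)\mid S_t,I_t=1\}]=\gamma_t(S_t;\beta^\star)$$ (the two inner means being positive if $g=\log$). For a function $\mu_t(h_t,a_t)$ put $$\phi_t(\beta,\mu_t)=\tfrac{A_t-p_t}{p_t(1-p_t)}I_t\,R_t\,\partial_\beta\gamma_t(S_t;\beta),$$ where $R_t=Y_{t+1}-(A_t+p_t-1)\gamma_t(S_t;\beta)-(1-p_t)\mu_t(H_t,1)-p_t\mu_t(H_t,0)$ if $g$ is the identity and $R_t=e^{-A_t\gamma_t(S_t;\beta)}Y_{t+1}-(1-p_t)e^{-\gamma_t(S_t;\beta)}\mu_t(H_t,1)-p_t\mu_t(H_t,0)$ if $g=\log$. $\mathbb P$ denotes expectation over a new trajectory with the fitted functions held fixed, $\|\cdot\|$ is the norm of $L_2(P)$ (Frobenius norm for matrices), and $v^{\otimes2}=vv^T$. *Estimator.* Fix $K\ge2$. Let $O_1,O_2,\dots$ be i.i.d. copies of $O$, let $n=KN$, and let $(B_k)_{k=1}^K$ be a random partition of $\{1,\dots,n\}$ into sets of size $N$, independent of the data. For each $k$, using only the observations with index outside $B_k$: let $\hat\mu_{kt}$ be any fit of $\mathbb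 E(Y_{t+1}\mid H_t,A_t,I_t=1)$; let $\hat\beta^{\rm init}_k\in\Theta$ solve $\sum_{i\notin B_k}\sum_t\phi_t(\beta,\hat\mu_{kt})(O_i)=0$; and, with any fits $\hat G_{kt}(s;\mu_t,\beta)$ of $\mathbb E\{\partial_\beta\phi_t(\beta,\mu_t)\mid S_t=s\}$ and $\hat M_{kt}(s;\mu_t,\beta)$ of $\mathbb E\{\phi_t(\beta,\mu_t)^{\otimes2}\mid S_t=s\}$, let $\hat d_{kt}(s;\mu_t,\beta)=\hat G_{kt}\hat M_{kt}^{+}$ ($^+$ is the Moore–Penrose inverse). Let $\check\beta\in\Theta$ solve $K^{-1}\sum_k\mathbb P_{n,k}\sum_t\hat d_{kt}(S_t;\hat\mu_{kt},\hat\beta_k^{\rm init})\phi_t(\beta,\hat\mu_{kt})=0$, where $\mathbb P_{n,k}$ is the empirical average over $B_k$. (Both equations need to be solved only with probability tending to one.) *Assumptions.* (a) For each $t$ there is a function $\mu_t'(h_t,a_t)$ with $\|\hat\mu_{kt}-\mu_t'\|=o_P(1)$ for all $k$. (b) For each $t$ there is a function $d_t'(s_t)$ in $L_2(P)$ to which the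 fitted weights converge: for all $t$ and $k$, $\|\hat d_{kt}(\cdot;\hat\mu_{kt},\hat\beta^{\rm init}_k)-d_t'\|=o_P(1)$; or, alternatively, for all $t$ and $k$, $\|\hat d_{kt}(\cdot;\mu_t',\beta^\star)-d_t'\|=o_P(1)$, $\hat\beta_k^{\rm init}\to\beta^\star$ in probability, and $(\mu_t,\beta)\mapsto\hat d_{kt}(\cdot;\mu_t,\beta)\in L_2(P)$, for $\beta\in\Theta$ and $\mu_t$ bounded by the constant $C$ of (d), is stochastically equicontinuous at $(\mu_t',\beta^\star)$: for all $\varepsilon,\eta>0$ there is $\delta>0$ such that, for all large $n$, with probability at least $1-\eta$ one has $\|\hat d_{kt}(\cdot;\mu_t,\beta)-\hat d_{kt}(\cdot;\mu_t',\beta^\star)\|<\varepsilon$ whenever $\|\mu_t-\mu'_t\|\le\delta$ and $|\beta-\beta^\star|\le\delta$. (c) $\mathbb P\sum_td_t'(S_t)\phi_t(\beta,\mu_t')=0$ has a unique solution $\beta\in\Theta$. (d) $\Theta$ is compact, the support of $O$ (and of $S_t$) is bounded, $|\hat\mu_{kt}|$ and $|\mu_t'|$ are bounded by a constant $C$ that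 does not depend on $n$, and $\mathbb P\{\sum_td_t'(S_t)\partial_\beta\phi_t(\beta^\star,\mu_t')\}$ is invertible. *Conclusion.* As $n\to\infty$, $\sqrt n(\check\beta-\beta^\star)\stackrel d\to N(0,V)$ with $$V=\mathbb P\Big\{\sum_td_t'(S_t)\partial_\beta\phi_t(\beta^\star,\mu_t')\Big\}^{-1}\,\mathbb P\Big[\Big\{\sum_td_t'(S_t)\phi_t(\beta^\star,\mu_t')\Big\}^{\otimes2}\Big]\,\mathbb P\Big\{\sum_td_t'(S_t)\partial_\beta\phi_t(\beta^\star,\mu_t')\Big\}^{-1,T},$$ and, with $\hat d_{kt}=\hat d_{kt}(S_t;\hat\mu_{kt},\hat\beta^{\rm init}_k)$, the matrix $$\Big[\tfrac1K\sum_k\mathbb P_{n,k}\Big\{\sum_t\hat d_{kt}\,\partial_\beta\phi_t(\check\beta,\hat\mu_{kt})\Big\}\Big]^{-1}\Big(\tfrac1K\sum_k\mathbb P_{n,k}\Big[\Big\{\sum_t\hat d_{kt}\,\phi_t(\check\beta,\hat\mu_{kt})\Big\}^{\otimes2}\Big]\Big)\Big[\tfrac1K\sum_k\mathbb P_{n,k}\Big\{\sum_t\hat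 d_{kt}\,\partial_\beta\phi_t(\check\beta,\hat\mu_{kt})\Big\}\Big]^{-1,T}$$ converges to $V$ in probability. No Donsker condition is imposed. -/

import Mathlib

open MeasureTheory ProbabilityTheory Filter Topology
open scoped ENNReal Matrix

namespace MRT

noncomputable section

/-! ### Data of a micro-randomized trial -/

/-- `ℝ^d` with the Euclidean norm. -/
abbrev Vec (d : ℕ) : Type := EuclideanSpace ℝ (Fin d)

/-- The covariates `X_t`: the availability indicator `I_t` together with a vector in `ℝ^q`. -/
abbrev Cov (q : ℕ) : Type := Bool × Vec q

/-- `(X_t, A_t, Y_{t+1})`. -/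
abbrev Step (q : ℕ) : Type := Cov q × Bool × ℝ

/-- A trajectory `O = (X_1, A_1, Y_2, …, X_T, A_T, Y_{T+1})`. -/
abbrev Traj (T q : ℕ) : Type := Fin T → Step q

/-- Values of the history `H_t = (X_1, A_1, Y_2, …, X_{t-1}, A_{t-1}, Y_t, X_t)`,
where `t` is the number of decision points before the current one. -/
abbrev Hist (q t : ℕ) : Type := (Fin t → Step q) × Cov q

variable {T q r p : ℕ}

/-- `I_t`. -/
def avail (t : Fin T) (o : Traj T q) : Bool := (o t).1.1

/-- The vector part of `X_t`. -/
def covar (t : Fin T) (o : Traj T q) : Vec q := (o t).1.2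

/-- `A_t`. -/
def trt (t : Fin T) (o : Traj T q) : Bool := (o t).2.1

/-- `Y_{t+1}`. -/
def outc (t : Fin T) (o : Traj T q) : ℝ := (o t).2.2

/-- `H_t`. -/
def hist (t : Fin T) (o : Traj T q) : Hist q t :=
  (fun u => o (Fin.castLE t.isLt.le u), (o t).1)

/-- A binary variable as a real number. -/
def bit (b : Bool) : ℝ := if b then 1 else 0

/-- The two link functions. -/
inductive Link where
  | identity
  | log

/-- The link function `g`. -/
def Link.fn : Link → ℝ → ℝ
  | .identity => fun x => x
  | .log => Real.log

/-- What the analyst specifies: the link `g`, the moderators `S_t` (a function of `H_t`), the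
randomization probabilities `p_t(H_t)` and the model `γ_t(s; β)` of the causal excursion effect,
which is twice continuously differentiable in `β`, with derivatives up to order two that are
bounded on bounded sets. -/
structure Spec (T q r p : ℕ) where
  link : Link
  modr : ∀ t : Fin T, Hist q t → Vec r
  modr_meas : ∀ t, Measurable (modr t)
  prob : ∀ t : Fin T, Hist q t → ℝ
  prob_meas : ∀ t, Measurable (prob t)
  gam : Fin T → Vec r → Vec p → ℝ
  gam_meas : ∀ t b, Measurable fun s => gam t s b
  gam_contDiff : ∀ t s, ContDiff ℝ 2 (gam t s)
  gam_bdd : ∀ (t : Fin T) (R : ℝ), ∃ C : ℝ, ∀ (s : Vec r) (b : Vec p), ‖s‖ ≤ R → ‖b‖ ≤ R →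
    |gam t s b| ≤ C ∧ ‖fderiv ℝ (gam t s) b‖ ≤ C ∧ ‖fderiv ℝ (fderiv ℝ (gam t s)) b‖ ≤ C

namespace Spec

variable (M : Spec T q r p)

/-- The moderators `S_t` of a trajectory. -/
def S (t : Fin T) (o : Traj T q) : Vec r := M.modr t (hist t o)

/-- The design of the trial under the law `P` of a trajectory: no treatment when unavailable,
`p_t(H_t)` is the conditional probability of treatment given `H_t`, and positivity. -/
structure Design (P : Measure (Traj T q)) : Prop where
  unavailable : ∀ t, ∀ᵐ o ∂P, avail t o = false → trt t o = false
  randomized : ∀ t,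
    condExp (MeasurableSpace.comap (hist t) inferInstance) P (fun o => bit (trt t o))
      =ᵐ[P] fun o => M.prob t (hist t o)
  positivity : ∃ τ : ℝ, 0 < τ ∧ ∀ t, ∀ᵐ o ∂P, avail t o = true →
    τ < M.prob t (hist t o) ∧ M.prob t (hist t o) < 1 - τ

/-- `E(Y_{t+1} | H_t, A_t = a)`: conditional expectation given `H_t` under `P(· | A_t = a)`. -/
def meanGivenHist (P : Measure (Traj T q)) (t : Fin T) (a : Bool) : Traj T q → ℝ :=
  condExp (MeasurableSpace.comap (hist t) inferInstance)
    (ProbabilityTheory.cond P {o | trt t o = a}) (outc t)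

/-- `E{E(Y_{t+1} | H_t, A_t = a) | S_t, I_t = 1}`: conditional expectation given `S_t` under
`P(· | I_t = 1)`. -/
def meanGivenMod (P : Measure (Traj T q)) (t : Fin T) (a : Bool) : Traj T q → ℝ :=
  condExp (MeasurableSpace.comap (M.S t) inferInstance)
    (ProbabilityTheory.cond P {o | avail t o = true}) (meanGivenHist P t a)

/-- The model for the causal excursion effect holds with the parameter value `b`. For the log link
the two means have to be positive, so that their logarithms make sense. -/
def EffectModel (P : Measure (Traj T q)) (b : Vec p) : Prop :=
  ∀ t, ∀ᵐ o ∂(ProbabilityTheory.cond P {o | avail t o = true}),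
    (M.link = Link.log → 0 < M.meanGivenMod P t true o ∧ 0 < M.meanGivenMod P t false o) ∧
    M.link.fn (M.meanGivenMod P t true o) - M.link.fn (M.meanGivenMod P t false o)
      = M.gam t (M.S t o) b

/-- The observations are bounded. The clause on `S_t` follows from the other two when `S_t` is a
sub-vector of `H_t`. -/
def BoundedSupport (P : Measure (Traj T q)) : Prop :=
  ∃ R : ℝ, ∀ t, ∀ᵐ o ∂P, ‖covar t o‖ ≤ R ∧ |outc t o| ≤ R ∧ ‖M.S t o‖ ≤ R

/-! ### The estimating function -/

/-- The factor in braces in `φ_t(β, μ_t)`. -/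
def resid (t : Fin T) (b : Vec p) (mu : Hist q t → Bool → ℝ) (o : Traj T q) : ℝ :=
  let h := hist t o
  let a := bit (trt t o)
  let g := M.gam t (M.S t o) b
  let π := M.prob t h
  match M.link with
  | .identity => outc t o - (a + π - 1) * g - (1 - π) * mu h true - π * mu h false
  | .log => Real.exp (-a * g) * outc t o - (1 - π) * Real.exp (-g) * mu h true - π * mu h false

/-- `φ_t(β, μ_t)`. -/
def phi (t : Fin T) (b : Vec p) (mu : Hist q t → Bool → ℝ) (o : Traj T q) : Vec p :=
  ((bit (trt t o) - M.prob t (hist t o)) /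
      (M.prob t (hist t o) * (1 - M.prob t (hist t o))) * bit (avail t o) * M.resid t b mu o) •
    gradient (M.gam t (M.S t o)) b

/-- The Jacobian matrix `∂_β φ_t(β, μ_t)`. -/
def dphi (t : Fin T) (b : Vec p) (mu : Hist q t → Bool → ℝ) (o : Traj T q) :
    Matrix (Fin p) (Fin p) ℝ :=
  Matrix.of fun i j => fderiv ℝ (fun b' => M.phi t b' mu o) b (EuclideanSpace.single j 1) i

/-- `∑_t d_t(S_t) φ_t(β, μ_t)`. -/
def psi (d : Fin T → Vec r → Matrix (Fin p) (Fin p) ℝ) (mu : ∀ t : Fin T, Hist q t → Bool → ℝ)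
    (b : Vec p) (o : Traj T q) : Vec p :=
  ∑ t, WithLp.toLp 2 (d t (M.S t o) *ᵥ WithLp.ofLp (M.phi t b (mu t) o))

/-- `∑_t d_t(S_t) ∂_β φ_t(β, μ_t)`. -/
def dpsi (d : Fin T → Vec r → Matrix (Fin p) (Fin p) ℝ) (mu : ∀ t : Fin T, Hist q t → Bool → ℝ)
    (b : Vec p) (o : Traj T q) : Matrix (Fin p) (Fin p) ℝ :=
  ∑ t, d t (M.S t o) * M.dphi t b (mu t) o

/-- The population matrix `P{∑_t d_t(S_t) ∂_β φ_t(β, μ_t)}`. -/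
def bread (P : Measure (Traj T q)) (d : Fin T → Vec r → Matrix (Fin p) (Fin p) ℝ)
    (mu : ∀ t : Fin T, Hist q t → Bool → ℝ) (b : Vec p) : Matrix (Fin p) (Fin p) ℝ :=
  Matrix.of fun i j => ∫ o, M.dpsi d mu b o i j ∂P

/-- The population matrix `P[{∑_t d_t(S_t) φ_t(β, μ_t)}^{⊗2}]`. -/
def meat (P : Measure (Traj T q)) (d : Fin T → Vec r → Matrix (Fin p) (Fin p) ℝ)
    (mu : ∀ t : Fin T, Hist q t → Bool → ℝ) (b : Vec p) : Matrix (Fin p) (Fin p) ℝ :=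
  Matrix.of fun i j => ∫ o, M.psi d mu b o i * M.psi d mu b o j ∂P

/-- The asymptotic variance `V`. -/
def asympVar (P : Measure (Traj T q)) (d : Fin T → Vec r → Matrix (Fin p) (Fin p) ℝ)
    (mu : ∀ t : Fin T, Hist q t → Bool → ℝ) (b : Vec p) : Matrix (Fin p) (Fin p) ℝ :=
  (M.bread P d mu b)⁻¹ * M.meat P d mu b * ((M.bread P d mu b)⁻¹)ᵀ

/-- `P ∑_t d_t(S_t) φ_t(β, μ_t) = 0` has exactly one solution `β` in `Θ`. -/
def UniqueZero (P : Measure (Traj T q)) (Θ : Set (Vec p))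
    (d : Fin T → Vec r → Matrix (Fin p) (Fin p) ℝ)
    (mu : ∀ t : Fin T, Hist q t → Bool → ℝ) : Prop :=
  ∃! b, b ∈ Θ ∧ ∫ o, M.psi d mu b o ∂P = 0

/-- `‖d₁ - d₂‖²` in `L₂(P)` (Frobenius norm) for matrix functions of `S_t`. -/
def sqDistD (P : Measure (Traj T q)) (t : Fin T) (d₁ d₂ : Vec r → Matrix (Fin p) (Fin p) ℝ) :
    ℝ≥0∞ :=
  ∫⁻ o, ENNReal.ofReal (∑ i, ∑ j, (d₁ (M.S t o) i j - d₂ (M.S t o) i j) ^ 2) ∂P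

end Spec

/-- `‖μ₁ - μ₂‖²` in `L₂(P)` for functions of `(H_t, A_t)`. -/
def sqDistMu (P : Measure (Traj T q)) (t : Fin T) (mu₁ mu₂ : Hist q t → Bool → ℝ) : ℝ≥0∞ :=
  ∫⁻ o, ENNReal.ofReal ((mu₁ (hist t o) (trt t o) - mu₂ (hist t o) (trt t o)) ^ 2) ∂P

/-- `|μ(H_t, A_t)| ≤ C` almost surely. -/
def BoundedMu (P : Measure (Traj T q)) (C : ℝ) (t : Fin T) (mu : Hist q t → Bool → ℝ) : Prop :=
  ∀ᵐ o ∂P, |mu (hist t o) (trt t o)| ≤ C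

/-- `X_N = o_P(1)` for nonnegative random quantities. -/
def LittleOP {Ω : Type*} [MeasurableSpace Ω] (Pr : Measure Ω) (X : ℕ → Ω → ℝ≥0∞) : Prop :=
  ∀ ε : ℝ≥0∞, 0 < ε → Tendsto (fun N => Pr {ω | ε ≤ X N ω}) atTop (𝓝 0)

/-- An event holds with probability tending to one. -/
def Whp {Ω : Type*} [MeasurableSpace Ω] (Pr : Measure Ω) (E : ℕ → Ω → Prop) : Prop :=
  Tendsto (fun N => Pr {ω | ¬ E N ω}) atTop (𝓝 0)

/-! ### The Moore–Penrose inverse -/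

/-- The four Penrose equations. -/
structure IsPenrose (A X : Matrix (Fin p) (Fin p) ℝ) : Prop where
  left : A * X * A = A
  right : X * A * X = X
  symm_left : (A * X)ᵀ = A * X
  symm_right : (X * A)ᵀ = X * A

theorem IsPenrose.unique {A X Y : Matrix (Fin p) (Fin p) ℝ} (hX : IsPenrose A X)
    (hY : IsPenrose A Y) : X = Y := by
  have h1 : A * X = A * Y := by
    calc A * X = (A * X)ᵀ := hX.symm_left.symm
      _ = (A * Y * A * X)ᵀ := by rw [hY.left]
      _ = (A * X)ᵀ * (A * Y)ᵀ := by rw [← Matrix.transpose_mul, Matrix.mul_assoc (A * Y)]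
      _ = A * X * (A * Y) := by rw [hX.symm_left, hY.symm_left]
      _ = A * X * A * Y := by simp only [Matrix.mul_assoc]
      _ = A * Y := by rw [hX.left]
  have h2 : X * A = Y * A := by
    calc X * A = (X * A)ᵀ := hX.symm_right.symm
      _ = (X * (A * Y * A))ᵀ := by rw [hY.left]
      _ = (Y * A)ᵀ * (X * A)ᵀ := by
        rw [← Matrix.transpose_mul]; simp only [Matrix.mul_assoc]
      _ = Y * A * (X * A) := by rw [hX.symm_right, hY.symm_right]
      _ = Y * (A * X * A) := by simp only [Matrix.mul_assoc]
      _ = Y * A := by rw [hX.left]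
  calc X = X * A * X := hX.right.symm
    _ = Y * (A * X) := by rw [h2, Matrix.mul_assoc]
    _ = Y * A * Y := by rw [h1, Matrix.mul_assoc]
    _ = Y := hY.right

theorem exists_isPenrose (A : Matrix (Fin p) (Fin p) ℝ) : ∃ X, IsPenrose A X := by
  have hB : (Aᴴ * A).IsHermitian := Matrix.isHermitian_conjTranspose_mul_self A
  let U : Matrix (Fin p) (Fin p) ℝ := hB.eigenvectorUnitary
  let D : Matrix (Fin p) (Fin p) ℝ := Matrix.diagonal hB.eigenvalues
  let E : Matrix (Fin p) (Fin p) ℝ := Matrix.diagonal fun i => (hB.eigenvalues i)⁻¹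
  have hU : Uᴴ * U = 1 := Unitary.coe_star_mul_self hB.eigenvectorUnitary
  have hspec : Aᴴ * A = U * D * Uᴴ := by
    have h := hB.spectral_theorem
    simpa [U, D, Unitary.conjStarAlgAut_apply, Matrix.star_eq_conjTranspose,
      Function.comp_def] using h
  have hDE : D * E * D = D := by
    simp only [D, E, Matrix.diagonal_mul_diagonal]
    congr 1; funext i; exact mul_inv_mul_cancel _
  have hED : E * D * E = E := by
    simp only [D, E, Matrix.diagonal_mul_diagonal]
    congr 1; funext i; simpa using mul_inv_mul_cancel (hB.eigenvalues i)⁻¹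
  have hDt : Dᴴ = D := by simp [D]
  have hEt : Eᴴ = E := by simp [E]
  have hcomm : E * D = D * E := by
    simp only [D, E, Matrix.diagonal_mul_diagonal, mul_comm]
  have hU' : ∀ Z : Matrix (Fin p) (Fin p) ℝ, Uᴴ * (U * Z) = Z := fun Z => by
    rw [← Matrix.mul_assoc, hU, Matrix.one_mul]
  let G : Matrix (Fin p) (Fin p) ℝ := U * E * Uᴴ
  have hGt : Gᴴ = G := by
    simp only [G, Matrix.conjTranspose_mul, Matrix.conjTranspose_conjTranspose, hEt,
      Matrix.mul_assoc]
  have hGB : G * (Aᴴ * A) = U * (E * D) * Uᴴ := by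
    rw [hspec]; simp only [G, Matrix.mul_assoc, hU']
  have hBGB : Aᴴ * A * (G * (Aᴴ * A)) = Aᴴ * A := by
    rw [hGB, hspec]
    calc U * D * Uᴴ * (U * (E * D) * Uᴴ) = U * (D * E * D) * Uᴴ := by
          simp only [Matrix.mul_assoc, hU']
      _ = U * D * Uᴴ := by rw [hDE]
  have hGBG : G * (Aᴴ * A) * G = G := by
    rw [hGB]
    calc U * (E * D) * Uᴴ * G = U * (E * D * E) * Uᴴ := by
          simp only [G, Matrix.mul_assoc, hU']
      _ = G := by rw [hED]
  refine ⟨G * Aᴴ, ?_, ?_, ?_, ?_⟩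
  · have h0 : Aᴴ * A * (G * (Aᴴ * A) - 1) = 0 := by
      rw [Matrix.mul_sub, hBGB, Matrix.mul_one, sub_self]
    have h1 : A * (G * (Aᴴ * A) - 1) = 0 := (Matrix.conjTranspose_mul_self_mul_eq_zero A _).1 h0
    rw [Matrix.mul_sub, Matrix.mul_one, sub_eq_zero] at h1
    simpa only [Matrix.mul_assoc] using h1
  · calc G * Aᴴ * A * (G * Aᴴ) = G * (Aᴴ * A) * G * Aᴴ := by simp only [Matrix.mul_assoc]
      _ = G * Aᴴ := by rw [hGBG]
  · rw [← Matrix.conjTranspose_eq_transpose_of_trivial]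
    simp only [Matrix.conjTranspose_mul, Matrix.conjTranspose_conjTranspose, hGt,
      Matrix.mul_assoc]
  · rw [← Matrix.conjTranspose_eq_transpose_of_trivial, Matrix.mul_assoc, hGB]
    have hEDt : (E * D)ᴴ = E * D := by rw [Matrix.conjTranspose_mul, hDt, hEt, hcomm]
    rw [Matrix.conjTranspose_mul, Matrix.conjTranspose_mul, hEDt,
      Matrix.conjTranspose_conjTranspose, ← Matrix.mul_assoc]

/-- The Moore–Penrose inverse `A⁺`. -/
def pinv (A : Matrix (Fin p) (Fin p) ℝ) : Matrix (Fin p) (Fin p) ℝ :=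
  (exists_isPenrose A).choose

/-! ### Cross-fitting -/

/-- A sample of size `n = K * N`, restricted to the complement of the `k`-th fold of the
partition `π`. -/
abbrev Train (T q K N : ℕ) (π : Fin (K * N) → Fin K) (k : Fin K) : Type :=
  {i : Fin (K * N) // π i ≠ k} → Traj T q

/-- The empirical average over a finite index set. -/
def avg {ι E : Type*} [AddCommGroup E] [Module ℝ E] (s : Finset ι) (f : ι → E) : E :=
  (s.card : ℝ)⁻¹ • ∑ i ∈ s, f i

/-- `K⁻¹ ∑_k P_{n,k} F_k`, where `P_{n,k}` is the empirical average over the `k`-th fold. -/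
def foldAvg {K N : ℕ} {E : Type*} [AddCommGroup E] [Module ℝ E] (π : Fin (K * N) → Fin K)
    (F : Fin K → Fin (K * N) → E) : E :=
  (K : ℝ)⁻¹ • ∑ k, avg (Finset.univ.filter fun i => π i = k) (F k)

/-- Arbitrary fitting procedures, using only the observations outside the `k`-th fold.
`muHat` is the fitted `E(Y_{t+1} | H_t, A_t, I_t = 1)`, `betaInit` the preliminary estimator,
`gradHat` the fitted `E{∂_β φ_t(β, μ_t) | S_t = s}` and `meatHat` the fitted
`E{φ_t(β, μ_t)^{⊗2} | S_t = s}`, the last two for arbitrary `μ_t` and `β`. -/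
structure Learner (T q r p K : ℕ) where
  muHat : ∀ (N : ℕ) (π : Fin (K * N) → Fin K) (k : Fin K), Train T q K N π k →
    ∀ t : Fin T, Hist q t → Bool → ℝ
  betaInit : ∀ (N : ℕ) (π : Fin (K * N) → Fin K) (k : Fin K), Train T q K N π k → Vec p
  gradHat : ∀ (N : ℕ) (π : Fin (K * N) → Fin K) (k : Fin K), Train T q K N π k →
    ∀ t : Fin T, (Hist q t → Bool → ℝ) → Vec p → Vec r → Matrix (Fin p) (Fin p) ℝ
  meatHat : ∀ (N : ℕ) (π : Fin (K * N) → Fin K) (k : Fin K), Train T q K N π k →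
    ∀ t : Fin T, (Hist q t → Bool → ℝ) → Vec p → Vec r → Matrix (Fin p) (Fin p) ℝ

namespace Learner

variable {K : ℕ} (L : Learner T q r p K)

/-- The plug-in weight `d̂_{kt}(s; μ_t, β)`. -/
def dHat (N : ℕ) (π : Fin (K * N) → Fin K) (k : Fin K) (z : Train T q K N π k) (t : Fin T)
    (mu : Hist q t → Bool → ℝ) (b : Vec p) (s : Vec r) : Matrix (Fin p) (Fin p) ℝ :=
  L.gradHat N π k z t mu b s * pinv (L.meatHat N π k z t mu b s)

/-- The weight `d̂_{kt}(s; μ̂_{kt}, β̂_k^init)` that enters the final estimating equation. -/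
def wHat (N : ℕ) (π : Fin (K * N) → Fin K) (k : Fin K) (z : Train T q K N π k) (t : Fin T)
    (s : Vec r) : Matrix (Fin p) (Fin p) ℝ :=
  L.dHat N π k z t (L.muHat N π k z t) (L.betaInit N π k z) s

/-- All fitted objects are measurable. -/
structure Meas : Prop where
  muHat : ∀ N π k (t : Fin T), Measurable fun x : Train T q K N π k × Hist q t × Bool =>
    L.muHat N π k x.1 t x.2.1 x.2.2
  betaInit : ∀ N π k, Measurable (L.betaInit N π k)
  wHat : ∀ N π k t i j, Measurable fun x : Train T q K N π k × Vec r =>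
    L.wHat N π k x.1 t x.2 i j
  dHat : ∀ N π k (t : Fin T) (mu : Hist q t → Bool → ℝ) b i j,
    (Measurable fun y : Hist q t × Bool => mu y.1 y.2) →
      Measurable fun x : Train T q K N π k × Vec r => L.dHat N π k x.1 t mu b x.2 i j

end Learner

/-- A sampling scheme for cross-fitting: i.i.d. trajectories `O_1, O_2, …` with law `P` and, for
every `N`, a random partition of the first `n = K * N` indices into `K` folds of size `N` that is
independent of the trajectories. -/
structure Sampling {Ω : Type*} [MeasurableSpace Ω] (Pr : Measure Ω) (P : Measure (Traj T q))
    {K : ℕ} (O : ℕ → Ω → Traj T q) (fold : ∀ N : ℕ, Ω → Fin (K * N) → Fin K) : Prop where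
  meas : ∀ i, Measurable (O i)
  law : ∀ i, Measure.map (O i) Pr = P
  indep : iIndepFun O Pr
  fold_meas : ∀ N, Measurable (fold N)
  fold_size : ∀ N ω k, (Finset.univ.filter fun i => fold N ω i = k).card = N
  fold_indep : ∀ N, IndepFun (fold N) (fun ω i => O i ω) Pr

section estimator

variable {Ω : Type*} {K : ℕ} (O : ℕ → Ω → Traj T q) (fold : ∀ N : ℕ, Ω → Fin (K * N) → Fin K)

/-- The observations outside the `k`-th fold. -/
def train (N : ℕ) (k : Fin K) (ω : Ω) : Train T q K N (fold N ω) k := fun i => O i.1 ω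

variable (M : Spec T q r p) (L : Learner T q r p K)

/-- `μ̂_{kt}`. -/
def muFit (N : ℕ) (k : Fin K) (ω : Ω) (t : Fin T) : Hist q t → Bool → ℝ :=
  L.muHat N (fold N ω) k (train O fold N k ω) t

/-- `β̂_k^init`. -/
def initFit (N : ℕ) (k : Fin K) (ω : Ω) : Vec p :=
  L.betaInit N (fold N ω) k (train O fold N k ω)

/-- `d̂_{kt}(·; μ_t, β)`. -/
def dFit (N : ℕ) (k : Fin K) (ω : Ω) (t : Fin T) (mu : Hist q t → Bool → ℝ) (b : Vec p) :
    Vec r → Matrix (Fin p) (Fin p) ℝ :=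
  L.dHat N (fold N ω) k (train O fold N k ω) t mu b

/-- `d̂_{kt}(·; μ̂_{kt}, β̂_k^init)`. -/
def wFit (N : ℕ) (k : Fin K) (ω : Ω) (t : Fin T) : Vec r → Matrix (Fin p) (Fin p) ℝ :=
  L.wHat N (fold N ω) k (train O fold N k ω) t

/-- The preliminary equation: `b` solves `∑_t φ_t(b, μ̂_{kt}) = 0` on average over the observations
outside the `k`-th fold. -/
def InitEq (N : ℕ) (k : Fin K) (ω : Ω) (b : Vec p) : Prop :=
  avg (Finset.univ : Finset {i : Fin (K * N) // fold N ω i ≠ k})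
    (fun i => ∑ t, M.phi t b (muFit O fold L N k ω t) (O i.1 ω)) = 0

/-- The final, cross-fitted equation
`K⁻¹ ∑_k P_{n,k} ∑_t d̂_{kt}(S_t; μ̂_{kt}, β̂_k^init) φ_t(b, μ̂_{kt}) = 0`. -/
def FinalEq (N : ℕ) (ω : Ω) (b : Vec p) : Prop :=
  foldAvg (fold N ω) (fun k i =>
    M.psi (wFit O fold L N k ω) (muFit O fold L N k ω) b (O i ω)) = 0

/-- The cross-fitted sandwich estimator of the variance, evaluated at `b`. -/
def sandwich (N : ℕ) (ω : Ω) (b : Vec p) : Matrix (Fin p) (Fin p) ℝ :=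
  let B : Matrix (Fin p) (Fin p) ℝ := foldAvg (fold N ω) fun k i =>
    M.dpsi (wFit O fold L N k ω) (muFit O fold L N k ω) b (O i ω)
  let Q : Matrix (Fin p) (Fin p) ℝ := foldAvg (fold N ω) fun k i =>
    Matrix.vecMulVec
      (WithLp.ofLp (M.psi (wFit O fold L N k ω) (muFit O fold L N k ω) b (O i ω)))
      (WithLp.ofLp (M.psi (wFit O fold L N k ω) (muFit O fold L N k ω) b (O i ω)))
  B⁻¹ * Q * (B⁻¹)ᵀ

variable [MeasurableSpace Ω] (Pr : Measure Ω) (P : Measure (Traj T q))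

/-- The weights that are used converge in `L₂(P)`:
`‖d̂_{kt}(·; μ̂_{kt}, β̂_k^init) - d'_t‖ = o_P(1)`. -/
def UsedWeightsConverge (d' : Fin T → Vec r → Matrix (Fin p) (Fin p) ℝ) : Prop :=
  ∀ t k, LittleOP Pr fun N ω => M.sqDistD P t (wFit O fold L N k ω t) (d' t)

/-- The weights at the limits converge in `L₂(P)`: `‖d̂_{kt}(·; μ'_t, β⋆) - d'_t‖ = o_P(1)`. -/
def LimitWeightsConverge (d' : Fin T → Vec r → Matrix (Fin p) (Fin p) ℝ)
    (mu' : ∀ t : Fin T, Hist q t → Bool → ℝ) (b : Vec p) : Prop :=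
  ∀ t k, LittleOP Pr fun N ω => M.sqDistD P t (dFit O fold L N k ω t (mu' t) b) (d' t)

/-- `d̂_{kt}(·; μ_t, β)` is continuous in `(μ_t, β)` at `(μ'_t, β⋆)`, with a modulus that does not
degenerate as the sample grows (stochastic equicontinuity); `μ_t` ranges over the measurable
functions bounded by `C`, and `β` over `Θ`. -/
def WeightsEquicontinuous (Θ : Set (Vec p)) (C : ℝ) (mu' : ∀ t : Fin T, Hist q t → Bool → ℝ)
    (b : Vec p) : Prop :=
  ∀ (t : Fin T) (k : Fin K), ∀ ε : ℝ≥0∞, 0 < ε → ∀ η : ℝ≥0∞, 0 < η → ∃ δ : ℝ, 0 < δ ∧ ∀ᶠ N in atTop,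
    Pr {ω | ∃ (mu : Hist q t → Bool → ℝ) (b' : Vec p),
        Measurable (fun y : Hist q t × Bool => mu y.1 y.2) ∧ BoundedMu P C t mu ∧ b' ∈ Θ ∧
        sqDistMu P t mu (mu' t) ≤ ENNReal.ofReal δ ∧ ‖b' - b‖ ≤ δ ∧
        ε ≤ M.sqDistD P t (dFit O fold L N k ω t mu b') (dFit O fold L N k ω t (mu' t) b)} ≤ η

end estimator

end

end MRT

set_option linter.unusedSectionVars false

/-! The result is a Z-estimation theorem in which the nuisance functions enter only through their
limits, for two reasons.

The first is robustness. Since the randomization probability is known, the factor (A_t - p_t)/{p_t(1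
- p_t)} I_t is a signed inverse probability weight: it turns the mean of φ_t into an integral over
the available histories of the arm A = 1 minus the arm A = 0. In this difference the outcome model
μ_t cancels, and what remains vanishes by the effect model, even after multiplication by any
function of S_t (`Spec.EffectModel.balance`, `Spec.Design.integral_weight_mul_phi`). So at β⋆ the
estimating function has mean zero for every bounded outcome model and every square integrable
weight, in particular for the fitted ones with the training data held fixed.

The second is cross-fitting. Given the partition and the training sample, the fitted functions are
fixed and the observations of the fold are i.i.d. with law P (`Sampling.map_train_test`). The
difference between the fitted and the limiting estimating function at β⋆ is therefore centered, and
its L₂ norm tends to zero; Chebyshev's inequality given the training sample makes its sum over a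
fold o_P(√N) (`Sampling.tendsto_fold_centered`). No entropy condition is needed.

To separate the parameter from the nuisances, ψ is written as a finite sum of features times
coefficients. The features are entries of d_t times 1, I_t μ_t(H_t, 1) or I_t μ_t(H_t, 0); they are
fitted but free of β. The coefficients are known, C¹ in β and locally bounded. The weights converge
in L₂ and the outcome features converge in L₂ and are bounded, so the features converge in L₂
(`Spec.Design.regular_crossFit`). The asymptotics are proved for any such sum (`Features.Regular`):
a law of large numbers in C(B, ℝ), together with Markov's inequality given the training sample,
yields uniform convergence of the averaged score, Jacobian and squared score. Consistency follows
from compactness of Θ and uniqueness of the zero, and an expansion at β⋆ gives √n(β̌ - β⋆) = -D⁻¹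
n^{-1/2} ∑ ψ'(O_i) + o_P(1), with D the population Jacobian and ψ' the limiting estimating function.
The multivariate central limit theorem, Slutsky's lemma and continuity of matrix inversion finish
the proof.

Convergence in probability is handled as convergence along the filter `inProb`, so that squeezing,
composition and cluster point arguments apply as they stand. -/

namespace MRT

/-! ### Convergence in probability as convergence along a filter -/

section inProb

variable {Ω : Type*} [MeasurableSpace Ω]

/-- The filter on `ℕ × Ω` of the events whose probability tends to one. -/
def inProb (Pr : Measure Ω) : Filter (ℕ × Ω) where
  sets := {s | Tendsto (fun N => Pr {ω | (N, ω) ∉ s}) atTop (𝓝 0)}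
  univ_sets := by simp
  sets_of_superset {s t} hs hst := by
    refine tendsto_of_tendsto_of_tendsto_of_le_of_le tendsto_const_nhds hs
      (fun _ => zero_le) fun N => measure_mono fun ω hω h => hω (hst h)
  inter_sets {s t} hs ht := by
    have h := Tendsto.add hs ht
    rw [add_zero] at h
    refine tendsto_of_tendsto_of_tendsto_of_le_of_le tendsto_const_nhds h
      (fun _ => zero_le) fun N => (measure_mono fun ω hω => ?_).trans (measure_union_le _ _)
    by_contra hcon
    simp only [Set.mem_union, Set.mem_ofPred_eq, not_or, not_not] at hcon
    exact hω ⟨hcon.1, hcon.2⟩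

variable {Pr : Measure Ω}

theorem eventually_inProb {E : ℕ × Ω → Prop} :
    (∀ᶠ x in inProb Pr, E x) ↔ Tendsto (fun N => Pr {ω | ¬ E (N, ω)}) atTop (𝓝 0) := Iff.rfl

theorem whp_iff {E : ℕ → Ω → Prop} : Whp Pr E ↔ ∀ᶠ x in inProb Pr, E x.1 x.2 := Iff.rfl

theorem eventually_inProb_of_forall_le {E : ℕ × Ω → Prop}
    (h : ∀ η : ℝ≥0∞, 0 < η → ∀ᶠ N in atTop, Pr {ω | ¬ E (N, ω)} ≤ η) :
    ∀ᶠ x in inProb Pr, E x :=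
  eventually_inProb.2 (ENNReal.tendsto_nhds_zero.2 fun η hη => h η hη)

theorem Eventually.inProb_le {E : ℕ × Ω → Prop} (h : ∀ᶠ x in inProb Pr, E x) {η : ℝ≥0∞}
    (hη : 0 < η) : ∀ᶠ N in atTop, Pr {ω | ¬ E (N, ω)} ≤ η :=
  ENNReal.tendsto_nhds_zero.1 (eventually_inProb.1 h) η hη

theorem littleOP_iff {X : ℕ → Ω → ℝ≥0∞} :
    LittleOP Pr X ↔ Tendsto (fun x : ℕ × Ω => X x.1 x.2) (inProb Pr) (𝓝 0) := by
  constructor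
  · intro h
    refine ENNReal.tendsto_nhds_zero.2 fun ε hε => ?_
    have := h ε hε
    refine (eventually_inProb (E := fun x => X x.1 x.2 < ε)).2 ?_ |>.mono fun x hx => hx.le
    simpa using this
  · intro h ε hε
    have : ∀ᶠ x in inProb Pr, X x.1 x.2 < ε := h.eventually_lt_const hε
    simpa using eventually_inProb.1 this

theorem tendstoInMeasure_iff_inProb {E : Type*} [PseudoMetricSpace E] {f : ℕ → Ω → E} {c : E} :
    TendstoInMeasure Pr f atTop (fun _ => c) ↔
      Tendsto (fun x : ℕ × Ω => f x.1 x.2) (inProb Pr) (𝓝 c) := by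
  rw [tendstoInMeasure_iff_dist, Metric.tendsto_nhds]
  refine forall₂_congr fun ε hε => ?_
  rw [eventually_inProb]
  simp

theorem eventually_inProb_of_ae {E : ℕ → Ω → Prop} (h : ∀ N, ∀ᵐ ω ∂Pr, E N ω) :
    ∀ᶠ x in inProb Pr, E x.1 x.2 := by
  refine eventually_inProb.2 (Tendsto.congr (fun N => ?_) tendsto_const_nhds)
  exact (h N).symm

/-- Boundedness in probability. -/
def BddInProb (Pr : Measure Ω) (X : ℕ × Ω → ℝ) : Prop :=
  ∀ η : ℝ≥0∞, 0 < η → ∃ c : ℝ, ∀ᶠ N in atTop, Pr {ω | c ≤ |X (N, ω)|} ≤ η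

/-- O_P(1) times o_P(1) is o_P(1): outside the two exceptional events one factor is at most `c'` and
the other is below `ε / c'`. -/
theorem BddInProb.tendsto_mul_zero {X e : ℕ × Ω → ℝ} (hX : BddInProb Pr X)
    (he : Tendsto e (inProb Pr) (𝓝 0)) :
    Tendsto (fun x => e x * X x) (inProb Pr) (𝓝 0) := by
  refine Metric.tendsto_nhds.2 fun ε hε => eventually_inProb_of_forall_le fun η hη => ?_
  have hη2 : 0 < η / 2 := ENNReal.half_pos hη.ne'
  obtain ⟨c, hc⟩ := hX (η / 2) hη2
  -- The bound `c` may be nonpositive; `c'` is a positive bound by which `ε` can be divided.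
  set c' := max c 1 with hc'
  have hc'0 : 0 < c' := lt_of_lt_of_le one_pos (le_max_right _ _)
  have he' : ∀ᶠ x in inProb Pr, dist (e x) 0 < ε / c' :=
    Metric.tendsto_nhds.1 he _ (div_pos hε hc'0)
  filter_upwards [hc, Eventually.inProb_le he' hη2] with N h1 h2
  calc _ ≤ Pr ({ω | c ≤ |X (N, ω)|} ∪ {ω | ¬ dist (e (N, ω)) 0 < ε / c'}) := by
        refine measure_mono fun ω hω => ?_
        by_contra hcon
        simp only [Set.mem_union, Set.mem_ofPred_eq, not_or, not_not, not_le] at hcon hω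
        refine hω ?_
        rw [Real.dist_0_eq_abs] at hcon ⊢
        rw [abs_mul]
        calc |e (N, ω)| * |X (N, ω)| ≤ |e (N, ω)| * c' := by
              gcongr; exact hcon.1.le.trans (le_max_left _ _)
          _ < ε / c' * c' := by gcongr; exact hcon.2
          _ = ε := by field_simp
    _ ≤ η / 2 + η / 2 := (measure_union_le _ _).trans (add_le_add h1 h2)
    _ = η := ENNReal.add_halves η

theorem tendsto_inProb_of_ae_tendsto [IsFiniteMeasure Pr] {E : Type*} [PseudoMetricSpace E]
    {f : ℕ → Ω → E} {c : E} (hf : ∀ N, AEStronglyMeasurable (f N) Pr)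
    (h : ∀ᵐ ω ∂Pr, Tendsto (fun N => f N ω) atTop (𝓝 c)) :
    Tendsto (fun x : ℕ × Ω => f x.1 x.2) (inProb Pr) (𝓝 c) :=
  tendstoInMeasure_iff_inProb.1 (tendstoInMeasure_of_tendsto_ae hf h)

/-- Weak limits are tight. The sets `{n ≤ ‖x‖}` decrease to the empty set, so the limit law gives
one of them mass below `η`; being closed, it eventually has mass below `η` under the approximating
laws by the portmanteau theorem. -/
theorem _root_.MeasureTheory.TendstoInDistribution.bddInProb [IsProbabilityMeasure Pr] {p : ℕ}
    {ν : Measure (Vec p)} [IsProbabilityMeasure ν] {X : ℕ → Ω → Vec p}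
    (h : TendstoInDistribution X atTop (id : Vec p → Vec p) (fun _ => Pr) ν) :
    BddInProb Pr fun x => ‖X x.1 x.2‖ := by
  intro η hη
  have hlim : Tendsto (fun n : ℕ => ν {x : Vec p | (n : ℝ) ≤ ‖x‖}) atTop (𝓝 0) := by
    have : (⋂ n : ℕ, {x : Vec p | (n : ℝ) ≤ ‖x‖}) = ∅ := by
      ext x
      simp only [Set.mem_iInter, Set.mem_ofPred_eq, Set.mem_empty_iff_false, iff_false, not_forall,
        not_le]
      exact exists_nat_gt ‖x‖
    rw [← measure_empty (μ := ν), ← this]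
    refine tendsto_measure_iInter_atTop (fun n => ?_) (fun m n hmn x hx => ?_)
      ⟨0, measure_ne_top _ _⟩
    · exact (measurableSet_le measurable_const measurable_norm).nullMeasurableSet
    · exact le_trans (by exact_mod_cast hmn : (m : ℝ) ≤ n) hx
  obtain ⟨n, hn⟩ := ((hlim.eventually_lt_const hη)).exists
  refine ⟨n, ?_⟩
  have hcl : IsClosed {x : Vec p | (n : ℝ) ≤ ‖x‖} := isClosed_le continuous_const continuous_norm
  have hls := ProbabilityMeasure.limsup_measure_closed_le_of_tendsto h.tendsto hcl
  have hlt : limsup (fun N => (Pr.map (X N)) {x : Vec p | (n : ℝ) ≤ ‖x‖}) atTop < η := by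
    refine lt_of_le_of_lt hls ?_
    simpa using hn
  filter_upwards [eventually_lt_of_limsup_lt hlt] with N hN
  rw [Measure.map_apply_of_aemeasurable (h.forall_aemeasurable N) hcl.measurableSet] at hN
  simpa using hN.le

end inProb

/-! ### A uniform law of large numbers -/

section ULLN

/-- A map into `C(Y, ℝ)` is measurable when its evaluations are. -/
theorem measurable_continuousMap {α Y : Type*} [MeasurableSpace α] [MetricSpace Y] [CompactSpace Y]
    [MeasurableSpace C(Y, ℝ)] [BorelSpace C(Y, ℝ)] {F : α → C(Y, ℝ)}
    (hF : ∀ y, Measurable fun a => F a y) : Measurable F := by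
  have hball : ∀ (h : C(Y, ℝ)) (ρ : ℝ), MeasurableSet (F ⁻¹' Metric.closedBall h ρ) := by
    intro h ρ
    rcases lt_or_ge ρ 0 with hρ | hρ
    · simp [Metric.closedBall_eq_empty.2 hρ]
    obtain ⟨D, hDc, hDd⟩ := TopologicalSpace.exists_countable_dense Y
    -- By continuity, the sup-norm inequality need only be checked at the points of a countable
    -- dense set, so a closed ball involves countably many evaluations.
    have : F ⁻¹' Metric.closedBall h ρ = ⋂ y ∈ D, {a | dist (F a y) (h y) ≤ ρ} := by
      ext a
      simp only [Set.mem_preimage, Metric.mem_closedBall, Set.mem_iInter, Set.mem_ofPred_eq]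
      rw [ContinuousMap.dist_le hρ]
      refine ⟨fun H y _ => H y, fun H y => ?_⟩
      have hcl : IsClosed {y | dist (F a y) (h y) ≤ ρ} :=
        isClosed_le (by fun_prop) continuous_const
      have : closure D ⊆ {y | dist (F a y) (h y) ≤ ρ} := hcl.closure_subset_iff.2 fun y hy => H y hy
      exact this (hDd.closure_eq ▸ Set.mem_univ y)
    rw [this]
    exact MeasurableSet.biInter hDc fun y _ =>
      measurableSet_le ((hF y).dist measurable_const) measurable_const
  have hb : ∀ (h : C(Y, ℝ)) (ρ : ℝ), MeasurableSet (F ⁻¹' Metric.ball h ρ) := by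
    intro h ρ
    have : Metric.ball h ρ = ⋃ n : ℕ, Metric.closedBall h (ρ - 1 / (n + 1)) := by
      ext g
      simp only [Metric.mem_ball, Set.mem_iUnion, Metric.mem_closedBall]
      constructor
      · intro hg
        obtain ⟨n, hn⟩ := exists_nat_one_div_lt (sub_pos.2 hg)
        exact ⟨n, by linarith⟩
      · rintro ⟨n, hn⟩
        have : (0 : ℝ) < 1 / (n + 1) := by positivity
        linarith
    rw [this, Set.preimage_iUnion]
    exact MeasurableSet.iUnion fun n => hball _ _
  refine measurable_of_isOpen fun U hU => ?_
  obtain ⟨D, hDc, hDd⟩ := TopologicalSpace.exists_countable_dense C(Y, ℝ)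
  -- `C(Y, ℝ)` is separable, so every open set is a countable union of balls with centers in `D` and
  -- radii `1 / (n + 1)`.
  have : U = ⋃ h ∈ D, ⋃ n ∈ {n : ℕ | Metric.ball h (1 / ((n : ℝ) + 1)) ⊆ U},
      Metric.ball h (1 / ((n : ℝ) + 1)) := by
    refine Set.Subset.antisymm (fun g hg => ?_) ?_
    · obtain ⟨ε, hε, hεU⟩ := Metric.isOpen_iff.1 hU g hg
      obtain ⟨n, hn⟩ := exists_nat_one_div_lt (half_pos hε)
      obtain ⟨h, hhD, hh⟩ := Metric.dense_iff.1 hDd g (1 / ((n : ℝ) + 1)) (by positivity)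
      simp only [Set.mem_iUnion]
      refine ⟨h, hh, n, ?_, ?_⟩
      · intro g' hg'
        refine hεU ?_
        rw [Metric.mem_ball] at *
        calc dist g' g ≤ dist g' h + dist h g := dist_triangle _ _ _
          _ < ε := by linarith
      · rw [Metric.mem_ball, dist_comm]; exact hhD
    · simp only [Set.iUnion_subset_iff]
      exact fun h _ n hn => hn
  rw [this]
  simp only [Set.preimage_iUnion]
  exact MeasurableSet.biUnion hDc fun h _ => MeasurableSet.biUnion (Set.to_countable _)
    fun n _ => hb _ _

variable {Ω 𝒳 : Type*} [MeasurableSpace Ω] [MeasurableSpace 𝒳] {Pr : Measure Ω}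
  [IsProbabilityMeasure Pr] {P : Measure 𝒳} {O : ℕ → Ω → 𝒳}

/-- The uniform law of large numbers over a compact parameter set, along a subsequence of sample
sizes. -/
theorem tendstoUniformlyOn_average {V : Type*} [MetricSpace V]
    (hmeas : ∀ i, Measurable (O i)) (hlaw : ∀ i, Measure.map (O i) Pr = P) (hind : iIndepFun O Pr)
    {f : V → 𝒳 → ℝ} {B : Set V} (hB : IsCompact B) (hf : ∀ b, Measurable (f b))
    (hcont : ∀ x, Continuous fun b => f b x) {H : 𝒳 → ℝ} (hH : Integrable H P)
    (hbd : ∀ᵐ x ∂P, ∀ b ∈ B, |f b x| ≤ H x) {u : ℕ → ℕ} (hu : Tendsto u atTop atTop) :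
    TendstoUniformlyOn (fun (x : ℕ × Ω) b => (u x.1 : ℝ)⁻¹ * ∑ i : Fin (u x.1), f b (O i x.2))
      (fun b => ∫ x, f b x ∂P) (inProb Pr) B := by
  have : CompactSpace B := isCompact_iff_compactSpace.1 hB
  let : MeasurableSpace C(B, ℝ) := borel _
  have : BorelSpace C(B, ℝ) := ⟨rfl⟩
  -- Each observation becomes a random element of the separable Banach space `C(B, ℝ)`. Its strong
  -- law, read in the sup norm, is the uniform law.
  let F : 𝒳 → C(B, ℝ) := fun x => ⟨fun b => f b x, (hcont x).comp continuous_subtype_val⟩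
  have hFm : Measurable F := measurable_continuousMap fun b => hf b
  have hFint : Integrable F P := by
    refine ⟨hFm.aestronglyMeasurable, ?_⟩
    refine ContinuousMap.hasFiniteIntegral_of_bound F H hH.2 ?_
    filter_upwards [hbd] with x hx b
    exact hx b b.2
  have hident : ∀ i, IdentDistrib (fun ω => F (O i ω)) (fun ω => F (O 0 ω)) Pr Pr := fun i =>
    (show IdentDistrib (O i) (O 0) Pr Pr from
      ⟨(hmeas i).aemeasurable, (hmeas 0).aemeasurable, by rw [hlaw, hlaw]⟩).comp hFm
  have hFint0 : Integrable (fun ω => F (O 0 ω)) Pr := by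
    have := hFint
    rw [← hlaw 0] at this
    exact this.comp_measurable (hmeas 0)
  have hsl := strong_law_ae (μ := Pr) (fun i ω => F (O i ω)) hFint0
    (fun i j hij => (hind.indepFun hij).comp hFm hFm) hident
  have hmean : ∫ ω, F (O 0 ω) ∂Pr = ∫ x, F x ∂P := by
    rw [← hlaw 0, integral_map (hmeas 0).aemeasurable hFm.aestronglyMeasurable]
  have key := tendsto_inProb_of_ae_tendsto (Pr := Pr)
    (f := fun N ω => (u N : ℝ)⁻¹ • ∑ i ∈ Finset.range (u N), F (O i ω)) (c := ∫ x, F x ∂P)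
    (fun N => by
      have : Measurable fun ω => ∑ i ∈ Finset.range (u N), F (O i ω) :=
        Finset.measurable_fun_sum _ fun i _ => hFm.comp (hmeas i)
      exact (this.const_smul ((u N : ℝ)⁻¹)).aestronglyMeasurable)
    (by
      filter_upwards [hsl] with ω hω
      rw [← hmean]
      exact hω.comp hu)
  rw [Metric.tendstoUniformlyOn_iff]
  intro ε hε
  filter_upwards [Metric.tendsto_nhds.1 key ε hε] with x hx b hb
  rw [dist_comm]
  refine lt_of_le_of_lt (le_of_eq ?_) (lt_of_le_of_lt
    (ContinuousMap.dist_apply_le_dist (⟨b, hb⟩ : B)) hx)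
  congr 1
  · simp [F, Finset.sum_range]
  · rw [ContinuousMap.integral_apply hFint]
    rfl

end ULLN

/-! ### Conditioning on the training sample -/

section crossfit

variable {T q K : ℕ} {Ω : Type*} [MeasurableSpace Ω] {Pr : Measure Ω} [IsProbabilityMeasure Pr]
  {P : Measure (Traj T q)} [IsProbabilityMeasure P] {O : ℕ → Ω → Traj T q}
  {fold : ∀ N : ℕ, Ω → Fin (K * N) → Fin K}

/-- A sample restricted to the `k`-th fold of the partition `π`. -/
abbrev Test (T q K N : ℕ) (π : Fin (K * N) → Fin K) (k : Fin K) : Type :=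
  {i : Fin (K * N) // ¬ π i ≠ k} → Traj T q

/-- The observations in the `k`-th fold. -/
def test (O : ℕ → Ω → Traj T q) (fold : ∀ N : ℕ, Ω → Fin (K * N) → Fin K) (N : ℕ) (k : Fin K)
    (ω : Ω) : Test T q K N (fold N ω) k := fun i => O i.1 ω

/-- For a fixed partition, the training and the test sample are independent. -/
theorem Sampling.map_train_test (hs : Sampling Pr P O fold) (N : ℕ) (π : Fin (K * N) → Fin K)
    (k : Fin K) :
    Pr.map (fun ω => ((fun i => O i.1 ω : Train T q K N π k),
      (fun i => O i.1 ω : Test T q K N π k)))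
      = (Measure.pi fun _ => P).prod (Measure.pi fun _ => P) := by
  have h1 : Pr.map (fun ω (i : Fin (K * N)) => O i ω) = Measure.pi fun _ => P := by
    have := (iIndepFun_iff_map_fun_eq_pi_map (μ := Pr)
      (f := fun (i : Fin (K * N)) ω => O i ω) fun i => (hs.meas i).aemeasurable).1
      (hs.indep.precomp Fin.val_injective)
    rw [this]
    simp only [hs.law]
  -- The product measure splits along a predicate and its negation. Indexing the test sample by `¬ π
  -- i ≠ k` makes it literally the second factor.
  have h2 := measurePreserving_piEquivPiSubtypeProd
    (fun _ : Fin (K * N) => P) (fun i => π i ≠ k)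
  rw [← h2.map_eq, ← h1, Measure.map_map h2.measurable
    (measurable_pi_lambda _ fun i => hs.meas i)]
  rfl

/-- If a set of training and test samples has small conditional probability given the training
sample, then it has small probability. -/
theorem Sampling.measure_le (hs : Sampling Pr P O fold) (N : ℕ) (k : Fin K)
    (A : ∀ π, Set (Train T q K N π k × Test T q K N π k)) (hA : ∀ π, MeasurableSet (A π))
    (c : ℝ≥0∞)
    (h : ∀ π z, (Finset.univ.filter fun i => π i = k).card = N →
      Measure.pi (fun _ => P) {y | (z, y) ∈ A π} ≤ c) :
    Pr {ω | (train O fold N k ω, test O fold N k ω) ∈ A (fold N ω)} ≤ c := by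
  -- The type of the training sample depends on the random partition. The partition is therefore
  -- frozen at each of its finitely many values, and the events are summed at the end.
  let X : ∀ π : Fin (K * N) → Fin K, Ω → Train T q K N π k × Test T q K N π k :=
    fun π ω => (fun i => O i.1 ω, fun i => O i.1 ω)
  have hX : ∀ π, Measurable (X π) := fun π =>
    (measurable_pi_lambda _ fun i : {i // π i ≠ k} => hs.meas i.1).prodMk
      (measurable_pi_lambda _ fun i : {i // ¬ π i ≠ k} => hs.meas i.1)
  have hle : ∀ π, Pr ({ω | fold N ω = π} ∩ X π ⁻¹' A π) ≤ Pr {ω | fold N ω = π} * c := by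
    intro π
    by_cases hπ : (Finset.univ.filter fun i => π i = k).card = N
    · have h1 : Pr (X π ⁻¹' A π) ≤ c := by
        rw [← Measure.map_apply (hX π) (hA π), hs.map_train_test, Measure.prod_apply (hA π)]
        calc _ ≤ ∫⁻ _ : Train T q K N π k, c ∂Measure.pi (fun _ => P) :=
              lintegral_mono fun z => h π z hπ
          _ = c := by simp
      let g : (ℕ → Traj T q) → Train T q K N π k × Test T q K N π k :=
        fun x => (fun i => x i.1, fun i => x i.1)
      have hg : Measurable g := (measurable_pi_lambda _ fun i => measurable_pi_apply _).prodMk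
        (measurable_pi_lambda _ fun i => measurable_pi_apply _)
      have h2 := (hs.fold_indep N).measure_inter_preimage_eq_mul {π} (g ⁻¹' A π)
        (measurableSet_singleton _) (hg (hA π))
      calc _ = Pr (fold N ⁻¹' {π} ∩ (fun ω i => O i ω) ⁻¹' (g ⁻¹' A π)) := rfl
        _ = Pr {ω | fold N ω = π} * Pr (X π ⁻¹' A π) := h2
        _ ≤ _ := by gcongr
    -- A partition whose `k`-th block has the wrong size never occurs, so nothing is needed about
    -- it.
    · have : {ω | fold N ω = π} = ∅ := by
        ext ω
        simp only [Set.mem_ofPred_eq, Set.mem_empty_iff_false, iff_false]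
        rintro rfl
        exact hπ (hs.fold_size N ω k)
      simp [this]
  calc _ ≤ Pr (⋃ π, ({ω | fold N ω = π} ∩ X π ⁻¹' A π)) := by
        refine measure_mono fun ω hω => ?_
        exact Set.mem_iUnion.2 ⟨fold N ω, rfl, hω⟩
    _ ≤ ∑ π, Pr ({ω | fold N ω = π} ∩ X π ⁻¹' A π) := measure_iUnion_fintype_le _ _
    _ ≤ ∑ π, Pr {ω | fold N ω = π} * c := Finset.sum_le_sum fun π _ => hle π
    _ = (∑ π, Pr (fold N ⁻¹' {π})) * c := by rw [Finset.sum_mul]; rfl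
    _ = c := by
        rw [sum_measure_preimage_singleton _ fun π _ => hs.fold_meas N (measurableSet_singleton π)]
        simp

/-- A bound on conditional probabilities given the training sample that tends to zero in
probability controls the probability of an event. -/
theorem Sampling.eventually_of_conditional (hs : Sampling Pr P O fold) (k : Fin K) {κ : ℝ≥0∞}
    (hκ : κ ≠ ⊤) {Q : ∀ N π, Train T q K N π k → ℝ≥0∞} (hQ : ∀ N π, Measurable (Q N π))
    {G : ∀ N π, Set (Train T q K N π k)} (hG : ∀ N π, MeasurableSet (G N π))
    {A : ∀ N π, Set (Train T q K N π k × Test T q K N π k)} (hA : ∀ N π, MeasurableSet (A N π))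
    (h : ∀ N π z, (Finset.univ.filter fun i => π i = k).card = N → z ∈ G N π → Q N π z ≠ ⊤ →
      Measure.pi (fun _ => P) {y | (z, y) ∈ A N π} ≤ κ * Q N π z)
    (hQ0 : Tendsto (fun x : ℕ × Ω => Q x.1 (fold x.1 x.2) (train O fold x.1 k x.2))
      (inProb Pr) (𝓝 0))
    (hG1 : ∀ᶠ x in inProb Pr, train O fold x.1 k x.2 ∈ G x.1 (fold x.1 x.2)) :
    ∀ᶠ x in inProb Pr, (train O fold x.1 k x.2, test O fold x.1 k x.2) ∉ A x.1 (fold x.1 x.2) := by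
  refine eventually_inProb_of_forall_le fun η hη => ?_
  have hη2 : 0 < η / 2 := ENNReal.half_pos hη.ne'
  obtain ⟨c, hc0, hc⟩ : ∃ c : ℝ≥0∞, 0 < c ∧ κ * c ≤ η / 2 := by
    have : Tendsto (fun c : ℝ≥0∞ => κ * c) (𝓝[>] 0) (𝓝 (κ * 0)) :=
      (ENNReal.Tendsto.const_mul tendsto_id (Or.inr hκ)).mono_left nhdsWithin_le_nhds
    rw [mul_zero] at this
    obtain ⟨c, hc1, hc2⟩ :=
      ((ENNReal.tendsto_nhds_zero.1 this (η / 2) hη2).and self_mem_nhdsWithin).exists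
    exact ⟨c, hc2, hc1⟩
  have hgood : ∀ᶠ x in inProb Pr, Q x.1 (fold x.1 x.2) (train O fold x.1 k x.2) < c ∧
      train O fold x.1 k x.2 ∈ G x.1 (fold x.1 x.2) := (hQ0.eventually_lt_const hc0).and hG1
  filter_upwards [Eventually.inProb_le hgood hη2] with N hN
  -- Restricting to training samples with `Q < c` in the good set makes the conditional bound
  -- uniform, equal to `κ * c`. The discarded training samples are counted in the other half of `η`.
  let A' : ∀ π, Set (Train T q K N π k × Test T q K N π k) :=
    fun π => A N π ∩ {x | Q N π x.1 < c ∧ x.1 ∈ G N π}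
  have hA' : ∀ π, MeasurableSet (A' π) := fun π => (hA N π).inter
    ((measurableSet_lt ((hQ N π).comp measurable_fst) measurable_const).inter
      (measurable_fst (hG N π)))
  have hb := hs.measure_le N k A' hA' (η / 2) (by
    intro π z hπ
    by_cases hz : Q N π z < c ∧ z ∈ G N π
    · calc _ ≤ Measure.pi (fun _ => P) {y | (z, y) ∈ A N π} :=
            measure_mono fun y hy => hy.1
        _ ≤ κ * Q N π z := h N π z hπ hz.2 hz.1.ne_top
        _ ≤ κ * c := by gcongr; exact hz.1.le
        _ ≤ η / 2 := hc
    · have : {y : Test T q K N π k | (z, y) ∈ A' π} = ∅ := by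
        ext y
        simp only [Set.mem_ofPred_eq, Set.mem_empty_iff_false, iff_false]
        exact fun hy => hz hy.2
      rw [this]; simp)
  calc _ ≤ Pr ({ω | ¬ (Q N (fold N ω) (train O fold N k ω) < c ∧
          train O fold N k ω ∈ G N (fold N ω))} ∪
        {ω | (train O fold N k ω, test O fold N k ω) ∈ A' (fold N ω)}) := by
        refine measure_mono fun ω hω => ?_
        by_cases hg : Q N (fold N ω) (train O fold N k ω) < c ∧
          train O fold N k ω ∈ G N (fold N ω)
        · exact Or.inr ⟨not_not.1 hω, hg⟩
        · exact Or.inl hg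
    _ ≤ η / 2 + η / 2 := (measure_union_le _ _).trans (add_le_add hN hb)
    _ = η := ENNReal.add_halves η

theorem sum_fold_eq_sum_subtype {N : ℕ} {E : Type*} [AddCommMonoid E] (π : Fin (K * N) → Fin K)
    (k : Fin K) (F : Fin (K * N) → E) :
    ∑ i ∈ Finset.univ.filter (fun i => π i = k), F i = ∑ i : {i // ¬ π i ≠ k}, F i.1 :=
  Finset.sum_subtype _ (by simp) F

theorem card_subtype_fold {N : ℕ} {π : Fin (K * N) → Fin K} {k : Fin K}
    (h : (Finset.univ.filter fun i => π i = k).card = N) :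
    Fintype.card {i // ¬ π i ≠ k} = N := by
  rw [Fintype.card_subtype]
  simpa using h

/-- Conditional Markov inequality: the average over a fold of a nonnegative function fitted outside
the fold tends to zero when its integral does. -/
theorem Sampling.tendsto_fold_lintegral (hs : Sampling Pr P O fold) (k : Fin K)
    {f : ∀ N π, Train T q K N π k → Traj T q → ℝ≥0∞}
    (hf : ∀ N π, Measurable fun x : Train T q K N π k × Traj T q => f N π x.1 x.2)
    (h : Tendsto (fun x : ℕ × Ω => ∫⁻ o, f x.1 (fold x.1 x.2) (train O fold x.1 k x.2) o ∂P)
      (inProb Pr) (𝓝 0)) :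
    Tendsto (fun x : ℕ × Ω => (x.1 : ℝ≥0∞)⁻¹ *
      ∑ i ∈ Finset.univ.filter (fun i => fold x.1 x.2 i = k),
        f x.1 (fold x.1 x.2) (train O fold x.1 k x.2) (O i x.2)) (inProb Pr) (𝓝 0) := by
  refine ENNReal.tendsto_nhds_zero.2 fun ε hε => ?_
  -- Markov's inequality divides by `ε`; for `ε = ⊤` there is nothing to prove.
  wlog hε' : ε ≠ ⊤ generalizing ε
  · simp only [ne_eq, not_not] at hε'
    simp [hε']
  have hfz : ∀ N π z, Measurable (f N π z) := fun N π z => (hf N π).comp measurable_prodMk_left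
  have hsum : ∀ N π, Measurable fun x : Train T q K N π k × Test T q K N π k =>
      (N : ℝ≥0∞)⁻¹ * ∑ i, f N π x.1 (x.2 i) := fun N π =>
    (Finset.measurable_fun_sum _ fun i _ => (hf N π).comp
      (measurable_fst.prodMk ((measurable_pi_apply i).comp measurable_snd))).const_mul _
  have key := hs.eventually_of_conditional k (κ := ε⁻¹) (ENNReal.inv_ne_top.2 hε.ne')
    (Q := fun N π z => ∫⁻ o, f N π z o ∂P) (fun N π => (hf N π).lintegral_prod_right')
    (G := fun N π => Set.univ) (fun _ _ => MeasurableSet.univ)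
    (A := fun N π => {x | ε ≤ (N : ℝ≥0∞)⁻¹ * ∑ i, f N π x.1 (x.2 i)})
    (fun N π => measurableSet_le measurable_const (hsum N π))
    (fun N π z hπ _ _ => by
      have h1 := mul_meas_ge_le_lintegral (μ := Measure.pi fun _ => P)
        (f := fun y : Test T q K N π k => (N : ℝ≥0∞)⁻¹ * ∑ i, f N π z (y i))
        ((hsum N π).comp measurable_prodMk_left) ε
      have h2 : ∫⁻ y : Test T q K N π k, (N : ℝ≥0∞)⁻¹ * ∑ i, f N π z (y i)
          ∂(Measure.pi fun _ => P) ≤ ∫⁻ o, f N π z o ∂P := by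
        have hm : ∀ i, Measurable fun y : Test T q K N π k => f N π z (y i) := fun i =>
          (hfz N π z).comp (measurable_pi_apply i)
        rw [lintegral_const_mul _ (Finset.measurable_fun_sum _ fun i _ => hm i),
          lintegral_finsetSum _ fun i _ => hm i]
        have : ∀ i, ∫⁻ y : Test T q K N π k, f N π z (y i) ∂(Measure.pi fun _ => P)
            = ∫⁻ o, f N π z o ∂P := fun i =>
          (measurePreserving_eval (fun _ : {i // ¬ π i ≠ k} => P) i).lintegral_comp (hfz N π z)
        simp only [this, Finset.sum_const, Finset.card_univ, card_subtype_fold hπ, nsmul_eq_mul]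
        rw [← mul_assoc]
        -- An inequality instead of `N⁻¹ * N = 1`, so that `N = 0` is included.
        exact mul_le_of_le_one_left zero_le (ENNReal.inv_mul_le_one _)
      rw [mul_comm ε⁻¹, ← div_eq_mul_inv]
      refine (ENNReal.le_div_iff_mul_le (Or.inl hε.ne') (Or.inl hε')).2 ?_
      rw [mul_comm]
      exact h1.trans h2)
    h (Eventually.of_forall fun _ => trivial)
  filter_upwards [key] with x hx
  rw [sum_fold_eq_sum_subtype]
  exact (not_le.1 hx).le

/-- Conditional Chebyshev inequality: the normalized sum over a fold of a centered function fitted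
outside the fold tends to zero when its second moment does. -/
theorem Sampling.tendsto_fold_centered (hs : Sampling Pr P O fold) (k : Fin K)
    {f : ∀ N π, Train T q K N π k → Traj T q → ℝ}
    (hf : ∀ N π, Measurable fun x : Train T q K N π k × Traj T q => f N π x.1 x.2)
    (h : Tendsto (fun x : ℕ × Ω =>
      ∫⁻ o, ENNReal.ofReal (f x.1 (fold x.1 x.2) (train O fold x.1 k x.2) o ^ 2) ∂P)
      (inProb Pr) (𝓝 0))
    (h0 : ∀ᶠ x in inProb Pr, ∫ o, f x.1 (fold x.1 x.2) (train O fold x.1 k x.2) o ∂P = 0) :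
    Tendsto (fun x : ℕ × Ω => (√(x.1 : ℝ))⁻¹ *
      ∑ i ∈ Finset.univ.filter (fun i => fold x.1 x.2 i = k),
        f x.1 (fold x.1 x.2) (train O fold x.1 k x.2) (O i x.2)) (inProb Pr) (𝓝 0) := by
  refine Metric.tendsto_nhds.2 fun ε hε => ?_
  have hfz : ∀ N π z, Measurable (f N π z) := fun N π z => (hf N π).comp measurable_prodMk_left
  have hsum : ∀ N π, Measurable fun x : Train T q K N π k × Test T q K N π k =>
      (√(N : ℝ))⁻¹ * ∑ i, f N π x.1 (x.2 i) := fun N π =>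
    (Finset.measurable_fun_sum _ fun i _ => (hf N π).comp
      (measurable_fst.prodMk ((measurable_pi_apply i).comp measurable_snd))).const_mul _
  -- The sum over the fold has variance `N` times that of `f`, and the threshold is `ε * √N`:
  -- Chebyshev leaves the variance of `f` divided by `ε ^ 2`. Centering holds only with probability
  -- tending to one, so it is imposed through the good set.
  have key := hs.eventually_of_conditional k (κ := ENNReal.ofReal (1 / ε ^ 2)) ENNReal.ofReal_ne_top
    (Q := fun N π z => ∫⁻ o, ENNReal.ofReal (f N π z o ^ 2) ∂P)
    (fun N π => ((hf N π).pow_const 2).ennreal_ofReal.lintegral_prod_right')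
    (G := fun N π => {z | ∫ o, f N π z o ∂P = 0})
    (fun N π => measurableSet_eq_fun
      (hf N π).stronglyMeasurable.integral_prod_right'.measurable measurable_const)
    (A := fun N π => {x | ε ≤ |(√(N : ℝ))⁻¹ * ∑ i, f N π x.1 (x.2 i)|})
    (fun N π => measurableSet_le measurable_const (measurable_norm.comp (hsum N π)))
    (fun N π z hπ hz hQ => by
      have hsq : Integrable (fun o => f N π z o ^ 2) P := by
        refine ⟨((hfz N π z).pow_const 2).aestronglyMeasurable, ?_⟩
        rw [hasFiniteIntegral_iff_ofReal (ae_of_all _ fun o => sq_nonneg _)]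
        exact lt_top_iff_ne_top.2 hQ
      have hL2 : MemLp (f N π z) 2 P :=
        (memLp_two_iff_integrable_sq (hfz N π z).aestronglyMeasurable).2 hsq
      have hvar := variance_sum_pi (μ := fun _ : {i // ¬ π i ≠ k} => P)
        (X := fun _ => f N π z) fun _ => hL2
      have hL2i : ∀ i : {i // ¬ π i ≠ k}, MemLp (fun y : Test T q K N π k => f N π z (y i)) 2
          (Measure.pi fun _ => P) := fun i =>
        hL2.comp_measurePreserving (measurePreserving_eval (fun _ : {i // ¬ π i ≠ k} => P) i)
      have hL2s : MemLp (∑ i, fun y : Test T q K N π k => f N π z (y i)) 2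
          (Measure.pi fun _ => P) := memLp_finsetSum' _ fun i _ => hL2i i
      have hmean : ∫ y, (∑ i, fun y : Test T q K N π k => f N π z (y i)) y
          ∂(Measure.pi fun _ => P) = 0 := by
        simp only [Finset.sum_apply]
        rw [integral_finsetSum _ fun i _ => (hL2i i).integrable one_le_two]
        refine Finset.sum_eq_zero fun i _ => ?_
        have := (measurePreserving_eval (fun _ : {i // ¬ π i ≠ k} => P) i)
        rw [← hz]
        conv_rhs => rw [← this.map_eq]
        rw [integral_map this.measurable.aemeasurable (hfz N π z).aestronglyMeasurable]
      -- For `N = 0` the factor `(√0)⁻¹` is `0`, so the normalized sum cannot reach `ε`.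
      rcases Nat.eq_zero_or_pos N with hN | hN
      · subst hN
        have : {y : Test T q K 0 π k | (z, y) ∈
            {x : Train T q K 0 π k × Test T q K 0 π k |
              ε ≤ |(√((0 : ℕ) : ℝ))⁻¹ * ∑ i, f 0 π x.1 (x.2 i)|}} = ∅ := by
          ext y; simp [hε]
        rw [this]; simp
      have hNs : 0 < √(N : ℝ) := Real.sqrt_pos.2 (by exact_mod_cast hN)
      have hcheb := meas_ge_le_variance_div_sq hL2s (mul_pos hε hNs)
      rw [hmean, hvar] at hcheb
      simp only [sub_zero, Finset.sum_const, Finset.card_univ, card_subtype_fold hπ, nsmul_eq_mul,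
        Finset.sum_apply] at hcheb
      refine le_trans (measure_mono fun y hy => ?_) (hcheb.trans ?_)
      · simp only [Set.mem_ofPred_eq] at hy ⊢
        rw [abs_mul, abs_inv, abs_of_pos hNs, inv_mul_eq_div, le_div_iff₀ hNs] at hy
        exact hy
      · rw [← ofReal_integral_eq_lintegral_ofReal hsq (ae_of_all _ fun o => sq_nonneg _),
          ← ENNReal.ofReal_mul (by positivity)]
        refine ENNReal.ofReal_le_ofReal ?_
        have hv := variance_le_expectation_sq (hfz N π z).aestronglyMeasurable (μ := P)
        have hNr : (0 : ℝ) < N := by exact_mod_cast hN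
        rw [mul_pow, Real.sq_sqrt hNr.le]
        calc _ = 1 / ε ^ 2 * Var[f N π z; P] := by field_simp
          _ ≤ _ := by gcongr; simpa using hv)
    h h0
  filter_upwards [key] with x hx
  rw [sum_fold_eq_sum_subtype, Real.dist_0_eq_abs]
  exact not_le.1 hx

end crossfit

/-! ### The multivariate central limit theorem -/

section CLT

open scoped RealInnerProductSpace

variable {Ω 𝒳 : Type*} [MeasurableSpace Ω] [MeasurableSpace 𝒳] {Pr : Measure Ω}
  [IsProbabilityMeasure Pr] {P : Measure 𝒳} {O : ℕ → Ω → 𝒳} {p : ℕ}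

/-- The matrix of second moments of a random vector. -/
noncomputable def secondMoment (P : Measure 𝒳) (Ψ : 𝒳 → Vec p) : Matrix (Fin p) (Fin p) ℝ :=
  Matrix.of fun i j => ∫ x, Ψ x i * Ψ x j ∂P

theorem dotProduct_secondMoment_mulVec {Ψ : 𝒳 → Vec p} (hL2 : ∀ i, MemLp (fun x => Ψ x i) 2 P)
    (t : Fin p → ℝ) :
    t ⬝ᵥ secondMoment P Ψ *ᵥ t = ∫ x, (∑ i, Ψ x i * t i) ^ 2 ∂P := by
  have hint : ∀ i j, Integrable (fun x => Ψ x i * Ψ x j) P := fun i j =>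
    (hL2 i).integrable_mul (hL2 j)
  have : ∀ x, (∑ i, Ψ x i * t i) ^ 2 = ∑ i, ∑ j, t i * t j * (Ψ x i * Ψ x j) := by
    intro x
    rw [sq, Finset.sum_mul_sum]
    refine Finset.sum_congr rfl fun i _ => Finset.sum_congr rfl fun j _ => by ring
  simp only [this]
  rw [integral_finsetSum _ fun i _ => integrable_finsetSum _ fun j _ => (hint i j).const_mul _]
  simp only [dotProduct, Matrix.mulVec, Finset.mul_sum]
  refine Finset.sum_congr rfl fun i _ => ?_
  rw [integral_finsetSum _ fun j _ => (hint i j).const_mul _]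
  refine Finset.sum_congr rfl fun j _ => ?_
  rw [integral_const_mul]
  simp only [secondMoment, Matrix.of_apply]
  ring

theorem posSemidef_secondMoment {Ψ : 𝒳 → Vec p} (hL2 : ∀ i, MemLp (fun x => Ψ x i) 2 P) :
    (secondMoment P Ψ).PosSemidef := by
  refine Matrix.PosSemidef.of_dotProduct_mulVec_nonneg ?_ fun t => ?_
  · ext i j
    simp [secondMoment, mul_comm]
  · simp only [star_trivial]
    rw [dotProduct_secondMoment_mulVec hL2]
    exact integral_nonneg fun x => sq_nonneg _

/-- The Cramér–Wold device on characteristic functions: at `t`, the characteristic function of the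
vector sum is that of the scalar sum of `⟪Ψ, t⟫` at `1`. The one-dimensional central limit theorem
gives its limit, and Lévy's theorem turns this into convergence in distribution. The sizes `u N`
allow for `n = K * N`. -/
theorem tendstoInDistribution_inv_sqrt_smul_sum (hmeas : ∀ i, Measurable (O i))
    (hlaw : ∀ i, Measure.map (O i) Pr = P) (hind : iIndepFun O Pr) {Ψ : 𝒳 → Vec p}
    (hΨ : Measurable Ψ) (hL2 : ∀ i, MemLp (fun x => Ψ x i) 2 P) (h0 : ∀ i, ∫ x, Ψ x i ∂P = 0)
    {u : ℕ → ℕ} (hu : Tendsto u atTop atTop) :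
    TendstoInDistribution (fun N ω => (√(u N : ℝ))⁻¹ • ∑ i : Fin (u N), Ψ (O i ω)) atTop
      (id : Vec p → Vec p) (fun _ => Pr) (multivariateGaussian 0 (secondMoment P Ψ)) := by
  have hZm : ∀ N, Measurable fun ω => (√(u N : ℝ))⁻¹ • ∑ i : Fin (u N), Ψ (O i ω) := fun N => by
    have : Measurable fun ω => ∑ i : Fin (u N), Ψ (O i ω) :=
      Finset.measurable_fun_sum _ fun i _ => hΨ.comp (hmeas i)
    exact this.const_smul (√(u N : ℝ))⁻¹
  refine ⟨fun N => (hZm N).aemeasurable, aemeasurable_id, ?_⟩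
  refine ProbabilityMeasure.tendsto_iff_tendsto_charFun.2 fun t => ?_
  have hform : ∀ x, ⟪Ψ x, t⟫ = ∑ i, Ψ x i * t i := fun x => by
    simp [PiLp.inner_apply, mul_comm]
  have hlm : Measurable fun x => ⟪Ψ x, t⟫ := hΨ.inner measurable_const
  have hL : MemLp (fun x => ⟪Ψ x, t⟫) 2 P := by
    simp only [hform]
    exact memLp_finsetSum _ fun i _ => (hL2 i).mul_const _
  have hL0 : MemLp (fun ω => ⟪Ψ (O 0 ω), t⟫) 2 Pr := by
    have := hL
    rw [← hlaw 0] at this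
    exact this.comp_measurePreserving ⟨hmeas 0, rfl⟩
  have hprob : IsProbabilityMeasure P := by
    rw [← hlaw 0]; exact Measure.isProbabilityMeasure_map (hmeas 0).aemeasurable
  have hmean : ∫ x, ⟪Ψ x, t⟫ ∂P = 0 := by
    simp only [hform]
    rw [integral_finsetSum _ fun i _ => ((hL2 i).integrable one_le_two).mul_const _]
    refine Finset.sum_eq_zero fun i _ => ?_
    rw [integral_mul_const, h0, zero_mul]
  have hmean0 : ∫ ω, ⟪Ψ (O 0 ω), t⟫ ∂Pr = 0 := by
    rw [← hmean, ← hlaw 0, integral_map (hmeas 0).aemeasurable hlm.aestronglyMeasurable]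
  have hlm0 : Measurable fun ω => ⟪Ψ (O 0 ω), t⟫ := hlm.comp (hmeas 0)
  have hvar : Var[fun ω => ⟪Ψ (O 0 ω), t⟫; Pr] = t ⬝ᵥ secondMoment P Ψ *ᵥ t := by
    rw [variance_of_integral_eq_zero hlm0.aemeasurable hmean0,
      dotProduct_secondMoment_mulVec hL2, ← hlaw 0,
      integral_map (hmeas 0).aemeasurable (by
        have := (hlm.pow_const 2).aestronglyMeasurable (μ := Measure.map (O 0) Pr)
        simpa only [hform] using this)]
    simp only [hform]
  have hclt := tendstoInDistribution_inv_sqrt_mul_sum_sub (P := Pr)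
    (X := fun i ω => ⟪Ψ (O i ω), t⟫) (Y := (id : ℝ → ℝ))
    (P' := gaussianReal 0 Var[fun ω => ⟪Ψ (O 0 ω), t⟫; Pr].toNNReal)
    ⟨aemeasurable_id, Measure.map_id⟩ hL0 (hind.comp (fun _ x => ⟪Ψ x, t⟫) fun _ => hlm)
    (fun i => (show IdentDistrib (O i) (O 0) Pr Pr from
      ⟨(hmeas i).aemeasurable, (hmeas 0).aemeasurable, by rw [hlaw, hlaw]⟩).comp hlm)
  have hcf := (ProbabilityMeasure.tendsto_iff_tendsto_charFun.1 hclt.tendsto 1).comp hu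
  have hps := posSemidef_secondMoment hL2
  have hlim : charFun (multivariateGaussian 0 (secondMoment P Ψ)) t
      = charFun (gaussianReal 0 Var[fun ω => ⟪Ψ (O 0 ω), t⟫; Pr].toNNReal) 1 := by
    rw [charFun_multivariateGaussian hps, charFun_gaussianReal, hvar, Real.coe_toNNReal]
    · simp
    · simpa using hps.dotProduct_mulVec_nonneg (WithLp.ofLp t)
  simp only [ProbabilityMeasure.coe_mk, Measure.map_id] at hcf ⊢
  rw [hlim]
  refine hcf.congr fun N => ?_
  simp only [Function.comp_apply]
  rw [hmean0]
  have hm2 : Measurable fun ω => (√(u N : ℝ))⁻¹ *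
      (∑ k ∈ Finset.range (u N), ⟪Ψ (O k ω), t⟫ - (u N : ℝ) * 0) :=
    ((Finset.measurable_fun_sum _ fun i _ => hlm.comp (hmeas i)).sub_const _).const_mul _
  rw [charFun_apply, charFun_apply, integral_map hm2.aemeasurable
    (Measurable.aestronglyMeasurable (by fun_prop)), integral_map (hZm N).aemeasurable
    (Measurable.aestronglyMeasurable (by fun_prop))]
  refine integral_congr_ae (ae_of_all _ fun ω => ?_)
  simp only [real_inner_smul_left, sum_inner]
  simp [Finset.sum_range]

end CLT

/-! ### Averages over the folds -/

section foldAvg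

variable {K N : ℕ} {E E' : Type*} [AddCommGroup E] [Module ℝ E] [AddCommGroup E'] [Module ℝ E']

theorem map_foldAvg (φ : E →ₗ[ℝ] E') (π : Fin (K * N) → Fin K) (F : Fin K → Fin (K * N) → E) :
    φ (foldAvg π F) = foldAvg π fun k i => φ (F k i) := by
  simp [foldAvg, avg, map_sum]

theorem foldAvg_sum {J : Type*} (s : Finset J) (π : Fin (K * N) → Fin K)
    (F : J → Fin K → Fin (K * N) → E) :
    (foldAvg π fun k i => ∑ j ∈ s, F j k i) = ∑ j ∈ s, foldAvg π (F j) := by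
  simp only [foldAvg, avg]
  rw [← Finset.smul_sum]
  congr 1
  rw [Finset.sum_comm]
  refine Finset.sum_congr rfl fun k _ => ?_
  rw [← Finset.smul_sum]
  congr 1
  rw [Finset.sum_comm]

theorem foldAvg_sub (π : Fin (K * N) → Fin K) (F G : Fin K → Fin (K * N) → E) :
    (foldAvg π fun k i => F k i - G k i) = foldAvg π F - foldAvg π G := by
  simp only [foldAvg, avg, Finset.sum_sub_distrib, smul_sub]

theorem foldAvg_eq {π : Fin (K * N) → Fin K}
    (h : ∀ k, (Finset.univ.filter fun i => π i = k).card = N) (F : Fin K → Fin (K * N) → E) :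
    foldAvg π F =
      (K : ℝ)⁻¹ • ∑ k, (N : ℝ)⁻¹ • ∑ i ∈ Finset.univ.filter (fun i => π i = k), F k i := by
  simp [foldAvg, avg, h]

/-- The folds have equal size and cover the sample, so the mean of the fold means of a common
function is the plain mean. -/
theorem foldAvg_const {π : Fin (K * N) → Fin K}
    (h : ∀ k, (Finset.univ.filter fun i => π i = k).card = N) (F : Fin (K * N) → E) :
    (foldAvg π fun _ => F) = ((K * N : ℕ) : ℝ)⁻¹ • ∑ i, F i := by
  rw [foldAvg_eq h, ← Finset.smul_sum, smul_smul, Nat.cast_mul, mul_inv,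
    Finset.sum_fiberwise]

theorem abs_foldAvg_le (π : Fin (K * N) → Fin K) (F : Fin K → Fin (K * N) → ℝ) :
    |foldAvg π F| ≤ foldAvg π fun k i => |F k i| := by
  simp only [foldAvg, avg, smul_eq_mul]
  rw [abs_mul, abs_of_nonneg (by positivity)]
  gcongr
  refine (Finset.abs_sum_le_sum_abs _ _).trans (Finset.sum_le_sum fun k _ => ?_)
  rw [abs_mul, abs_of_nonneg (by positivity)]
  gcongr
  exact Finset.abs_sum_le_sum_abs _ _

theorem foldAvg_mono (π : Fin (K * N) → Fin K) {F G : Fin K → Fin (K * N) → ℝ}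
    (h : ∀ k i, F k i ≤ G k i) : foldAvg π F ≤ foldAvg π G := by
  simp only [foldAvg, avg, smul_eq_mul]
  gcongr with k _ i _
  exact h k i

end foldAvg

/-! ### Uniform convergence of cross-fitted averages -/

section uniform

variable {T q K : ℕ} {Ω : Type*} [MeasurableSpace Ω] {Pr : Measure Ω} [IsProbabilityMeasure Pr]
  {P : Measure (Traj T q)} [IsProbabilityMeasure P] {O : ℕ → Ω → Traj T q}
  {fold : ∀ N : ℕ, Ω → Fin (K * N) → Fin K}

theorem Sampling.ae_forall (hs : Sampling Pr P O fold) {E : Traj T q → Prop}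
    (h : ∀ᵐ o ∂P, E o) : ∀ᵐ ω ∂Pr, ∀ i, E (O i ω) := by
  refine ae_all_iff.2 fun i => ?_
  rw [← hs.law i] at h
  exact ae_of_ae_map (hs.meas i).aemeasurable h

/-- The cross-fitted average of a nonnegative function that is small in mean is small. -/
theorem Sampling.tendsto_foldAvg_abs (hs : Sampling Pr P O fold)
    {h : ∀ N π (k : Fin K), Train T q K N π k → Traj T q → ℝ}
    (hm : ∀ N π k, Measurable fun x : Train T q K N π k × Traj T q => h N π k x.1 x.2)
    (hconv : ∀ k, Tendsto (fun x : ℕ × Ω =>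
      ∫⁻ o, ‖h x.1 (fold x.1 x.2) k (train O fold x.1 k x.2) o‖ₑ ∂P) (inProb Pr) (𝓝 0)) :
    Tendsto (fun x : ℕ × Ω => foldAvg (fold x.1 x.2) fun k i =>
      |h x.1 (fold x.1 x.2) k (train O fold x.1 k x.2) (O i x.2)|) (inProb Pr) (𝓝 0) := by
  have h1 : ∀ k, Tendsto (fun x : ℕ × Ω => (x.1 : ℝ)⁻¹ *
      ∑ i ∈ Finset.univ.filter (fun i => fold x.1 x.2 i = k),
        |h x.1 (fold x.1 x.2) k (train O fold x.1 k x.2) (O i x.2)|) (inProb Pr) (𝓝 0) := by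
    intro k
    have h2 := hs.tendsto_fold_lintegral k
      (f := fun N π z o => ‖h N π k z o‖ₑ) (fun N π => (hm N π k).enorm) (hconv k)
    have h3 := (ENNReal.tendsto_toReal ENNReal.zero_ne_top).comp h2
    refine h3.congr fun x => ?_
    simp only [Function.comp_apply, ENNReal.toReal_mul, ENNReal.toReal_inv, ENNReal.toReal_natCast]
    rw [ENNReal.toReal_sum fun i _ => enorm_ne_top]
    simp
  have h4 := (tendsto_finsetSum Finset.univ fun k _ => h1 k).const_mul (K : ℝ)⁻¹
  simp only [Finset.sum_const_zero, mul_zero] at h4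
  refine h4.congr fun x => ?_
  rw [foldAvg_eq (hs.fold_size x.1 x.2)]
  simp

/-- Uniform law of large numbers for cross-fitted averages. -/
theorem Sampling.tendstoUniformlyOn_foldAvg (hs : Sampling Pr P O fold) (hK : 0 < K)
    {h : ∀ N π (k : Fin K), Train T q K N π k → Traj T q → ℝ}
    (hm : ∀ N π k, Measurable fun x : Train T q K N π k × Traj T q => h N π k x.1 x.2)
    {h' : Traj T q → ℝ} (hm' : Measurable h') (hi' : Integrable h' P)
    (hconv : ∀ k, Tendsto (fun x : ℕ × Ω =>
      ∫⁻ o, ‖h x.1 (fold x.1 x.2) k (train O fold x.1 k x.2) o - h' o‖ₑ ∂P) (inProb Pr) (𝓝 0))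
    {V : Type*} [MetricSpace V] {f : V → Traj T q → ℝ} {B : Set V} (hB : IsCompact B)
    (hf : ∀ b, Measurable (f b)) (hcont : ∀ o, Continuous fun b => f b o) {C : ℝ}
    (hbd : ∀ᵐ o ∂P, ∀ b ∈ B, |f b o| ≤ C) :
    TendstoUniformlyOn (fun (x : ℕ × Ω) b => foldAvg (fold x.1 x.2) fun k i =>
        h x.1 (fold x.1 x.2) k (train O fold x.1 k x.2) (O i x.2) * f b (O i x.2))
      (fun b => ∫ o, h' o * f b o ∂P) (inProb Pr) B := by
  -- The uniform law is applied to the limiting feature, with envelope `|h'| * C`.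
  have h1 := tendstoUniformlyOn_average hs.meas hs.law hs.indep
    (f := fun b o => h' o * f b o) hB (fun b => hm'.mul (hf b))
    (fun o => continuous_const.mul (hcont o)) (H := fun o => |h' o| * C) (hi'.abs.mul_const C)
    (by
      filter_upwards [hbd] with o ho b hb
      rw [abs_mul]
      gcongr
      exact ho b hb) (u := fun N => K * N) (tendsto_id.const_mul_atTop' hK)
  have h2 := hs.tendsto_foldAvg_abs (h := fun N π k z o => h N π k z o - h' o)
    (fun N π k => (hm N π k).sub (hm'.comp measurable_snd)) hconv
  have h3 := h2.const_mul C
  rw [mul_zero] at h3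
  rw [Metric.tendstoUniformlyOn_iff] at h1 ⊢
  intro ε hε
  filter_upwards [h1 (ε / 2) (half_pos hε), h3.eventually_lt_const (half_pos hε),
    eventually_inProb_of_ae (fun _ => hs.ae_forall hbd)] with x hx1 hx2 hx3 b hb
  have h4 := hx1 b hb
  rw [Real.dist_eq, abs_sub_comm] at h4 ⊢
  -- Replacing the fitted feature by its limit costs at most `C` times the average of the absolute
  -- feature error, uniformly in `b`.
  have h5 : |(foldAvg (fold x.1 x.2) fun k i =>
        h x.1 (fold x.1 x.2) k (train O fold x.1 k x.2) (O i x.2) * f b (O i x.2)) -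
      (((K * x.1 : ℕ) : ℝ)⁻¹ * ∑ i : Fin (K * x.1), h' (O i x.2) * f b (O i x.2))| < ε / 2 := by
    refine lt_of_le_of_lt ?_ hx2
    have e1 := foldAvg_const (hs.fold_size x.1 x.2)
      (fun i : Fin (K * x.1) => h' (O i x.2) * f b (O i x.2))
    rw [smul_eq_mul] at e1
    rw [← e1, ← foldAvg_sub]
    refine (abs_foldAvg_le _ _).trans ?_
    have e2 := map_foldAvg (LinearMap.mulLeft ℝ C) (fold x.1 x.2) fun k i =>
      |h x.1 (fold x.1 x.2) k (train O fold x.1 k x.2) (O i x.2) - h' (O i x.2)|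
    simp only [LinearMap.mulLeft_apply] at e2
    rw [e2]
    refine foldAvg_mono _ fun k i => ?_
    rw [← sub_mul, abs_mul, mul_comm]
    gcongr
    exact hx3 i b hb
  calc _ ≤ _ := abs_sub_le _ (((K * x.1 : ℕ) : ℝ)⁻¹ *
        ∑ i : Fin (K * x.1), h' (O i x.2) * f b (O i x.2)) _
    _ < ε / 2 + ε / 2 := add_lt_add h5 h4
    _ = ε := add_halves ε

theorem tendstoUniformlyOn_finsetSum {α V J : Type*} {l : Filter α} {B : Set V} (s : Finset J)
    {F : J → α → V → ℝ} {f : J → V → ℝ} (h : ∀ j ∈ s, TendstoUniformlyOn (F j) (f j) l B) :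
    TendstoUniformlyOn (fun x b => ∑ j ∈ s, F j x b) (fun b => ∑ j ∈ s, f j b) l B := by
  classical
  induction s using Finset.induction_on with
  | empty => simpa using (Metric.tendstoUniformlyOn_iff.2 fun ε hε => by simp [hε])
  | insert a s ha ih =>
    simp only [Finset.sum_insert ha]
    exact (h a (Finset.mem_insert_self a s)).add
      (ih fun j hj => h j (Finset.mem_insert_of_mem hj))

theorem enorm_rpow_two (x : ℝ) : ‖x‖ₑ ^ (2 : ℝ) = ENNReal.ofReal (x ^ 2) := by
  rw [Real.enorm_eq_ofReal_abs, ENNReal.ofReal_rpow_of_nonneg (abs_nonneg x) zero_le_two]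
  simp

/-- Products of functions that converge in `L₂` converge in `L₁`. -/
theorem tendsto_lintegral_mul_sub_mul {α 𝒳 : Type*} [MeasurableSpace 𝒳] {μ : Measure 𝒳}
    {l : Filter α} {F G : α → 𝒳 → ℝ} {f g : 𝒳 → ℝ} (hF : ∀ x, Measurable (F x))
    (hG : ∀ x, Measurable (G x)) (hf : Measurable f) (hg : Measurable g)
    (hfi : ∫⁻ o, ENNReal.ofReal (f o ^ 2) ∂μ ≠ ⊤) (hgi : ∫⁻ o, ENNReal.ofReal (g o ^ 2) ∂μ ≠ ⊤)
    (hFf : Tendsto (fun x => ∫⁻ o, ENNReal.ofReal ((F x o - f o) ^ 2) ∂μ) l (𝓝 0))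
    (hGg : Tendsto (fun x => ∫⁻ o, ENNReal.ofReal ((G x o - g o) ^ 2) ∂μ) l (𝓝 0)) :
    Tendsto (fun x => ∫⁻ o, ‖F x o * G x o - f o * g o‖ₑ ∂μ) l (𝓝 0) := by
  simp only [← enorm_rpow_two] at hfi hgi hFf hGg
  have holder : ∀ u v : 𝒳 → ℝ, Measurable u → Measurable v → ∫⁻ o, ‖u o‖ₑ * ‖v o‖ₑ ∂μ ≤
      (∫⁻ o, ‖u o‖ₑ ^ (2 : ℝ) ∂μ) ^ (1 / 2 : ℝ) * (∫⁻ o, ‖v o‖ₑ ^ (2 : ℝ) ∂μ) ^ (1 / 2 : ℝ) :=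
    fun u v hu hv => ENNReal.lintegral_mul_le_Lp_mul_Lq μ Real.HolderConjugate.two_two
      hu.enorm.aemeasurable hv.enorm.aemeasurable
  have hrt : ∀ {X : α → ℝ≥0∞}, Tendsto X l (𝓝 0) →
      Tendsto (fun x => X x ^ (1 / 2 : ℝ)) l (𝓝 0) := fun {X} hX => by
    have := (ENNReal.continuous_rpow_const (y := (1 / 2 : ℝ))).continuousAt.tendsto.comp hX
    simpa [Function.comp_def] using this
  have hnt : ∀ {a : ℝ≥0∞}, a ≠ ⊤ → a ^ (1 / 2 : ℝ) ≠ ⊤ := fun ha =>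
    ENNReal.rpow_ne_top_of_nonneg (by norm_num) ha
  have hA := hrt hFf
  have hB := hrt hGg
  have hlim := ((ENNReal.Tendsto.mul hA (Or.inr ENNReal.zero_ne_top) hB
      (Or.inr ENNReal.zero_ne_top)).add
    (ENNReal.Tendsto.const_mul hB (Or.inr (hnt hfi)))).add
    (ENNReal.Tendsto.mul_const hA (Or.inr (hnt hgi)))
  simp only [mul_zero, zero_mul, add_zero] at hlim
  refine tendsto_of_tendsto_of_tendsto_of_le_of_le tendsto_const_nhds hlim (fun _ => zero_le)
    fun x => ?_
  calc ∫⁻ o, ‖F x o * G x o - f o * g o‖ₑ ∂μ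
      ≤ ∫⁻ o, ((‖F x o - f o‖ₑ * ‖G x o - g o‖ₑ + ‖f o‖ₑ * ‖G x o - g o‖ₑ)
          + ‖F x o - f o‖ₑ * ‖g o‖ₑ) ∂μ := by
        refine lintegral_mono fun o => ?_
        -- Every term contains a factor that tends to zero in L₂, and the other factor either does
        -- so too or is fixed in L₂; Hölder's inequality handles all three without boundedness.
        have : F x o * G x o - f o * g o = ((F x o - f o) * (G x o - g o) +
          f o * (G x o - g o)) + (F x o - f o) * g o := by ring
        rw [this]
        refine (enorm_add_le _ _).trans (add_le_add ((enorm_add_le _ _).trans ?_) ?_) <;>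
        simp [enorm_mul]
    _ = (∫⁻ o, ‖F x o - f o‖ₑ * ‖G x o - g o‖ₑ ∂μ + ∫⁻ o, ‖f o‖ₑ * ‖G x o - g o‖ₑ ∂μ)
          + ∫⁻ o, ‖F x o - f o‖ₑ * ‖g o‖ₑ ∂μ := by
        rw [lintegral_add_left (by fun_prop), lintegral_add_left (by fun_prop)]
    _ ≤ _ := add_le_add (add_le_add (holder _ _ ((hF x).sub hf) ((hG x).sub hg))
        (holder _ _ hf ((hG x).sub hg))) (holder _ _ ((hF x).sub hf) hg)

/-- Uniform convergence near a point of continuity of the limit is joint convergence. -/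
theorem tendsto_prod_of_tendstoUniformlyOn {α V : Type*} [PseudoMetricSpace V] {l : Filter α}
    {F : α → V → ℝ} {f : V → ℝ} {B : Set V} {b : V} (h : TendstoUniformlyOn F f l B)
    (hB : B ∈ 𝓝 b) (hf : ContinuousAt f b) :
    Tendsto (fun y : α × V => F y.1 y.2) (l ×ˢ 𝓝 b) (𝓝 (f b)) := by
  rw [Metric.tendsto_nhds]
  intro ε hε
  rw [Metric.tendstoUniformlyOn_iff] at h
  have h1 := Filter.prod_mem_prod (h (ε / 2) (half_pos hε))
    (Filter.inter_mem hB (Metric.tendsto_nhds.1 hf (ε / 2) (half_pos hε)))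
  filter_upwards [h1] with y hy
  have h2 := hy.1 y.2 hy.2.1
  have h3 : dist (f y.2) (f b) < ε / 2 := hy.2.2
  rw [dist_comm] at h2
  linarith [dist_triangle (F y.1 y.2) (f y.2) (f b)]

/-- If the impossible event belonged to the filter, the total mass would tend to zero. Nontriviality
is what lets a uniform limit along `inProb` inherit continuity. -/
instance [NeZero Pr] : NeBot (inProb Pr) := by
  refine ⟨fun h => ?_⟩
  have h1 : (∅ : Set (ℕ × Ω)) ∈ inProb Pr := h ▸ Filter.mem_bot
  have h2 : Tendsto (fun _ : ℕ => Pr Set.univ) atTop (𝓝 0) := by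
    simpa using eventually_inProb.1 (show ∀ᶠ x in inProb Pr, x ∈ (∅ : Set (ℕ × Ω)) from h1)
  have h3 := tendsto_nhds_unique h2 tendsto_const_nhds
  simp at h3

end uniform

/-- The directional derivative is the pointwise limit of the measurable difference quotients `n (f
(b + v / n) - f b)`. -/
theorem measurable_fderiv_apply {V 𝒳 : Type*} [NormedAddCommGroup V] [NormedSpace ℝ V]
    [MeasurableSpace 𝒳] {f : V → 𝒳 → ℝ} (hm : ∀ b, Measurable (f b))
    (hd : ∀ x, Differentiable ℝ fun b => f b x) (b v : V) :
    Measurable fun x => fderiv ℝ (fun b' => f b' x) b v := by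
  refine measurable_of_tendsto_metrizable
    (f := fun (n : ℕ) x => (n : ℝ) • (f (b + (n : ℝ)⁻¹ • v) x - f b x)) (fun n => ?_) ?_
  · exact ((hm _).sub (hm b)).const_smul (n : ℝ)
  · rw [tendsto_pi_nhds]
    intro x
    refine (hd x b).hasFDerivAt.lim v ?_
    simpa using tendsto_natCast_atTop_atTop (R := ℝ)

/-! ### Estimating functions that are linear in fitted features -/

/-- An estimating function `∑ⱼ ηⱼ(o) cⱼ(b, o)` with known coefficients `cⱼ` and with features `ηⱼ`
that are fitted outside a fold and have limits. -/
structure Features (T q p K : ℕ) (J : Type*) where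
  coef : J → Vec p → Traj T q → ℝ
  fit : ∀ (N : ℕ) (π : Fin (K * N) → Fin K) (k : Fin K), Train T q K N π k →
    J → Fin p → Traj T q → ℝ
  lim : J → Fin p → Traj T q → ℝ

namespace Features

noncomputable section

variable {T q p K : ℕ} {J : Type*} [Fintype J] (F : Features T q p K J)

/-- The estimating function with features `η`. -/
def score (η : J → Fin p → Traj T q → ℝ) (b : Vec p) (o : Traj T q) : Vec p :=
  WithLp.toLp 2 fun i => ∑ j, η j i o * F.coef j b o

/-- The Jacobian matrix of the estimating function. -/
def jac (η : J → Fin p → Traj T q → ℝ) (b : Vec p) (o : Traj T q) : Matrix (Fin p) (Fin p) ℝ :=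
  Matrix.of fun i l =>
    ∑ j, η j i o * fderiv ℝ (fun b' => F.coef j b' o) b (EuclideanSpace.single l 1)

variable {Ω : Type*} [MeasurableSpace Ω] (Pr : Measure Ω)
  (P : Measure (Traj T q)) (O : ℕ → Ω → Traj T q)
  (fold : ∀ N : ℕ, Ω → Fin (K * N) → Fin K)

/-- The features fitted outside the `k`-th fold. -/
def fitAt (x : ℕ × Ω) (k : Fin K) : J → Fin p → Traj T q → ℝ :=
  F.fit x.1 (fold x.1 x.2) k (train O fold x.1 k x.2)

/-- The cross-fitted estimating function. -/
def scoreAvg (x : ℕ × Ω) (b : Vec p) : Vec p :=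
  foldAvg (fold x.1 x.2) fun k i => F.score (F.fitAt O fold x k) b (O i x.2)

/-- The cross-fitted Jacobian matrix. -/
def jacAvg (x : ℕ × Ω) (b : Vec p) : Matrix (Fin p) (Fin p) ℝ :=
  foldAvg (fold x.1 x.2) fun k i => F.jac (F.fitAt O fold x k) b (O i x.2)

/-- The cross-fitted matrix of second moments of the estimating function. -/
def sqAvg (x : ℕ × Ω) (b : Vec p) : Matrix (Fin p) (Fin p) ℝ :=
  foldAvg (fold x.1 x.2) fun k i =>
    Matrix.vecMulVec (WithLp.ofLp (F.score (F.fitAt O fold x k) b (O i x.2)))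
      (WithLp.ofLp (F.score (F.fitAt O fold x k) b (O i x.2)))

/-- The population Jacobian matrix. -/
def jacMean (b : Vec p) : Matrix (Fin p) (Fin p) ℝ :=
  Matrix.of fun i l => ∫ o, F.jac F.lim b o i l ∂P

/-- Smoothness and boundedness of the coefficients, and `L₂`-consistency of the features. -/
structure Regular : Prop where
  coef_meas : ∀ j b, Measurable (F.coef j b)
  coef_diff : ∀ j o, ContDiff ℝ 1 fun b => F.coef j b o
  coef_bdd : ∀ R : ℝ, ∃ C : ℝ, ∀ j, ∀ᵐ o ∂P, ∀ b, ‖b‖ ≤ R →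
    |F.coef j b o| ≤ C ∧ ‖fderiv ℝ (fun b' => F.coef j b' o) b‖ ≤ C
  fit_meas : ∀ N π k j i, Measurable fun x : Train T q K N π k × Traj T q =>
    F.fit N π k x.1 j i x.2
  lim_meas : ∀ j i, Measurable (F.lim j i)
  lim_sq : ∀ j i, ∫⁻ o, ENNReal.ofReal (F.lim j i o ^ 2) ∂P ≠ ⊤
  conv : ∀ j i k, Tendsto (fun x : ℕ × Ω =>
    ∫⁻ o, ENNReal.ofReal ((F.fitAt O fold x k j i o - F.lim j i o) ^ 2) ∂P) (inProb Pr) (𝓝 0)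

variable {F Pr P O fold}

namespace Regular

theorem fitAt_meas (hF : F.Regular Pr P O fold) (x : ℕ × Ω) (k : Fin K) (j : J) (i : Fin p) :
    Measurable (F.fitAt O fold x k j i) :=
  (hF.fit_meas _ _ _ j i).comp measurable_prodMk_left

theorem lim_memLp (hF : F.Regular Pr P O fold) (j : J) (i : Fin p) : MemLp (F.lim j i) 2 P := by
  refine (memLp_two_iff_integrable_sq (hF.lim_meas j i).aestronglyMeasurable).2
    ⟨((hF.lim_meas j i).pow_const 2).aestronglyMeasurable, ?_⟩
  rw [hasFiniteIntegral_iff_ofReal (ae_of_all _ fun o => sq_nonneg _)]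
  exact lt_top_iff_ne_top.2 (hF.lim_sq j i)

variable [IsProbabilityMeasure P]

theorem lim_integrable (hF : F.Regular Pr P O fold) (j : J) (i : Fin p) :
    Integrable (F.lim j i) P :=
  (hF.lim_memLp j i).integrable one_le_two

theorem tendsto_lintegral_fit_mul_fit (hF : F.Regular Pr P O fold) (j j' : J)
    (i i' : Fin p) (k : Fin K) :
    Tendsto (fun x : ℕ × Ω => ∫⁻ o, ‖F.fitAt O fold x k j i o * F.fitAt O fold x k j' i' o
      - F.lim j i o * F.lim j' i' o‖ₑ ∂P) (inProb Pr) (𝓝 0) :=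
  tendsto_lintegral_mul_sub_mul (fun x => hF.fitAt_meas x k j i) (fun x => hF.fitAt_meas x k j' i')
    (hF.lim_meas j i) (hF.lim_meas j' i') (hF.lim_sq j i) (hF.lim_sq j' i') (hF.conv j i k)
    (hF.conv j' i' k)

theorem tendsto_lintegral_fit (hF : F.Regular Pr P O fold) (j : J) (i : Fin p) (k : Fin K) :
    Tendsto (fun x : ℕ × Ω => ∫⁻ o, ‖F.fitAt O fold x k j i o - F.lim j i o‖ₑ ∂P)
      (inProb Pr) (𝓝 0) := by
  -- On a probability space L₂ convergence implies L₁ convergence: this is the product lemma with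
  -- second factor `1`.
  have := tendsto_lintegral_mul_sub_mul (μ := P) (l := inProb Pr)
    (G := fun _ _ => (1 : ℝ)) (g := fun _ => (1 : ℝ))
    (fun x => hF.fitAt_meas x k j i) (fun _ => measurable_const) (hF.lim_meas j i)
    measurable_const (hF.lim_sq j i) (by simp) (hF.conv j i k) (by simp [tendsto_const_nhds])
  simpa using this

theorem coef_continuous (hF : F.Regular Pr P O fold) (j : J) (o : Traj T q) :
    Continuous fun b => F.coef j b o :=
  (hF.coef_diff j o).continuous

theorem coef_differentiable (hF : F.Regular Pr P O fold) (j : J) (o : Traj T q) :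
    Differentiable ℝ fun b => F.coef j b o :=
  (hF.coef_diff j o).differentiable one_ne_zero

theorem dcoef_continuous (hF : F.Regular Pr P O fold) (j : J) (o : Traj T q) (v : Vec p) :
    Continuous fun b => fderiv ℝ (fun b' => F.coef j b' o) b v :=
  ((hF.coef_diff j o).continuous_fderiv one_ne_zero).clm_apply continuous_const

theorem dcoef_meas (hF : F.Regular Pr P O fold) (j : J) (b v : Vec p) :
    Measurable fun o => fderiv ℝ (fun b' => F.coef j b' o) b v :=
  measurable_fderiv_apply (hF.coef_meas j) (hF.coef_differentiable j) b v

/-- Puts the bounds for all `j` on a single null set, with a nonnegative constant, and passes from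
the operator norm of the derivative to its entries. -/
theorem exists_coef_bound (hF : F.Regular Pr P O fold) (R : ℝ) :
    ∃ C : ℝ, 0 ≤ C ∧ ∀ᵐ o ∂P, ∀ j, ∀ b ∈ Metric.closedBall 0 R,
    |F.coef j b o| ≤ C ∧
      ∀ l, |fderiv ℝ (fun b' => F.coef j b' o) b (EuclideanSpace.single l 1)| ≤ C := by
  obtain ⟨C, hC⟩ := hF.coef_bdd R
  refine ⟨max C 0, le_max_right _ _, ?_⟩
  filter_upwards [ae_all_iff.2 hC] with o ho j b hb
  have hb' : ‖b‖ ≤ R := by simpa using hb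
  refine ⟨(ho j b hb').1.trans (le_max_left _ _), fun l => ?_⟩
  have h1 := (fderiv ℝ (fun b' => F.coef j b' o) b).le_opNorm (EuclideanSpace.single l (1 : ℝ))
  simp only [PiLp.norm_single, norm_one, mul_one, Real.norm_eq_abs] at h1
  exact h1.trans ((ho j b hb').2.trans (le_max_left _ _))

theorem integrable_lim_coef (hF : F.Regular Pr P O fold) (j : J) (i : Fin p) (b : Vec p) :
    Integrable (fun o => F.lim j i o * F.coef j b o) P := by
  obtain ⟨C, -, hC⟩ := hF.exists_coef_bound ‖b‖
  refine (hF.lim_integrable j i).mul_bdd (c := C) (hF.coef_meas j b).aestronglyMeasurable ?_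
  filter_upwards [hC] with o ho
  exact (ho j b (by simp)).1

theorem score_meas (hF : F.Regular Pr P O fold) (b : Vec p) (i : Fin p) :
    Measurable fun o => F.score F.lim b o i :=
  Finset.measurable_fun_sum _ fun j _ => (hF.lim_meas j i).mul (hF.coef_meas j b)

theorem score_memLp (hF : F.Regular Pr P O fold) (b : Vec p) (i : Fin p) :
    MemLp (fun o => F.score F.lim b o i) 2 P := by
  refine memLp_finsetSum _ fun j _ => ?_
  obtain ⟨C, -, hC⟩ := hF.exists_coef_bound ‖b‖
  refine MemLp.of_le_mul (c := C) (hF.lim_memLp j i)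
    ((hF.lim_meas j i).mul (hF.coef_meas j b)).aestronglyMeasurable ?_
  filter_upwards [hC] with o ho
  rw [norm_mul, mul_comm]
  gcongr
  exact (ho j b (by simp)).1

variable [IsProbabilityMeasure Pr]

/-- The score is a finite sum of terms "feature times coefficient" in which only the coefficient
depends on `b`, so the cross-fitted uniform law applies to each term. -/
theorem tendstoUniformlyOn_scoreAvg (hF : F.Regular Pr P O fold) (hs : Sampling Pr P O fold)
    (hK : 0 < K) (R : ℝ) (i : Fin p) :
    TendstoUniformlyOn (fun (x : ℕ × Ω) b => F.scoreAvg O fold x b i)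
      (fun b => ∫ o, F.score F.lim b o i ∂P) (inProb Pr) (Metric.closedBall 0 R) := by
  obtain ⟨C, -, hC⟩ := hF.exists_coef_bound R
  have h1 := tendstoUniformlyOn_finsetSum Finset.univ fun j _ =>
    hs.tendstoUniformlyOn_foldAvg hK (h := fun N π k z o => F.fit N π k z j i o)
      (fun N π k => hF.fit_meas N π k j i) (hF.lim_meas j i) (hF.lim_integrable j i)
      (hF.tendsto_lintegral_fit j i) (isCompact_closedBall (0 : Vec p) R) (hF.coef_meas j)
      (hF.coef_continuous j) (C := C) (hC.mono fun o ho b hb => (ho j b hb).1)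
  refine (h1.congr (Eventually.of_forall fun x b _ => ?_)).congr_right fun b _ => ?_
  · have := map_foldAvg (EuclideanSpace.proj i : Vec p →L[ℝ] ℝ).toLinearMap (fold x.1 x.2)
      fun k m => F.score (F.fitAt O fold x k) b (O m x.2)
    simp only [ContinuousLinearMap.coe_coe, PiLp.proj_apply] at this
    rw [scoreAvg, this]
    simp only [score]
    rw [foldAvg_sum]
    rfl
  · simp only [score]
    rw [integral_finsetSum _ fun j _ => hF.integrable_lim_coef j i b]

theorem tendstoUniformlyOn_jacAvg (hF : F.Regular Pr P O fold) (hs : Sampling Pr P O fold)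
    (hK : 0 < K) (R : ℝ) (i l : Fin p) :
    TendstoUniformlyOn (fun (x : ℕ × Ω) b => F.jacAvg O fold x b i l)
      (fun b => F.jacMean P b i l) (inProb Pr) (Metric.closedBall 0 R) := by
  obtain ⟨C, -, hC⟩ := hF.exists_coef_bound R
  have h1 := tendstoUniformlyOn_finsetSum Finset.univ fun j _ =>
    hs.tendstoUniformlyOn_foldAvg hK (h := fun N π k z o => F.fit N π k z j i o)
      (fun N π k => hF.fit_meas N π k j i) (hF.lim_meas j i) (hF.lim_integrable j i)
      (hF.tendsto_lintegral_fit j i) (isCompact_closedBall (0 : Vec p) R)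
      (fun b => hF.dcoef_meas j b (EuclideanSpace.single l 1))
      (fun o => hF.dcoef_continuous j o (EuclideanSpace.single l 1)) (C := C)
      (hC.mono fun o ho b hb => (ho j b hb).2 l)
  refine (h1.congr (Eventually.of_forall fun x b _ => ?_)).congr_right fun b hb => ?_
  · have := map_foldAvg (Matrix.entryLinearMap ℝ ℝ i l) (fold x.1 x.2)
      fun k m => F.jac (F.fitAt O fold x k) b (O m x.2)
    simp only [Matrix.entryLinearMap_apply] at this
    rw [jacAvg, this]
    simp only [jac, Matrix.of_apply]
    rw [foldAvg_sum]
    rfl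
  · simp only [jacMean, jac, Matrix.of_apply]
    rw [integral_finsetSum _ fun j _ => (hF.lim_integrable j i).mul_bdd (c := C)
      (hF.dcoef_meas j b _).aestronglyMeasurable (hC.mono fun o ho => (ho j b hb).2 l)]

/-- A product of two scores is again linear, in the products of features over pairs of indices.
These products converge in L₁ because the features converge in L₂. -/
theorem tendstoUniformlyOn_sqAvg (hF : F.Regular Pr P O fold) (hs : Sampling Pr P O fold)
    (hK : 0 < K) (R : ℝ) (i l : Fin p) :
    TendstoUniformlyOn (fun (x : ℕ × Ω) b => F.sqAvg O fold x b i l)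
      (fun b => secondMoment P (F.score F.lim b) i l) (inProb Pr) (Metric.closedBall 0 R) := by
  obtain ⟨C, hC0, hC⟩ := hF.exists_coef_bound R
  have hbd : ∀ᵐ o ∂P, ∀ a : J × J, ∀ b ∈ Metric.closedBall (0 : Vec p) R,
      |F.coef a.1 b o * F.coef a.2 b o| ≤ C * C := hC.mono fun o ho a b hb => by
    rw [abs_mul]
    exact mul_le_mul (ho a.1 b hb).1 (ho a.2 b hb).1 (abs_nonneg _) hC0
  have hint : ∀ a : J × J, Integrable (fun o => F.lim a.1 i o * F.lim a.2 l o) P := fun a =>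
    (hF.lim_memLp a.1 i).integrable_mul (hF.lim_memLp a.2 l)
  have h1 := tendstoUniformlyOn_finsetSum (Finset.univ : Finset (J × J)) fun a _ =>
    hs.tendstoUniformlyOn_foldAvg hK
      (h := fun N π k z o => F.fit N π k z a.1 i o * F.fit N π k z a.2 l o)
      (fun N π k => (hF.fit_meas N π k a.1 i).mul (hF.fit_meas N π k a.2 l))
      ((hF.lim_meas a.1 i).mul (hF.lim_meas a.2 l)) (hint a)
      (hF.tendsto_lintegral_fit_mul_fit a.1 a.2 i l) (isCompact_closedBall (0 : Vec p) R)
      (f := fun b o => F.coef a.1 b o * F.coef a.2 b o)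
      (fun b => (hF.coef_meas a.1 b).mul (hF.coef_meas a.2 b))
      (fun o => (hF.coef_continuous a.1 o).mul (hF.coef_continuous a.2 o)) (C := C * C)
      (hbd.mono fun o ho => ho a)
  have hprod : ∀ (η : J → Fin p → Traj T q → ℝ) b o, F.score η b o i * F.score η b o l
      = ∑ a : J × J, η a.1 i o * η a.2 l o * (F.coef a.1 b o * F.coef a.2 b o) := by
    intro η b o
    simp only [score]
    rw [Finset.sum_mul_sum, Fintype.sum_prod_type]
    exact Finset.sum_congr rfl fun j _ => Finset.sum_congr rfl fun j' _ => by ring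
  refine (h1.congr (Eventually.of_forall fun x b _ => ?_)).congr_right fun b hb => ?_
  · have := map_foldAvg (Matrix.entryLinearMap ℝ ℝ i l) (fold x.1 x.2)
      fun k m => Matrix.vecMulVec (WithLp.ofLp (F.score (F.fitAt O fold x k) b (O m x.2)))
        (WithLp.ofLp (F.score (F.fitAt O fold x k) b (O m x.2)))
    simp only [Matrix.entryLinearMap_apply, Matrix.vecMulVec_apply, hprod] at this
    rw [sqAvg, this]
    rw [foldAvg_sum]
    rfl
  · simp only [secondMoment, Matrix.of_apply, hprod]
    have hint' : ∀ a : J × J, Integrable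
        (fun o => F.lim a.1 i o * F.lim a.2 l o * (F.coef a.1 b o * F.coef a.2 b o)) P := fun a =>
      (hint a).mul_bdd (c := C * C)
        ((hF.coef_meas a.1 b).mul (hF.coef_meas a.2 b)).aestronglyMeasurable
        (hbd.mono fun o ho => ho a b hb)
    rw [integral_finsetSum _ fun a _ => hint' a]
    rfl

end Regular

end

end Features

/-! ### Matrix inversion, coordinates and derivatives of fold averages -/

/-- The inverse is the reciprocal determinant times the adjugate, which is continuous where the
determinant does not vanish. -/
theorem tendsto_matrix_inv {α : Type*} {p : ℕ} {l : Filter α} {B : α → Matrix (Fin p) (Fin p) ℝ}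
    {D : Matrix (Fin p) (Fin p) ℝ} (h : Tendsto B l (𝓝 D)) (hD : IsUnit D) :
    Tendsto (fun x => (B x)⁻¹) l (𝓝 D⁻¹) := by
  simp only [Matrix.inv_def, Ring.inverse_eq_inv']
  have hdet : D.det ≠ 0 := ((Matrix.isUnit_iff_isUnit_det D).1 hD).ne_zero
  exact ((Continuous.matrix_det continuous_id).continuousAt.tendsto.comp h |>.inv₀ hdet).smul
    ((Continuous.matrix_adjugate continuous_id).continuousAt.tendsto.comp h)

theorem clm_apply_eq_sum {p : ℕ} (L : Vec p →L[ℝ] ℝ) (v : Vec p) :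
    L v = ∑ l, L (EuclideanSpace.single l 1) * v l := by
  have hv : v = ∑ l, v l • (EuclideanSpace.single l (1 : ℝ) : Vec p) := by
    ext i
    simp [Finset.sum_apply, Pi.single_apply]
  conv_lhs => rw [hv]
  simp [map_sum, mul_comm]

theorem tendsto_vec {α : Type*} {p : ℕ} {l : Filter α} {f : α → Vec p} {v : Vec p}
    (h : ∀ i, Tendsto (fun x => f x i) l (𝓝 (v i))) : Tendsto f l (𝓝 v) :=
  ((PiLp.continuous_toLp 2 fun _ : Fin p => ℝ).tendsto (WithLp.ofLp v)).comp
    (tendsto_pi_nhds.2 h)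

/-- The linear map that sends a matrix to the operator it defines. -/
noncomputable def matrixCLM (p : ℕ) : Matrix (Fin p) (Fin p) ℝ →ₗ[ℝ] (Vec p →L[ℝ] Vec p) where
  toFun A := Matrix.toEuclideanCLM (𝕜 := ℝ) A
  map_add' := map_add _
  map_smul' := map_smul _

theorem hasFDerivAt_foldAvg {K N p : ℕ} (π : Fin (K * N) → Fin K)
    {G : Fin K → Fin (K * N) → Vec p → Vec p} {G' : Fin K → Fin (K * N) → Vec p →L[ℝ] Vec p}
    {b : Vec p} (h : ∀ k i, HasFDerivAt (G k i) (G' k i) b) :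
    HasFDerivAt (fun b => foldAvg π fun k i => G k i b) (foldAvg π G') b := by
  simp only [foldAvg, avg]
  refine HasFDerivAt.fun_const_smul (HasFDerivAt.fun_sum fun k _ => ?_) _
  exact HasFDerivAt.fun_const_smul (HasFDerivAt.fun_sum fun i _ => h k i) _

/-! ### Consistency, linearization and negligibility of the fitting error -/

namespace Features

variable {T q p K : ℕ} {J : Type*} [Fintype J] {F : Features T q p K J}
  {Ω : Type*} [MeasurableSpace Ω] {Pr : Measure Ω} [IsProbabilityMeasure Pr]
  {P : Measure (Traj T q)} [IsProbabilityMeasure P] {O : ℕ → Ω → Traj T q}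
  {fold : ∀ N : ℕ, Ω → Fin (K * N) → Fin K}

namespace Regular

/-- For a fixed sample this is a finite sum. Continuity is needed to conclude that the population
mean, as a uniform limit, is continuous in `b`. -/
theorem scoreAvg_continuous (hF : F.Regular Pr P O fold) (x : ℕ × Ω) (i : Fin p) :
    Continuous fun b => F.scoreAvg O fold x b i := by
  have : ∀ b, F.scoreAvg O fold x b i = foldAvg (fold x.1 x.2) fun k m =>
      ∑ j, F.fitAt O fold x k j i (O m x.2) * F.coef j b (O m x.2) := fun b => by
    have := map_foldAvg (EuclideanSpace.proj i : Vec p →L[ℝ] ℝ).toLinearMap (fold x.1 x.2)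
      fun k m => F.score (F.fitAt O fold x k) b (O m x.2)
    simp only [ContinuousLinearMap.coe_coe, PiLp.proj_apply] at this
    rw [scoreAvg, this]
    rfl
  simp only [this, foldAvg, avg]
  have h1 := hF.coef_continuous
  fun_prop

theorem jacAvg_continuous (hF : F.Regular Pr P O fold) (x : ℕ × Ω) (i l : Fin p) :
    Continuous fun b => F.jacAvg O fold x b i l := by
  have : ∀ b, F.jacAvg O fold x b i l = foldAvg (fold x.1 x.2) fun k m =>
      ∑ j, F.fitAt O fold x k j i (O m x.2) *
        fderiv ℝ (fun b' => F.coef j b' (O m x.2)) b (EuclideanSpace.single l 1) := fun b => by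
    have := map_foldAvg (Matrix.entryLinearMap ℝ ℝ i l) (fold x.1 x.2)
      fun k m => F.jac (F.fitAt O fold x k) b (O m x.2)
    simp only [Matrix.entryLinearMap_apply] at this
    rw [jacAvg, this]
    rfl
  simp only [this, foldAvg, avg]
  have h1 := fun j o => hF.dcoef_continuous j o (EuclideanSpace.single l 1)
  fun_prop

theorem sqAvg_continuous (hF : F.Regular Pr P O fold) (x : ℕ × Ω) (i l : Fin p) :
    Continuous fun b => F.sqAvg O fold x b i l := by
  have : ∀ b, F.sqAvg O fold x b i l = foldAvg (fold x.1 x.2) fun k m =>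
      (∑ j, F.fitAt O fold x k j i (O m x.2) * F.coef j b (O m x.2)) *
        ∑ j, F.fitAt O fold x k j l (O m x.2) * F.coef j b (O m x.2) := fun b => by
    have := map_foldAvg (Matrix.entryLinearMap ℝ ℝ i l) (fold x.1 x.2)
      fun k m => Matrix.vecMulVec (WithLp.ofLp (F.score (F.fitAt O fold x k) b (O m x.2)))
        (WithLp.ofLp (F.score (F.fitAt O fold x k) b (O m x.2)))
    simp only [Matrix.entryLinearMap_apply, Matrix.vecMulVec_apply] at this
    rw [sqAvg, this]
    rfl
  simp only [this, foldAvg, avg]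
  have h1 := hF.coef_continuous
  fun_prop

/-- The cross-fitted Jacobian matrix converges locally uniformly. -/
theorem tendsto_jacAvg (hF : F.Regular Pr P O fold) (hs : Sampling Pr P O fold) (hK : 0 < K)
    (b : Vec p) :
    Tendsto (fun y : (ℕ × Ω) × Vec p => F.jacAvg O fold y.1 y.2) (inProb Pr ×ˢ 𝓝 b)
      (𝓝 (F.jacMean P b)) := by
  refine tendsto_pi_nhds.2 fun i => tendsto_pi_nhds.2 fun l => ?_
  -- The radius `‖b‖ + 1` makes the ball a neighbourhood of `b`. The limit is continuous there as a
  -- uniform limit of continuous functions.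
  have hU := hF.tendstoUniformlyOn_jacAvg hs hK (‖b‖ + 1) i l
  have hnhds : Metric.closedBall (0 : Vec p) (‖b‖ + 1) ∈ 𝓝 b :=
    Metric.closedBall_mem_nhds_of_mem (by simp)
  exact tendsto_prod_of_tendstoUniformlyOn hU hnhds ((hU.continuousOn
    (Frequently.of_forall fun x => (hF.jacAvg_continuous x i l).continuousOn)).continuousAt hnhds)

/-- The cross-fitted second moment matrix converges locally uniformly. -/
theorem tendsto_sqAvg (hF : F.Regular Pr P O fold) (hs : Sampling Pr P O fold) (hK : 0 < K)
    (b : Vec p) :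
    Tendsto (fun y : (ℕ × Ω) × Vec p => F.sqAvg O fold y.1 y.2) (inProb Pr ×ˢ 𝓝 b)
      (𝓝 (secondMoment P (F.score F.lim b))) := by
  refine tendsto_pi_nhds.2 fun i => tendsto_pi_nhds.2 fun l => ?_
  have hU := hF.tendstoUniformlyOn_sqAvg hs hK (‖b‖ + 1) i l
  have hnhds : Metric.closedBall (0 : Vec p) (‖b‖ + 1) ∈ 𝓝 b :=
    Metric.closedBall_mem_nhds_of_mem (by simp)
  exact tendsto_prod_of_tendstoUniformlyOn hU hnhds ((hU.continuousOn
    (Frequently.of_forall fun x => (hF.sqAvg_continuous x i l).continuousOn)).continuousAt hnhds)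

/-- Consistency of solutions of the cross-fitted equation. -/
theorem tendsto_of_scoreAvg_eq_zero (hF : F.Regular Pr P O fold) (hs : Sampling Pr P O fold)
    (hK : 0 < K) {Θ : Set (Vec p)} (hΘ : IsCompact Θ) {b : Vec p}
    (huniq : ∀ b' ∈ Θ, (∀ i, ∫ o, F.score F.lim b' o i ∂P = 0) → b' = b)
    {bc : ℕ × Ω → Vec p} (hbc : ∀ᶠ x in inProb Pr, bc x ∈ Θ ∧ F.scoreAvg O fold x (bc x) = 0) :
    Tendsto bc (inProb Pr) (𝓝 b) := by
  obtain ⟨R, hR⟩ := hΘ.isBounded.subset_closedBall 0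
  -- In a compact set it is enough that `b` is the only possible cluster point; along an ultrafilter
  -- a cluster point `y` is a limit of `bc`.
  refine hΘ.tendsto_nhds_of_unique_mapClusterPt (hbc.mono fun x hx => hx.1) fun y hy hcl => ?_
  obtain ⟨U, hU, hUy⟩ := mapClusterPt_iff_ultrafilter.1 hcl
  refine huniq y hy fun i => ?_
  have hunif := hF.tendstoUniformlyOn_scoreAvg hs hK R i
  have hcont : ContinuousOn (fun b => ∫ o, F.score F.lim b o i ∂P) (Metric.closedBall 0 R) :=
    hunif.continuousOn (Frequently.of_forall fun x => (hF.scoreAvg_continuous x i).continuousOn)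
  have h1 : Tendsto (fun x => ∫ o, F.score F.lim (bc x) o i ∂P) U
      (𝓝 (∫ o, F.score F.lim y o i ∂P)) :=
    (hcont y (hR hy)).tendsto.comp (tendsto_nhdsWithin_iff.2
      ⟨hUy, (hbc.filter_mono hU).mono fun x hx => hR hx.1⟩)
  -- The averaged score vanishes at `bc x` and is uniformly close to the population mean, so the
  -- latter tends to zero along `bc`. By continuity `y` is then a zero.
  have h2 : Tendsto (fun x => ∫ o, F.score F.lim (bc x) o i ∂P) (inProb Pr) (𝓝 0) := by
    refine Metric.tendsto_nhds.2 fun ε hε => ?_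
    filter_upwards [Metric.tendstoUniformlyOn_iff.1 hunif ε hε, hbc] with x hx1 hx2
    have := hx1 (bc x) (hR hx2.1)
    rw [hx2.2] at this
    simpa using this
  exact tendsto_nhds_unique h1 (h2.mono_left hU)

theorem hasFDerivAt_scoreAvg (hF : F.Regular Pr P O fold) (x : ℕ × Ω) (b : Vec p) :
    HasFDerivAt (F.scoreAvg O fold x)
      (Matrix.toEuclideanCLM (𝕜 := ℝ) (F.jacAvg O fold x b)) b := by
  have hscore : ∀ η o, HasFDerivAt (fun b => F.score η b o)
      (Matrix.toEuclideanCLM (𝕜 := ℝ) (F.jac η b o)) b := by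
    intro η o
    rw [← hasFDerivWithinAt_univ, hasFDerivWithinAt_euclidean]
    intro i
    rw [hasFDerivWithinAt_univ]
    have h1 : HasFDerivAt (fun b => ∑ j, η j i o * F.coef j b o)
        (∑ j, η j i o • fderiv ℝ (fun b' => F.coef j b' o) b) b :=
      HasFDerivAt.fun_sum fun j _ =>
        ((hF.coef_differentiable j o b).hasFDerivAt).const_mul (η j i o)
    refine h1.congr_fderiv ?_
    ext v
    simp only [ContinuousLinearMap.comp_apply, PiLp.proj_apply, Matrix.ofLp_toEuclideanCLM,
      Matrix.mulVec, dotProduct, jac, Matrix.of_apply, sum_apply,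
      smul_apply, smul_eq_mul]
    simp_rw [clm_apply_eq_sum _ v, Finset.sum_mul, Finset.mul_sum]
    rw [Finset.sum_comm]
    exact Finset.sum_congr rfl fun l _ => Finset.sum_congr rfl fun j _ => by ring
  have h2 : Matrix.toEuclideanCLM (𝕜 := ℝ) (F.jacAvg O fold x b) =
      foldAvg (fold x.1 x.2) fun k i =>
        Matrix.toEuclideanCLM (𝕜 := ℝ) (F.jac (F.fitAt O fold x k) b (O i x.2)) :=
    map_foldAvg (matrixCLM p) _ _
  rw [h2]
  exact hasFDerivAt_foldAvg _ fun k i => hscore (F.fitAt O fold x k) (O i x.2)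

/-- The first-order expansion of a consistent solution of the cross-fitted equation. -/
theorem exists_expansion (hF : F.Regular Pr P O fold) (hs : Sampling Pr P O fold) (hK : 0 < K)
    {b : Vec p} {bc : ℕ × Ω → Vec p} (hbc : Tendsto bc (inProb Pr) (𝓝 b))
    (hz : ∀ᶠ x in inProb Pr, F.scoreAvg O fold x (bc x) = 0) :
    ∃ e : ℕ × Ω → ℝ, Tendsto e (inProb Pr) (𝓝 0) ∧ ∀ᶠ x in inProb Pr, 0 ≤ e x ∧
      ‖F.scoreAvg O fold x b + Matrix.toEuclideanCLM (𝕜 := ℝ) (F.jacMean P b) (bc x - b)‖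
        ≤ e x * ‖bc x - b‖ := by
  -- The relative linearization error, with value `0` where `bc x = b` because division by zero
  -- gives zero.
  let e : ℕ × Ω → ℝ := fun x =>
    ‖F.scoreAvg O fold x b + Matrix.toEuclideanCLM (𝕜 := ℝ) (F.jacMean P b) (bc x - b)‖ / ‖bc x - b‖
  have hcl : Continuous fun A : Matrix (Fin p) (Fin p) ℝ => Matrix.toEuclideanCLM (𝕜 := ℝ) A :=
    LinearMap.continuous_of_finiteDimensional
      (matrixCLM p)
  have hlim : Tendsto (fun y : (ℕ × Ω) × Vec p =>
      Matrix.toEuclideanCLM (𝕜 := ℝ) (F.jacAvg O fold y.1 y.2)) (inProb Pr ×ˢ 𝓝 b)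
      (𝓝 (Matrix.toEuclideanCLM (𝕜 := ℝ) (F.jacMean P b))) :=
    (hcl.tendsto _).comp (hF.tendsto_jacAvg hs hK b)
  have key : ∀ ε > 0, ∀ᶠ x in inProb Pr,
      ‖F.scoreAvg O fold x b + Matrix.toEuclideanCLM (𝕜 := ℝ) (F.jacMean P b) (bc x - b)‖
        ≤ ε * ‖bc x - b‖ := by
    intro ε hε
    obtain ⟨pa, hpa, pb, hpb, hab⟩ := eventually_prod_iff.1 (Metric.tendsto_nhds.1 hlim ε hε)
    obtain ⟨δ, hδ, hball⟩ := Metric.eventually_nhds_iff_ball.1 hpb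
    filter_upwards [hpa, hz, hbc.eventually (Metric.ball_mem_nhds b hδ)] with x hx1 hx2 hx3
    -- Mean value inequality on a small ball around `b`, where the random Jacobian is within `ε` of
    -- the population Jacobian.
    have := Convex.norm_image_sub_le_of_norm_hasFDerivWithin_le' (𝕜 := ℝ)
      (f := F.scoreAvg O fold x) (s := Metric.ball b δ) (x := b) (y := bc x) (C := ε)
      (f' := fun b' => Matrix.toEuclideanCLM (𝕜 := ℝ) (F.jacAvg O fold x b'))
      (φ := Matrix.toEuclideanCLM (𝕜 := ℝ) (F.jacMean P b))
      (fun b' _ => (hF.hasFDerivAt_scoreAvg x b').hasFDerivWithinAt)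
      (fun b' hb' => by rw [← dist_eq_norm]; exact (hab hx1 (hball b' hb')).le)
      (convex_ball b δ) (Metric.mem_ball_self hδ) hx3
    rw [hx2, zero_sub, ← neg_add', norm_neg] at this
    exact this
  refine ⟨e, ?_, ?_⟩
  · refine Metric.tendsto_nhds.2 fun ε hε => ?_
    filter_upwards [key (ε / 2) (half_pos hε)] with x hx
    have h0 : 0 ≤ e x := by positivity
    rw [Real.dist_0_eq_abs, abs_of_nonneg h0]
    refine lt_of_le_of_lt (div_le_of_le_mul₀ (norm_nonneg _) (half_pos hε).le hx) (half_lt_self hε)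
  -- Any `ε` would do: the bound is needed only where `bc x = b`, and there it forces the remainder
  -- to vanish.
  · filter_upwards [key 1 one_pos] with x hx
    refine ⟨by positivity, ?_⟩
    rcases eq_or_ne (‖bc x - b‖) 0 with h | h
    · rw [h, mul_zero] at hx ⊢
      exact hx
    · simp only [e]
      rw [div_mul_cancel₀ _ h]

/-- Cross-fitting makes the estimation of the features asymptotically negligible. -/
theorem tendsto_sqrt_scoreAvg_sub (hF : F.Regular Pr P O fold) (hs : Sampling Pr P O fold)
    {b : Vec p} (h0 : ∀ i k, ∀ᶠ x in inProb Pr,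
      ∫ o, (F.score (F.fitAt O fold x k) b o i - F.score F.lim b o i) ∂P = 0) :
    Tendsto (fun x : ℕ × Ω => √((K * x.1 : ℕ) : ℝ) • F.scoreAvg O fold x b -
      (√((K * x.1 : ℕ) : ℝ))⁻¹ • ∑ m : Fin (K * x.1), F.score F.lim b (O m x.2))
      (inProb Pr) (𝓝 0) := by
  obtain ⟨C, hC0, hC⟩ := hF.exists_coef_bound ‖b‖
  refine tendsto_vec fun i => ?_
  let f : ∀ (k : Fin K) N π, Train T q K N π k → Traj T q → ℝ := fun k N π z o =>
    F.score (F.fit N π k z) b o i - F.score F.lim b o i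
  have hfm : ∀ k N π, Measurable fun x : Train T q K N π k × Traj T q => f k N π x.1 x.2 := by
    intro k N π
    refine Measurable.sub (Finset.measurable_fun_sum _ fun j _ => (hF.fit_meas N π k j i).mul
      ((hF.coef_meas j b).comp measurable_snd)) ((hF.score_meas b i).comp measurable_snd)
  have hsq : ∀ k, Tendsto (fun x : ℕ × Ω => ∫⁻ o, ENNReal.ofReal
      (f k x.1 (fold x.1 x.2) (train O fold x.1 k x.2) o ^ 2) ∂P) (inProb Pr) (𝓝 0) := by
    intro k
    -- The Cauchy–Schwarz inequality over the index set gives the factor `card J`, and the bound on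
    -- the coefficients gives `C ^ 2`.
    have h1 := ENNReal.Tendsto.const_mul (a := ENNReal.ofReal (Fintype.card J * C ^ 2))
      (tendsto_finsetSum Finset.univ fun j _ => hF.conv j i k) (Or.inr ENNReal.ofReal_ne_top)
    simp only [Finset.sum_const_zero, mul_zero] at h1
    refine tendsto_of_tendsto_of_tendsto_of_le_of_le tendsto_const_nhds h1 (fun _ => zero_le)
      fun x => ?_
    have hm : ∀ j, Measurable fun o =>
        ENNReal.ofReal ((F.fitAt O fold x k j i o - F.lim j i o) ^ 2) := fun j =>
      (((hF.fitAt_meas x k j i).sub (hF.lim_meas j i)).pow_const 2).ennreal_ofReal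
    rw [← lintegral_finsetSum _ fun j _ => hm j,
      ← lintegral_const_mul _ (Finset.measurable_fun_sum _ fun j _ => hm j)]
    refine lintegral_mono_ae ?_
    filter_upwards [hC] with o ho
    rw [← ENNReal.ofReal_sum_of_nonneg fun j _ => sq_nonneg _,
      ← ENNReal.ofReal_mul (by positivity)]
    refine ENNReal.ofReal_le_ofReal ?_
    have e1 : f k x.1 (fold x.1 x.2) (train O fold x.1 k x.2) o =
        ∑ j, (F.fitAt O fold x k j i o - F.lim j i o) * F.coef j b o := by
      simp only [f, score, sub_mul, Finset.sum_sub_distrib]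
      rfl
    rw [e1]
    calc _ ≤ Fintype.card J * ∑ j, ((F.fitAt O fold x k j i o - F.lim j i o) * F.coef j b o) ^ 2 :=
          sq_sum_le_card_mul_sum_sq
      _ ≤ Fintype.card J * ∑ j, C ^ 2 * (F.fitAt O fold x k j i o - F.lim j i o) ^ 2 := by
          gcongr with j
          rw [mul_pow, mul_comm]
          refine mul_le_mul_of_nonneg_right ?_ (sq_nonneg _)
          exact sq_le_sq' (abs_le.1 (ho j b (by simp)).1).1 (abs_le.1 (ho j b (by simp)).1).2
      _ = _ := by rw [← Finset.mul_sum, mul_assoc]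
  have h2 : ∀ k, Tendsto (fun x : ℕ × Ω => (√(x.1 : ℝ))⁻¹ *
      ∑ m ∈ Finset.univ.filter (fun m => fold x.1 x.2 m = k),
        f k x.1 (fold x.1 x.2) (train O fold x.1 k x.2) (O m x.2)) (inProb Pr) (𝓝 0) := fun k =>
    hs.tendsto_fold_centered k (hfm k) (hsq k) (h0 i k)
  -- The normalization `√(K N) / (K N)` of the whole sample equals `√K / K` times the normalization
  -- `1 / √N` of a single fold.
  have h3 := (tendsto_finsetSum Finset.univ fun k _ => h2 k).const_mul (√(K : ℝ) * (K : ℝ)⁻¹)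
  simp only [Finset.sum_const_zero, mul_zero] at h3
  refine h3.congr fun x => ?_
  have hcoord : F.scoreAvg O fold x b i = foldAvg (fold x.1 x.2) fun k m =>
      F.score (F.fitAt O fold x k) b (O m x.2) i := by
    have := map_foldAvg (EuclideanSpace.proj i : Vec p →L[ℝ] ℝ).toLinearMap (fold x.1 x.2)
      fun k m => F.score (F.fitAt O fold x k) b (O m x.2)
    simp only [ContinuousLinearMap.coe_coe, PiLp.proj_apply] at this
    rw [scoreAvg, this]
  have hsum : (∑ m : Fin (K * x.1), F.score F.lim b (O m x.2)) i =
      ∑ m : Fin (K * x.1), F.score F.lim b (O m x.2) i := by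
    simp
  have hinv : (√((K * x.1 : ℕ) : ℝ))⁻¹ = √((K * x.1 : ℕ) : ℝ) * ((K * x.1 : ℕ) : ℝ)⁻¹ := by
    rw [← div_eq_mul_inv, Real.sqrt_div_self', one_div]
  have hconst := foldAvg_const (hs.fold_size x.1 x.2)
    fun m : Fin (K * x.1) => F.score F.lim b (O m x.2) i
  simp only [PiLp.sub_apply, PiLp.smul_apply, smul_eq_mul, hcoord]
  rw [hsum, hinv, mul_assoc (√((K * x.1 : ℕ) : ℝ)), ← smul_eq_mul (a := ((K * x.1 : ℕ) : ℝ)⁻¹), ← hconst,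
    ← mul_sub,
    ← foldAvg_sub, foldAvg_eq (hs.fold_size x.1 x.2), smul_eq_mul]
  simp only [smul_eq_mul, ← Finset.mul_sum]
  have hN : √((x.1 : ℝ)) * (x.1 : ℝ)⁻¹ = (√(x.1 : ℝ))⁻¹ := by
    rw [← div_eq_mul_inv, Real.sqrt_div_self', one_div]
  rw [Nat.cast_mul, Real.sqrt_mul (Nat.cast_nonneg K), ← hN]
  simp only [f, fitAt]
  ring

end Regular

end Features

/-! ### Asymptotic normality and the sandwich estimator for sums of fitted features -/

theorem secondMoment_toEuclideanCLM {𝒳 : Type*} [MeasurableSpace 𝒳] {P : Measure 𝒳} {p : ℕ}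
    {Ψ : 𝒳 → Vec p} (hL2 : ∀ i, MemLp (fun x => Ψ x i) 2 P) (A : Matrix (Fin p) (Fin p) ℝ) :
    secondMoment P (fun x => Matrix.toEuclideanCLM (𝕜 := ℝ) A (Ψ x)) =
      A * secondMoment P Ψ * Aᵀ := by
  have hint : ∀ i j, Integrable (fun x => Ψ x i * Ψ x j) P := fun i j =>
    (hL2 i).integrable_mul (hL2 j)
  ext i j
  have h1 : ∀ x, (Matrix.toEuclideanCLM (𝕜 := ℝ) A (Ψ x)) i *
      (Matrix.toEuclideanCLM (𝕜 := ℝ) A (Ψ x)) j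
      = ∑ l, ∑ m, A i m * A j l * (Ψ x m * Ψ x l) := by
    intro x
    simp only [Matrix.ofLp_toEuclideanCLM, Matrix.mulVec, dotProduct]
    rw [Finset.sum_mul_sum, Finset.sum_comm]
    exact Finset.sum_congr rfl fun l _ => Finset.sum_congr rfl fun m _ => by ring
  simp only [secondMoment, Matrix.of_apply, h1, Matrix.mul_apply, Matrix.transpose_apply]
  rw [integral_finsetSum _ fun l _ => integrable_finsetSum _ fun m _ => (hint m l).const_mul _]
  refine Finset.sum_congr rfl fun l _ => ?_
  rw [integral_finsetSum _ fun m _ => (hint m l).const_mul _, Finset.sum_mul]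
  refine Finset.sum_congr rfl fun m _ => ?_
  rw [integral_const_mul]
  ring

namespace Features.Regular

variable {T q p K : ℕ} {J : Type*} [Fintype J] {F : Features T q p K J}
  {Ω : Type*} [MeasurableSpace Ω] {Pr : Measure Ω} [IsProbabilityMeasure Pr]
  {P : Measure (Traj T q)} [IsProbabilityMeasure P] {O : ℕ → Ω → Traj T q}
  {fold : ∀ N : ℕ, Ω → Fin (K * N) → Fin K}

/-- A consistent solution of the cross-fitted equation is asymptotically linear. -/
theorem tendsto_asymptotically_linear (hF : F.Regular Pr P O fold) (hs : Sampling Pr P O fold)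
    (hK : 0 < K) {b : Vec p}
    (h0 : ∀ i k, ∀ᶠ x in inProb Pr,
      ∫ o, (F.score (F.fitAt O fold x k) b o i - F.score F.lim b o i) ∂P = 0)
    (hmean : ∀ i, ∫ o, F.score F.lim b o i ∂P = 0) (hD : IsUnit (F.jacMean P b))
    {bc : ℕ × Ω → Vec p} (hbc : Tendsto bc (inProb Pr) (𝓝 b))
    (hz : ∀ᶠ x in inProb Pr, F.scoreAvg O fold x (bc x) = 0) :
    Tendsto (fun x : ℕ × Ω => √((K * x.1 : ℕ) : ℝ) • (bc x - b) +
      Matrix.toEuclideanCLM (𝕜 := ℝ) (F.jacMean P b)⁻¹ ((√((K * x.1 : ℕ) : ℝ))⁻¹ •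
        ∑ m : Fin (K * x.1), F.score F.lim b (O m x.2))) (inProb Pr) (𝓝 0) := by
  set D := Matrix.toEuclideanCLM (𝕜 := ℝ) (F.jacMean P b) with hDdef
  set A := Matrix.toEuclideanCLM (𝕜 := ℝ) (F.jacMean P b)⁻¹ with hAdef
  have hAD : ∀ v, A (D v) = v := fun v => by
    have : A * D = 1 := by
      rw [hAdef, hDdef, ← map_mul, Matrix.nonsing_inv_mul _
        ((Matrix.isUnit_iff_isUnit_det _).1 hD), map_one]
    exact congrArg (fun L : Vec p →L[ℝ] Vec p => L v) this
  set X : ℕ × Ω → Vec p := fun x => (√((K * x.1 : ℕ) : ℝ))⁻¹ •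
    ∑ m : Fin (K * x.1), F.score F.lim b (O m x.2) with hX
  set S : ℕ × Ω → Vec p := fun x => F.scoreAvg O fold x b with hS
  have hSX : Tendsto (fun x => √((K * x.1 : ℕ) : ℝ) • S x - X x) (inProb Pr) (𝓝 0) :=
    hF.tendsto_sqrt_scoreAvg_sub hs h0
  have hscore : Measurable (F.score F.lim b) :=
    (PiLp.continuous_toLp 2 fun _ : Fin p => ℝ).measurable.comp
      (measurable_pi_lambda _ fun i => hF.score_meas b i)
  -- Tightness of the normalized sum is read off from the central limit theorem; with `hSX` it makes
  -- `√n S` bounded in probability up to o_P(1).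
  have hXb : BddInProb Pr fun x => ‖X x‖ :=
    (tendstoInDistribution_inv_sqrt_smul_sum hs.meas hs.law hs.indep hscore (hF.score_memLp b)
      hmean (u := fun N => K * N) (tendsto_id.const_mul_atTop' hK)).bddInProb
  obtain ⟨e, he, hexp⟩ := hF.exists_expansion hs hK hbc hz
  have heS : Tendsto (fun x => e x * ‖√((K * x.1 : ℕ) : ℝ) • S x‖) (inProb Pr) (𝓝 0) := by
    have h1 := (hXb.tendsto_mul_zero he).add (he.mul hSX.norm)
    simp only [norm_zero, mul_zero, add_zero] at h1
    refine squeeze_zero' (hexp.mono fun x hx => mul_nonneg hx.1 (norm_nonneg _))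
      (hexp.mono fun x hx => ?_) h1
    rw [← mul_add]
    refine mul_le_mul_of_nonneg_left ?_ hx.1
    have := norm_add_le (X x) (√((K * x.1 : ℕ) : ℝ) • S x - X x)
    rwa [add_sub_cancel] at this
  have hlin : Tendsto (fun x : ℕ × Ω => √((K * x.1 : ℕ) : ℝ) • (bc x - b) +
      A (√((K * x.1 : ℕ) : ℝ) • S x)) (inProb Pr) (𝓝 0) := by
    have hlim := heS.const_mul (2 * ‖A‖ ^ 2)
    rw [mul_zero] at hlim
    have hhalf : ∀ᶠ x in inProb Pr, ‖A‖ * e x < 1 / 2 := by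
      have := he.const_mul ‖A‖
      rw [mul_zero] at this
      exact this.eventually_lt_const one_half_pos
    refine squeeze_zero_norm' ?_ hlim
    filter_upwards [hexp, hhalf] with x ⟨hx0, hx1⟩ hx2
    set Δ := bc x - b with hΔ
    have h1 : ‖Δ + A (S x)‖ ≤ ‖A‖ * (e x * ‖Δ‖) := by
      have : Δ + A (S x) = A (S x + D Δ) := by rw [map_add, hAD, add_comm]
      rw [this]
      exact (A.le_opNorm _).trans (mul_le_mul_of_nonneg_left hx1 (norm_nonneg _))
    -- Once `‖A‖ * e x < 1 / 2`, the remainder is absorbed in the left side. This yields the rate of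
    -- `Δ`, which was known only to tend to zero.
    have h2 : ‖Δ‖ ≤ 2 * ‖A‖ * ‖S x‖ := by
      have h3 : ‖Δ‖ ≤ ‖Δ + A (S x)‖ + ‖A (S x)‖ := by
        have := norm_sub_le (Δ + A (S x)) (A (S x))
        rwa [add_sub_cancel_right] at this
      have h4 := A.le_opNorm (S x)
      nlinarith [norm_nonneg Δ]
    have h5 : ‖Δ + A (S x)‖ ≤ 2 * ‖A‖ ^ 2 * (e x * ‖S x‖) :=
      calc _ ≤ ‖A‖ * (e x * ‖Δ‖) := h1
        _ ≤ ‖A‖ * (e x * (2 * ‖A‖ * ‖S x‖)) := by gcongr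
        _ = _ := by ring
    rw [map_smul, ← smul_add, norm_smul, norm_smul]
    calc _ ≤ ‖√((K * x.1 : ℕ) : ℝ)‖ * (2 * ‖A‖ ^ 2 * (e x * ‖S x‖)) := by gcongr
      _ = _ := by ring
  have h6 := hlin.sub ((A.continuous.tendsto 0).comp hSX)
  simp only [map_zero, sub_zero] at h6
  refine h6.congr fun x => ?_
  simp only [Function.comp_apply, map_sub]
  abel

/-- Asymptotic normality of a solution of the cross-fitted equation. -/
theorem tendstoInDistribution (hF : F.Regular Pr P O fold) (hs : Sampling Pr P O fold)
    (hK : 0 < K) {b : Vec p}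
    (h0 : ∀ i k, ∀ᶠ x in inProb Pr,
      ∫ o, (F.score (F.fitAt O fold x k) b o i - F.score F.lim b o i) ∂P = 0)
    (hmean : ∀ i, ∫ o, F.score F.lim b o i ∂P = 0) (hD : IsUnit (F.jacMean P b))
    {bc : ℕ → Ω → Vec p} (hbcm : ∀ N, Measurable (bc N))
    (hbc : Tendsto (fun x : ℕ × Ω => bc x.1 x.2) (inProb Pr) (𝓝 b))
    (hz : ∀ᶠ x in inProb Pr, F.scoreAvg O fold x (bc x.1 x.2) = 0) :
    TendstoInDistribution (fun N ω => √((K * N : ℕ) : ℝ) • (bc N ω - b)) atTop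
      (id : Vec p → Vec p) (fun _ => Pr) (multivariateGaussian 0
        ((F.jacMean P b)⁻¹ * secondMoment P (F.score F.lim b) * ((F.jacMean P b)⁻¹)ᵀ)) := by
  have hscore : Measurable (F.score F.lim b) :=
    (PiLp.continuous_toLp 2 fun _ : Fin p => ℝ).measurable.comp
      (measurable_pi_lambda _ fun i => hF.score_meas b i)
  -- Solving `0 ≈ S + D Δ` gives `Δ ≈ -D⁻¹ S`; the sign disappears in the variance.
  set A := -(F.jacMean P b)⁻¹ with hA
  let Ψ : Traj T q → Vec p := fun o => Matrix.toEuclideanCLM (𝕜 := ℝ) A (F.score F.lim b o)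
  have hcoord : ∀ i o, Ψ o i = ∑ l, A i l * F.score F.lim b o l := fun i o => rfl
  have hvar : (F.jacMean P b)⁻¹ * secondMoment P (F.score F.lim b) * ((F.jacMean P b)⁻¹)ᵀ =
      secondMoment P Ψ := by
    rw [secondMoment_toEuclideanCLM (hF.score_memLp b) A, hA]
    simp
  have hclt := tendstoInDistribution_inv_sqrt_smul_sum hs.meas hs.law hs.indep (Ψ := Ψ)
    ((Matrix.toEuclideanCLM (𝕜 := ℝ) A).continuous.measurable.comp hscore)
    (fun i => by
      simp only [hcoord]
      exact memLp_finsetSum _ fun l _ => (hF.score_memLp b l).const_mul _)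
    (fun i => by
      simp only [hcoord]
      rw [integral_finsetSum _ fun l _ =>
        ((hF.score_memLp b l).integrable one_le_two).const_mul _]
      refine Finset.sum_eq_zero fun l _ => ?_
      rw [integral_const_mul, hmean, mul_zero])
    (u := fun N => K * N) (tendsto_id.const_mul_atTop' hK)
  rw [hvar]
  -- Slutsky's lemma: the estimator differs from the sum of the transformed scores by o_P(1).
  refine tendstoInDistribution_of_tendstoInMeasure_sub _ _ hclt ?_
    fun N => (((hbcm N).sub_const b).const_smul (√((K * N : ℕ) : ℝ))).aemeasurable
  refine tendstoInMeasure_iff_inProb.2 ?_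
  refine (hF.tendsto_asymptotically_linear hs hK h0 hmean hD hbc hz).congr fun x => ?_
  simp only [Pi.sub_apply, Ψ, hA, map_neg, map_smul, map_sum, neg_apply,
    Finset.sum_neg_distrib, smul_neg, sub_neg_eq_add]

/-- Consistency of the cross-fitted sandwich estimator. -/
theorem tendsto_sandwich (hF : F.Regular Pr P O fold) (hs : Sampling Pr P O fold)
    (hK : 0 < K) {b : Vec p} (hD : IsUnit (F.jacMean P b)) {bc : ℕ × Ω → Vec p}
    (hbc : Tendsto bc (inProb Pr) (𝓝 b)) :
    Tendsto (fun x => (F.jacAvg O fold x (bc x))⁻¹ * F.sqAvg O fold x (bc x) *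
        ((F.jacAvg O fold x (bc x))⁻¹)ᵀ) (inProb Pr)
      (𝓝 ((F.jacMean P b)⁻¹ * secondMoment P (F.score F.lim b) * ((F.jacMean P b)⁻¹)ᵀ)) := by
  -- Convergence is joint in the sample and the parameter, so a consistent random point may be
  -- substituted.
  have h1 := tendsto_matrix_inv ((hF.tendsto_jacAvg hs hK b).comp (tendsto_id.prodMk hbc)) hD
  have h2 := (hF.tendsto_sqAvg hs hK b).comp (tendsto_id.prodMk hbc)
  exact (h1.mul h2).mul ((Continuous.matrix_transpose continuous_id).continuousAt.tendsto.comp h1)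

end Features.Regular

/-! ### Conditioning on an event and on a sub-σ-algebra -/

theorem integral_mul_condExp {Ω : Type*} {m m0 : MeasurableSpace Ω} (hm : m ≤ m0)
    {μ : Measure[m0] Ω} [IsFiniteMeasure μ] {f g : Ω → ℝ} (hf : StronglyMeasurable[m] f)
    (hfg : Integrable (fun x => f x * g x) μ) (hg : Integrable g μ) :
    ∫ x, f x * g x ∂μ = ∫ x, f x * (μ[g|m]) x ∂μ := by
  rw [← integral_condExp hm (f := fun x => f x * g x)]
  exact integral_congr_ae (condExp_mul_of_stronglyMeasurable_left hf hfg hg)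

/-- The conditional law is a multiple of the restriction to `s`, so the pull-out property under it
can be rescaled to integrals over `s`; a null `s` makes both sides zero. -/
theorem setIntegral_mul_condExp_cond {Ω : Type*} {m m0 : MeasurableSpace Ω} (hm : m ≤ m0)
    {μ : Measure[m0] Ω} [IsFiniteMeasure μ] {s : Set Ω} {f g : Ω → ℝ}
    (hf : StronglyMeasurable[m] f) (hfg : IntegrableOn (fun x => f x * g x) s μ)
    (hg : IntegrableOn g s μ) :
    ∫ x in s, f x * g x ∂μ = ∫ x in s, f x * ((ProbabilityTheory.cond μ s)[g|m]) x ∂μ := by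
  by_cases h0 : μ s = 0
  · simp [Measure.restrict_eq_zero.2 h0]
  have hprob : IsProbabilityMeasure (ProbabilityTheory.cond μ s) := cond_isProbabilityMeasure h0
  have hc : (μ s)⁻¹ ≠ ⊤ := ENNReal.inv_ne_top.2 h0
  have h1 : ∫ x, f x * g x ∂(ProbabilityTheory.cond μ s) =
      ∫ x, f x * ((ProbabilityTheory.cond μ s)[g|m]) x ∂(ProbabilityTheory.cond μ s) :=
    integral_mul_condExp hm hf (Integrable.smul_measure hfg hc) (Integrable.smul_measure hg hc)
  have hint : ∀ F : Ω → ℝ, ∫ x, F x ∂(ProbabilityTheory.cond μ s) =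
      ((μ s)⁻¹).toReal * ∫ x in s, F x ∂μ := fun F => by
    rw [ProbabilityTheory.cond, integral_smul_measure, smul_eq_mul]
  rw [hint, hint] at h1
  have hne : ((μ s)⁻¹).toReal ≠ 0 :=
    ENNReal.toReal_ne_zero.2 ⟨ENNReal.inv_ne_zero.2 (measure_ne_top _ _), hc⟩
  exact mul_left_cancel₀ hne h1

/-! ### The design of the trial -/

section design

variable {T q r p : ℕ}

theorem measurable_avail (t : Fin T) : Measurable (avail (q := q) t) :=
  measurable_fst.comp (measurable_fst.comp (measurable_pi_apply t))

theorem measurable_trt (t : Fin T) : Measurable (trt (q := q) t) :=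
  measurable_fst.comp (measurable_snd.comp (measurable_pi_apply t))

theorem measurable_outc (t : Fin T) : Measurable (outc (q := q) t) :=
  measurable_snd.comp (measurable_snd.comp (measurable_pi_apply t))

theorem measurable_hist (t : Fin T) : Measurable (hist (q := q) t) :=
  (measurable_pi_lambda _ fun _ => measurable_pi_apply _).prodMk
    (measurable_fst.comp (measurable_pi_apply t))

theorem measurable_bit : Measurable bit := measurable_from_top

theorem Spec.measurable_S (M : Spec T q r p) (t : Fin T) : Measurable (M.S t) :=
  (M.modr_meas t).comp (measurable_hist t)

theorem comap_hist_le (t : Fin T) :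
    MeasurableSpace.comap (hist (q := q) t) inferInstance ≤ MeasurableSpace.pi :=
  (measurable_hist t).comap_le

/-- A function of the history is measurable with respect to the history. -/
theorem stronglyMeasurable_hist {t : Fin T} {f : Hist q t → ℝ} (hf : Measurable f) :
    StronglyMeasurable[MeasurableSpace.comap (hist (q := q) t) inferInstance]
      fun o => f (hist t o) :=
  (hf.comp (comap_measurable (hist t))).stronglyMeasurable

theorem measurableSet_avail (t : Fin T) : MeasurableSet {o : Traj T q | avail t o = true} :=
  measurable_avail t (measurableSet_singleton true)

theorem measurableSet_trt (t : Fin T) (a : Bool) : MeasurableSet {o : Traj T q | trt t o = a} :=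
  measurable_trt t (measurableSet_singleton a)

namespace Spec

variable (M : Spec T q r p) {P : Measure (Traj T q)}

/-- The conditional probability of `A_t = a` given the history. -/
noncomputable def armProb (t : Fin T) (a : Bool) (h : Hist q t) : ℝ :=
  if a then M.prob t h else 1 - M.prob t h

theorem measurable_armProb (t : Fin T) (a : Bool) : Measurable (M.armProb t a) := by
  cases a
  · exact (M.prob_meas t).const_sub 1
  · exact M.prob_meas t

variable {M}

/-- A lower bound for the probability of either arm, given availability. -/
def Positive (M : Spec T q r p) (P : Measure (Traj T q)) (τ : ℝ) : Prop :=
  0 < τ ∧ ∀ t a, ∀ᵐ o ∂P, avail t o = true → τ < M.armProb t a (hist t o)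

theorem Design.exists_positive (hd : M.Design P) : ∃ τ, M.Positive P τ := by
  obtain ⟨τ, hτ, h⟩ := hd.positivity
  refine ⟨τ, hτ, fun t a => ?_⟩
  filter_upwards [h t] with o ho hav
  have := ho hav
  cases a
  · simp only [armProb, Bool.false_eq_true, if_false]; linarith
  · simp only [armProb, if_true]; linarith

variable [IsProbabilityMeasure P]

/-- Positivity says nothing about `p_t` at unavailable histories. Integrability comes from its being
almost surely a conditional expectation. -/
theorem Design.integrable_armProb (hd : M.Design P) (t : Fin T) (a : Bool) :
    Integrable (fun o => M.armProb t a (hist t o)) P := by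
  have h1 : Integrable (fun o => M.prob t (hist t o)) P :=
    integrable_condExp.congr (hd.randomized t)
  cases a
  · exact (integrable_const 1).sub h1
  · exact h1

/-- The indicator of the arm is replaced by its conditional expectation given the history, with
respect to which `f` is measurable. -/
theorem Design.setIntegral_trt (hd : M.Design P) (t : Fin T) (a : Bool) {f : Traj T q → ℝ}
    (hf : StronglyMeasurable[MeasurableSpace.comap (hist (q := q) t) inferInstance] f)
    (hfi : Integrable f P) :
    ∫ o in {o | trt t o = a}, f o ∂P = ∫ o, f o * M.armProb t a (hist t o) ∂P := by
  have hb : Measurable fun o : Traj T q => bit (trt t o) :=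
    measurable_bit.comp (measurable_trt t)
  have hb1 : ∀ o : Traj T q, ‖bit (trt t o)‖ ≤ 1 := fun o => by
    unfold bit; split_ifs <;> simp
  have hbi : Integrable (fun o : Traj T q => bit (trt t o)) P :=
    Integrable.of_bound hb.aestronglyMeasurable 1 (ae_of_all _ hb1)
  have hfb : Integrable (fun o => f o * bit (trt t o)) P :=
    hfi.mul_bdd (c := 1) hb.aestronglyMeasurable (ae_of_all _ hb1)
  have key : ∫ o, f o * bit (trt t o) ∂P = ∫ o, f o * M.prob t (hist t o) ∂P := by
    rw [integral_mul_condExp (comap_hist_le t) hf hfb hbi]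
    refine integral_congr_ae ?_
    filter_upwards [hd.randomized t] with o ho
    rw [ho]
  have hfp : Integrable (fun o => f o * M.prob t (hist t o)) P := by
    have h1 := (integrable_condExp (μ := P) (m := MeasurableSpace.comap (hist t) inferInstance)
      (f := fun o => f o * bit (trt t o)))
    refine h1.congr ?_
    filter_upwards [condExp_mul_of_stronglyMeasurable_left hf hfb hbi, hd.randomized t]
      with o ho1 ho2
    have ho1' := ho1
    simp only [Pi.mul_apply] at ho1'
    rw [← ho2]
    exact ho1'
  have hind : ∫ o in {o | trt t o = a}, f o ∂P =
      ∫ o, {o | trt t o = a}.indicator f o ∂P := (integral_indicator (measurableSet_trt t a)).symm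
  rw [hind]
  cases a
  · have h2 : ∀ o, {o : Traj T q | trt t o = false}.indicator f o = f o - f o * bit (trt t o) := by
      intro o
      by_cases h : trt t o = false <;> simp [h, bit, Set.indicator]
    simp only [h2]
    rw [integral_sub hfi hfb, key, ← integral_sub hfi hfp]
    refine integral_congr_ae (ae_of_all _ fun o => ?_)
    simp [armProb]
    ring
  · have h2 : ∀ o, {o : Traj T q | trt t o = true}.indicator f o = f o * bit (trt t o) := by
      intro o
      by_cases h : trt t o = true <;> simp [h, bit, Set.indicator]
    simp only [h2]
    rw [key]
    rfl

/-- Positivity: integrals over the available histories are controlled by either arm. -/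
theorem Design.lintegral_avail_le (hd : M.Design P) {τ : ℝ} (hτ : M.Positive P τ) (t : Fin T)
    (a : Bool) {f : Hist q t → ℝ≥0∞} (hf : Measurable f) :
    ENNReal.ofReal τ * ∫⁻ o in {o | avail t o = true}, f (hist t o) ∂P ≤
      ∫⁻ o in {o | trt t o = a}, f (hist t o) ∂P := by
  -- It is enough to compare the two image measures on histories, set by set. Availability is part
  -- of the history, so it can be absorbed in the set.
  have hle : ENNReal.ofReal τ • (P.restrict {o | avail t o = true}).map (hist t) ≤
      (P.restrict {o | trt t o = a}).map (hist t) := by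
    refine Measure.le_iff.2 fun B hB => ?_
    have hBm := measurable_hist t hB
    rw [Measure.smul_apply, Measure.map_apply (measurable_hist t) hB,
      Measure.map_apply (measurable_hist t) hB, Measure.restrict_apply hBm,
      Measure.restrict_apply hBm, smul_eq_mul]
    set E : Set (Hist q t) := B ∩ {h | h.2.1 = true} with hE
    have hEm : MeasurableSet E := hB.inter
      ((measurable_fst.comp measurable_snd) (measurableSet_singleton true))
    have hset : hist t ⁻¹' B ∩ {o : Traj T q | avail t o = true} = hist t ⁻¹' E := rfl
    have h1 := hd.setIntegral_trt t a (f := fun o => E.indicator (fun _ => (1 : ℝ)) (hist t o))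
      (stronglyMeasurable_hist (measurable_const.indicator hEm))
      (Integrable.of_bound (((measurable_const.indicator hEm).comp
        (measurable_hist t)).aestronglyMeasurable) 1 (ae_of_all _ fun o => by
          by_cases h : hist t o ∈ E <;> simp [h]))
    have h2 : ∫ o in {o | trt t o = a}, E.indicator (fun _ => (1 : ℝ)) (hist t o) ∂P =
        P.real (hist t ⁻¹' E ∩ {o | trt t o = a}) := by
      have : (fun o : Traj T q => E.indicator (fun _ => (1 : ℝ)) (hist t o)) =
          (hist t ⁻¹' E).indicator fun _ => (1 : ℝ) := rfl
      rw [this, integral_indicator (measurable_hist t hEm)]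
      simp [Measure.restrict_restrict (measurable_hist t hEm), measureReal_def]
    have h3 : τ * P.real (hist t ⁻¹' E) ≤
        ∫ o, E.indicator (fun _ => (1 : ℝ)) (hist t o) * M.armProb t a (hist t o) ∂P := by
      have e1 : ∀ o : Traj T q, E.indicator (fun _ => (1 : ℝ)) (hist t o) *
          M.armProb t a (hist t o) =
          (hist t ⁻¹' E).indicator (fun o => M.armProb t a (hist t o)) o := by
        intro o
        by_cases h : hist t o ∈ E <;> simp [h, Set.indicator]
      simp only [e1]
      rw [integral_indicator (measurable_hist t hEm)]
      have e2 : τ * P.real (hist t ⁻¹' E) = ∫ _ in hist t ⁻¹' E, τ ∂P := by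
        simp [mul_comm]
      rw [e2]
      refine integral_mono_ae (integrable_const _) (hd.integrable_armProb t a).integrableOn ?_
      refine (ae_restrict_iff' (measurable_hist t hEm)).2 ?_
      filter_upwards [hτ.2 t a] with o ho hoE
      exact (ho hoE.2).le
    rw [hset, ← hset, ← ofReal_measureReal, ← ofReal_measureReal, ← ENNReal.ofReal_mul hτ.1.le]
    refine ENNReal.ofReal_le_ofReal ?_
    rw [hset]
    refine h3.trans ((h1.symm.trans h2).le.trans (measureReal_mono fun o ho => ?_))
    exact ⟨ho.1.1, ho.2⟩
  calc _ = ∫⁻ h, f h ∂(ENNReal.ofReal τ • (P.restrict {o | avail t o = true}).map (hist t)) := by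
        rw [lintegral_smul_measure, lintegral_map hf (measurable_hist t), smul_eq_mul]
    _ ≤ ∫⁻ h, f h ∂((P.restrict {o | trt t o = a}).map (hist t)) := lintegral_mono' hle le_rfl
    _ = _ := lintegral_map hf (measurable_hist t)

/-- A property of the history that holds in one arm holds whenever treatment is available. -/
theorem Design.ae_avail (hd : M.Design P) (t : Fin T) (a : Bool) {E : Set (Hist q t)}
    (hE : MeasurableSet E) (h : ∀ᵐ o ∂P, trt t o = a → hist t o ∈ E) :
    ∀ᵐ o ∂P, avail t o = true → hist t o ∈ E := by
  obtain ⟨τ, hτ⟩ := hd.exists_positive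
  have h1 := hd.lintegral_avail_le hτ t a (f := Eᶜ.indicator 1) (measurable_one.indicator hE.compl)
  have hEm : Measurable fun o : Traj T q => Eᶜ.indicator (1 : Hist q t → ℝ≥0∞) (hist t o) :=
    (measurable_one.indicator hE.compl).comp (measurable_hist t)
  have h2 : ∫⁻ o in {o | trt t o = a}, Eᶜ.indicator 1 (hist t o) ∂P = 0 := by
    rw [lintegral_eq_zero_iff hEm]
    refine (ae_restrict_iff' (measurableSet_trt t a)).2 ?_
    filter_upwards [h] with o ho hoa
    simp [ho hoa]
  rw [h2] at h1
  have h3 : ∫⁻ o in {o | avail t o = true}, Eᶜ.indicator 1 (hist t o) ∂P = 0 := by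
    have := le_antisymm h1 zero_le
    rcases mul_eq_zero.1 this with h4 | h4
    · exact absurd h4 (by simpa using hτ.1)
    · exact h4
  rw [lintegral_eq_zero_iff hEm] at h3
  filter_upwards [(ae_restrict_iff' (measurableSet_avail t)).1 h3] with o ho hoa
  by_contra hcon
  have := ho hoa
  simp [hcon] at this

/-- `BoundedMu` controls `mu` only at the treatment received, whereas the residual uses both arms.
Positivity transfers the bound to either arm at the available histories. -/
theorem Design.boundedMu (hd : M.Design P) {t : Fin T} {C : ℝ} {mu : Hist q t → Bool → ℝ}
    (hm : Measurable fun y : Hist q t × Bool => mu y.1 y.2) (h : BoundedMu P C t mu) (a : Bool) :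
    ∀ᵐ o ∂P, avail t o = true → |mu (hist t o) a| ≤ C := by
  refine hd.ae_avail t a (E := {h | |mu h a| ≤ C}) (measurableSet_le
    (measurable_norm.comp (hm.comp measurable_prodMk_right)) measurable_const) ?_
  filter_upwards [h] with o ho hoa
  rw [hoa] at ho
  exact ho

/-- The same transfer for L₂ distances; the price is the factor `τ`. -/
theorem Design.lintegral_sub_mu_le (hd : M.Design P) {τ : ℝ} (hτ : M.Positive P τ) {t : Fin T}
    {mu mu' : Hist q t → Bool → ℝ} (hm : Measurable fun y : Hist q t × Bool => mu y.1 y.2)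
    (hm' : Measurable fun y : Hist q t × Bool => mu' y.1 y.2) (a : Bool) :
    ENNReal.ofReal τ * ∫⁻ o in {o | avail t o = true},
        ENNReal.ofReal ((mu (hist t o) a - mu' (hist t o) a) ^ 2) ∂P ≤ sqDistMu P t mu mu' := by
  refine (hd.lintegral_avail_le hτ t a (f := fun h => ENNReal.ofReal ((mu h a - mu' h a) ^ 2))
    ((((hm.comp measurable_prodMk_right).sub
      (hm'.comp measurable_prodMk_right)).pow_const 2).ennreal_ofReal)).trans ?_
  calc _ = ∫⁻ o in {o | trt t o = a},
        ENNReal.ofReal ((mu (hist t o) (trt t o) - mu' (hist t o) (trt t o)) ^ 2) ∂P := by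
        refine setLIntegral_congr_fun (measurableSet_trt t a) fun o ho => ?_
        have : trt t o = a := ho
        simp only [this]
    _ ≤ _ := setLIntegral_le_lintegral _ _

end Spec

end design

/-! ### Conditional means and inverse probability weighting -/

theorem ae_cond_iff {Ω : Type*} [MeasurableSpace Ω] {μ : Measure Ω} [IsFiniteMeasure μ] {s : Set Ω}
    (hs : MeasurableSet s) {E : Ω → Prop} :
    (∀ᵐ x ∂(ProbabilityTheory.cond μ s), E x) ↔ ∀ᵐ x ∂μ, x ∈ s → E x := by
  rw [ProbabilityTheory.cond, Measure.ae_ennreal_smul_measure_iff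
    (ENNReal.inv_ne_zero.2 (measure_ne_top _ _)), ae_restrict_iff' hs]

theorem integrableOn_mul_of_bdd {Ω : Type*} [MeasurableSpace Ω] {μ : Measure Ω} {s : Set Ω}
    (hs : MeasurableSet s) {f g : Ω → ℝ} (hf : IntegrableOn f s μ) (hg : Measurable g) {C : ℝ}
    (hbd : ∀ᵐ x ∂μ, x ∈ s → |g x| ≤ C) : IntegrableOn (fun x => f x * g x) s μ :=
  Integrable.mul_bdd (c := C) hf hg.aestronglyMeasurable ((ae_restrict_iff' hs).2 hbd)

namespace Spec

variable {T q r p : ℕ} {M : Spec T q r p} {P : Measure (Traj T q)} [IsProbabilityMeasure P]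

theorem stronglyMeasurable_meanGivenHist (t : Fin T) (a : Bool) :
    StronglyMeasurable[MeasurableSpace.comap (hist (q := q) t) inferInstance]
      (meanGivenHist P t a) := stronglyMeasurable_condExp

theorem measurable_meanGivenHist (t : Fin T) (a : Bool) : Measurable (meanGivenHist P t a) :=
  ((stronglyMeasurable_meanGivenHist t a).mono (comap_hist_le t)).measurable

theorem measurable_meanGivenMod (t : Fin T) (a : Bool) : Measurable (M.meanGivenMod P t a) :=
  (stronglyMeasurable_condExp.mono (M.measurable_S t).comap_le).measurable

/-- The conditional mean is defined under `P(· | A_t = a)`, so its bound holds at first only in that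
arm. As a function of the history it stays bounded, by positivity, at all available histories. -/
theorem Design.meanGivenHist_bdd (hd : M.Design P) {R : ℝ} {t : Fin T}
    (hR : ∀ᵐ o ∂P, |outc t o| ≤ R) (a : Bool) :
    ∀ᵐ o ∂P, avail t o = true → |meanGivenHist P t a o| ≤ max R 0 := by
  have h1 : ∀ᵐ o ∂(ProbabilityTheory.cond P {o | trt t o = a}),
      |meanGivenHist P t a o| ≤ max R 0 := by
    have := ae_bdd_abs_condExp_of_ae_bdd_abs (R := max R 0)
      (m := MeasurableSpace.comap (hist (q := q) t) inferInstance)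
      (μ := ProbabilityTheory.cond P {o | trt t o = a}) (f := outc t)
      ((ae_cond_iff (measurableSet_trt t a)).2 (hR.mono fun o ho _ =>
        ho.trans (le_max_left _ _)))
    simpa [meanGivenHist] using this
  have h2 := (ae_cond_iff (measurableSet_trt t a)).1 h1
  have h3 : MeasurableSet[MeasurableSpace.comap (hist (q := q) t) inferInstance]
      {o | |meanGivenHist P t a o| ≤ max R 0} :=
    measurableSet_le (measurable_norm.comp (stronglyMeasurable_meanGivenHist t a).measurable)
      measurable_const
  obtain ⟨E, hE, hEeq⟩ := h3
  have hmem : ∀ o, hist t o ∈ E ↔ |meanGivenHist P t a o| ≤ max R 0 := fun o => by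
    change o ∈ hist t ⁻¹' E ↔ _
    rw [hEeq]; rfl
  simp only [← hmem]
  refine hd.ae_avail t a hE ?_
  filter_upwards [h2] with o ho hoa
  exact (hmem o).2 (ho hoa)

theorem meanGivenMod_bdd {R : ℝ} {t : Fin T} {a : Bool}
    (hR : ∀ᵐ o ∂P, avail t o = true → |meanGivenHist P t a o| ≤ max R 0) :
    ∀ᵐ o ∂P, avail t o = true → |M.meanGivenMod P t a o| ≤ max R 0 := by
  have h1 := (ae_cond_iff (μ := P) (measurableSet_avail (q := q) t)).2 hR
  have := ae_bdd_abs_condExp_of_ae_bdd_abs (R := max R 0)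
    (m := MeasurableSpace.comap (M.S t) inferInstance) (by simpa using h1)
  exact (ae_cond_iff (measurableSet_avail t)).1 (by simpa [meanGivenMod] using this)

/-- The inverse probability weight of arm `a`. -/
noncomputable def ipw (M : Spec T q r p) (t : Fin T) (a : Bool) (o : Traj T q) : ℝ :=
  bit (avail t o) * (M.armProb t a (hist t o))⁻¹

theorem stronglyMeasurable_ipw (t : Fin T) (a : Bool) :
    StronglyMeasurable[MeasurableSpace.comap (hist (q := q) t) inferInstance] (M.ipw t a) :=
  stronglyMeasurable_hist (f := fun h => bit h.2.1 * (M.armProb t a h)⁻¹)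
    ((measurable_bit.comp (measurable_fst.comp measurable_snd)).mul (M.measurable_armProb t a).inv)

theorem measurable_ipw (t : Fin T) (a : Bool) : Measurable (M.ipw t a) :=
  ((stronglyMeasurable_ipw t a).mono (comap_hist_le t)).measurable

theorem Positive.ipw_le {τ : ℝ} (hτ : M.Positive P τ) (t : Fin T) (a : Bool) :
    ∀ᵐ o ∂P, |M.ipw t a o| ≤ τ⁻¹ := by
  filter_upwards [hτ.2 t a] with o ho
  by_cases h : avail t o = true
  · have := ho h
    have hpos := hτ.1.trans this
    simp only [ipw, bit, h, if_true, one_mul]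
    rw [abs_of_pos (inv_pos.2 hpos)]
    exact inv_anti₀ hτ.1 this.le
  · simp only [ipw, bit, h]
    simpa using hτ.1.le

theorem Positive.integrable_ipw_mul {τ : ℝ} (hτ : M.Positive P τ) (t : Fin T) (a : Bool)
    {f : Traj T q → ℝ} (hfi : IntegrableOn f {o | avail t o = true} P) :
    Integrable (fun o => M.ipw t a o * f o) P := by
  have h1 : Integrable ({o | avail t o = true}.indicator f) P :=
    hfi.integrable_indicator (measurableSet_avail t)
  refine (h1.bdd_mul (measurable_ipw (M := M) t a).aestronglyMeasurable (hτ.ipw_le t a)).congr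
    (ae_of_all _ fun o => ?_)
  by_cases h : avail t o = true <;> simp [h, ipw, bit, Set.indicator]

/-- Inverse probability weighting recovers integrals of functions of the history. -/
theorem Design.setIntegral_ipw (hd : M.Design P) (t : Fin T) (a : Bool) {f : Traj T q → ℝ}
    (hf : StronglyMeasurable[MeasurableSpace.comap (hist (q := q) t) inferInstance] f)
    (hfi : IntegrableOn f {o | avail t o = true} P) :
    ∫ o in {o | trt t o = a}, M.ipw t a o * f o ∂P = ∫ o in {o | avail t o = true}, f o ∂P := by
  obtain ⟨τ, hτ⟩ := hd.exists_positive
  rw [hd.setIntegral_trt t a (f := fun o => M.ipw t a o * f o)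
      ((stronglyMeasurable_ipw t a).mul hf) (hτ.integrable_ipw_mul t a hfi),
    ← integral_indicator (measurableSet_avail t)]
  refine integral_congr_ae ?_
  filter_upwards [hτ.2 t a] with o ho
  by_cases h : avail t o = true
  · have := (hτ.1.trans (ho h)).ne'
    simp only [ipw, bit, h, if_true, one_mul, Set.indicator, Set.mem_ofPred_eq]
    field_simp
  · simp [ipw, bit, h, Set.indicator]

/-- Inverse probability weighting recovers the conditional mean outcome in an arm. -/
theorem Design.setIntegral_ipw_outc (hd : M.Design P) {R : ℝ} {t : Fin T}
    (hR : ∀ᵐ o ∂P, |outc t o| ≤ R) (a : Bool) {f : Traj T q → ℝ}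
    (hf : StronglyMeasurable[MeasurableSpace.comap (hist (q := q) t) inferInstance] f)
    (hfi : IntegrableOn f {o | avail t o = true} P) :
    ∫ o in {o | trt t o = a}, M.ipw t a o * f o * outc t o ∂P =
      ∫ o in {o | avail t o = true}, f o * meanGivenHist P t a o ∂P := by
  obtain ⟨τ, hτ⟩ := hd.exists_positive
  have hg := (stronglyMeasurable_ipw (M := M) t a).mul hf
  have hgi := hτ.integrable_ipw_mul t a hfi
  have hY : Integrable (outc (q := q) t) P :=
    Integrable.of_bound (measurable_outc t).aestronglyMeasurable R hR
  -- Within the arm the outcome is replaced by its conditional mean given the history; after that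
  -- the integrand is a function of the history and the weight can be removed.
  have h1 := setIntegral_mul_condExp_cond (μ := P) (s := {o | trt t o = a}) (g := outc t)
    (comap_hist_le t) hg
    (hgi.mul_bdd (c := R) (measurable_outc t).aestronglyMeasurable hR).integrableOn hY.integrableOn
  have h2 := hd.setIntegral_ipw t a (hf.mul (stronglyMeasurable_meanGivenHist t a))
    (integrableOn_mul_of_bdd (measurableSet_avail t) hfi (measurable_meanGivenHist t a)
      (hd.meanGivenHist_bdd hR a))
  simp only [Pi.mul_apply] at h1 h2
  rw [h1, ← h2]
  refine integral_congr_ae (ae_of_all _ fun o => ?_)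
  simp only [meanGivenHist]
  ring

/-- The contribution of one arm to the mean of an inverse probability weighted equation. -/
theorem Design.setIntegral_arm (hd : M.Design P) {R : ℝ} {t : Fin T}
    (hR : ∀ᵐ o ∂P, |outc t o| ≤ R) (a : Bool) {ρ : Vec r → ℝ} (hρ : Measurable ρ)
    (hρi : IntegrableOn (fun o => ρ (M.S t o)) {o | avail t o = true} P)
    {f : Hist q t → ℝ} (hf : Measurable f)
    (hfi : IntegrableOn (fun o => f (hist t o)) {o | avail t o = true} P) :
    ∫ o in {o | trt t o = a}, M.ipw t a o * (ρ (M.S t o) * outc t o - f (hist t o)) ∂P =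
      ∫ o in {o | avail t o = true},
        (ρ (M.S t o) * M.meanGivenMod P t a o - f (hist t o)) ∂P := by
  obtain ⟨τ, hτ⟩ := hd.exists_positive
  have hρs : StronglyMeasurable[MeasurableSpace.comap (hist (q := q) t) inferInstance]
      fun o => ρ (M.S t o) := stronglyMeasurable_hist (hρ.comp (M.modr_meas t))
  have hm := hd.meanGivenHist_bdd hR a
  have hmi : IntegrableOn (meanGivenHist P t a) {o | avail t o = true} P :=
    Measure.integrableOn_of_bounded (M := max R 0) (measure_ne_top _ _)
      (measurable_meanGivenHist t a).aestronglyMeasurable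
      ((ae_restrict_iff' (measurableSet_avail t)).2 hm)
  have h1 := hd.setIntegral_ipw_outc hR a hρs hρi
  have h2 := hd.setIntegral_ipw t a (stronglyMeasurable_hist hf) hfi
  -- The second conditioning, from `H_t` down to `S_t` on the available histories, is possible
  -- because `ρ` depends on `S_t` alone.
  have h3 := setIntegral_mul_condExp_cond (μ := P) (s := {o | avail t o = true})
    (g := meanGivenHist P t a) (m := MeasurableSpace.comap (M.S t) inferInstance)
    (f := fun o => ρ (M.S t o)) (M.measurable_S t).comap_le
    (hρ.comp (comap_measurable (M.S t))).stronglyMeasurable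
    (integrableOn_mul_of_bdd (measurableSet_avail t) hρi (measurable_meanGivenHist t a) hm) hmi
  have i1 : IntegrableOn (fun o => M.ipw t a o * ρ (M.S t o) * outc t o) {o | trt t o = a} P :=
    ((hτ.integrable_ipw_mul t a hρi).mul_bdd (c := R)
      (measurable_outc t).aestronglyMeasurable hR).integrableOn
  have i2 : IntegrableOn (fun o => M.ipw t a o * f (hist t o)) {o | trt t o = a} P :=
    (hτ.integrable_ipw_mul t a hfi).integrableOn
  have i3 : IntegrableOn (fun o => ρ (M.S t o) * M.meanGivenMod P t a o)
      {o | avail t o = true} P :=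
    integrableOn_mul_of_bdd (measurableSet_avail t) hρi (measurable_meanGivenMod t a)
      (meanGivenMod_bdd hm)
  rw [integral_sub i3 hfi]
  have e : ∀ o, M.ipw t a o * (ρ (M.S t o) * outc t o - f (hist t o)) =
      M.ipw t a o * ρ (M.S t o) * outc t o - M.ipw t a o * f (hist t o) := fun o => by ring
  simp only [e]
  rw [integral_sub i1 i2, h1, h2, h3]
  rfl

end Spec

namespace Spec

variable {T q r p : ℕ} {M : Spec T q r p} {P : Measure (Traj T q)} [IsProbabilityMeasure P]

theorem abs_bit_le (a : Bool) : |bit a| ≤ 1 := by cases a <;> simp [bit]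

theorem BoundedSupport.exists_bound (h : M.BoundedSupport P) (R : ℝ) : ∃ c : ℝ, 0 ≤ c ∧
    ∀ t, ∀ᵐ o ∂P, |outc t o| ≤ c ∧ ∀ b, ‖b‖ ≤ R → |M.gam t (M.S t o) b| ≤ c ∧
      ‖fderiv ℝ (M.gam t (M.S t o)) b‖ ≤ c ∧
      ‖fderiv ℝ (fderiv ℝ (M.gam t (M.S t o))) b‖ ≤ c := by
  obtain ⟨R₀, h⟩ := h
  choose c hc using fun t => M.gam_bdd t (max R₀ R)
  -- One constant for all decision points: the sum of absolute values dominates every `c t`,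
  -- whatever its sign.
  refine ⟨max R₀ 0 + ∑ t, |c t|, by positivity, fun t => ?_⟩
  have hct : c t ≤ ∑ t, |c t| :=
    (le_abs_self _).trans (Finset.single_le_sum (f := fun t => |c t|) (fun _ _ => abs_nonneg _)
      (Finset.mem_univ t))
  have h0 : 0 ≤ max R₀ 0 := le_max_right _ _
  have hs : 0 ≤ ∑ t, |c t| := Finset.sum_nonneg fun _ _ => abs_nonneg _
  filter_upwards [h t] with o ho
  refine ⟨by linarith [ho.2.1, le_max_left R₀ 0], fun b hb => ?_⟩
  obtain ⟨h1, h2, h3⟩ := hc t (M.S t o) b (ho.2.2.trans (le_max_left _ _))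
    (hb.trans (le_max_right _ _))
  exact ⟨by linarith, by linarith, by linarith⟩

/-! ### The estimating function has mean zero -/

/-- A signed combination of inverse probability weighted arms has mean zero when the conditional
means balance. -/
theorem Design.integral_contrast (hd : M.Design P) {R : ℝ} {t : Fin T}
    (hR : ∀ᵐ o ∂P, |outc t o| ≤ R) {ρ : Bool → Vec r → ℝ} (hρ : ∀ a, Measurable (ρ a))
    (hρi : ∀ a, IntegrableOn (fun o => ρ a (M.S t o)) {o | avail t o = true} P)
    {f : Bool → Hist q t → ℝ} (hf : ∀ a, Measurable (f a))
    (hfi : ∀ a, IntegrableOn (fun o => f a (hist t o)) {o | avail t o = true} P)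
    (hbal : ∀ᵐ o ∂P, avail t o = true →
      ρ true (M.S t o) * M.meanGivenMod P t true o -
          ρ false (M.S t o) * M.meanGivenMod P t false o =
        f true (hist t o) - f false (hist t o)) {F : Traj T q → ℝ}
    (hF : ∀ᵐ o ∂P, F o = (if trt t o then 1 else -1) *
      (M.ipw t (trt t o) o * (ρ (trt t o) (M.S t o) * outc t o - f (trt t o) (hist t o)))) :
    Integrable F P ∧ ∫ o, F o ∂P = 0 := by
  obtain ⟨τ, hτ⟩ := hd.exists_positive
  have hi : ∀ a, Integrable
      (fun o => M.ipw t a o * (ρ a (M.S t o) * outc t o - f a (hist t o))) P :=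
    fun a => hτ.integrable_ipw_mul t a
      ((integrableOn_mul_of_bdd (measurableSet_avail t) (hρi a) (measurable_outc t)
        (hR.mono fun o ho _ => ho)).sub (hfi a))
  have ht : ∀ᵐ o ∂P, o ∈ {o : Traj T q | trt t o = true} →
      M.ipw t true o * (ρ true (M.S t o) * outc t o - f true (hist t o)) = F o := by
    filter_upwards [hF] with o ho hot
    have : trt t o = true := hot
    rw [ho, this]; simp
  have hfa : ∀ᵐ o ∂P, o ∈ {o : Traj T q | trt t o = false} →
      -(M.ipw t false o * (ρ false (M.S t o) * outc t o - f false (hist t o))) = F o := by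
    filter_upwards [hF] with o ho hot
    have : trt t o = false := hot
    rw [ho, this]; simp
  have hcompl : {o : Traj T q | trt t o = true}ᶜ = {o | trt t o = false} := by
    ext o; simp
  have hFt : IntegrableOn F {o | trt t o = true} P :=
    (hi true).integrableOn.congr ((ae_restrict_iff' (measurableSet_trt t true)).2 ht)
  have hFf : IntegrableOn F {o | trt t o = false} P :=
    (hi false).neg.integrableOn.congr ((ae_restrict_iff' (measurableSet_trt t false)).2 hfa)
  have hFi : Integrable F P := by
    rw [← integrableOn_univ, ← Set.union_compl_self {o : Traj T q | trt t o = true}, hcompl]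
    exact hFt.union hFf
  refine ⟨hFi, ?_⟩
  have i3 : ∀ a, IntegrableOn (fun o => ρ a (M.S t o) * M.meanGivenMod P t a o - f a (hist t o))
      {o | avail t o = true} P := fun a =>
    (integrableOn_mul_of_bdd (measurableSet_avail t) (hρi a) (measurable_meanGivenMod t a)
      (meanGivenMod_bdd (hd.meanGivenHist_bdd hR a))).sub (hfi a)
  -- Both arms become integrals over the same set of available histories, where the integrands
  -- cancel by `hbal`.
  rw [← integral_add_compl (measurableSet_trt t true) hFi, hcompl,
    ← setIntegral_congr_ae (measurableSet_trt t true) ht,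
    ← setIntegral_congr_ae (measurableSet_trt t false) hfa, integral_neg,
    hd.setIntegral_arm hR true (hρ true) (hρi true) (hf true) (hfi true),
    hd.setIntegral_arm hR false (hρ false) (hρi false) (hf false) (hfi false), ← sub_eq_add_neg,
    ← integral_sub (i3 true) (i3 false)]
  refine integral_eq_zero_of_ae ((ae_restrict_iff' (measurableSet_avail t)).2 ?_)
  filter_upwards [hbal] with o ho hoa
  have := ho hoa
  simp only [Pi.zero_apply]
  linarith

/-- The factor of the outcome in the residual, in arm `a`. -/
noncomputable def ratio (M : Spec T q r p) (t : Fin T) (b : Vec p) (a : Bool) (s : Vec r) : ℝ :=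
  match M.link with
  | .identity => 1
  | .log => Real.exp (-bit a * M.gam t s b)

/-- The part of the residual that is subtracted from the outcome, in arm `a`. -/
noncomputable def center (M : Spec T q r p) (t : Fin T) (b : Vec p) (mu : Hist q t → Bool → ℝ)
    (a : Bool) (h : Hist q t) : ℝ :=
  match M.link with
  | .identity => (bit a + M.prob t h - 1) * M.gam t (M.modr t h) b +
      (1 - M.prob t h) * mu h true + M.prob t h * mu h false
  | .log => (1 - M.prob t h) * Real.exp (-M.gam t (M.modr t h) b) * mu h true +
      M.prob t h * mu h false

theorem resid_eq (t : Fin T) (b : Vec p) (mu : Hist q t → Bool → ℝ) (o : Traj T q) :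
    M.resid t b mu o =
      M.ratio t b (trt t o) (M.S t o) * outc t o - M.center t b mu (trt t o) (hist t o) := by
  simp only [resid, ratio, center, S]
  cases M.link <;> simp only <;> ring

theorem measurable_ratio (t : Fin T) (b : Vec p) (a : Bool) : Measurable (M.ratio t b a) := by
  unfold ratio
  cases M.link
  · exact measurable_const
  · exact ((M.gam_meas t b).const_mul _).exp

theorem measurable_center (t : Fin T) (b : Vec p) {mu : Hist q t → Bool → ℝ}
    (hm : Measurable fun y : Hist q t × Bool => mu y.1 y.2) (a : Bool) :
    Measurable (M.center t b mu a) := by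
  have hp := M.prob_meas t
  have hg := (M.gam_meas t b).comp (M.modr_meas t)
  have h1 : Measurable fun h => mu h true := hm.comp measurable_prodMk_right
  have h0 : Measurable fun h => mu h false := hm.comp measurable_prodMk_right
  unfold center
  cases M.link
  · exact ((((hp.const_add _).sub_const _).mul hg).add ((hp.const_sub _).mul h1)).add (hp.mul h0)
  · exact (((hp.const_sub _).mul hg.neg.exp).mul h1).add (hp.mul h0)

theorem abs_ratio_le {t : Fin T} {b : Vec p} {s : Vec r} {c : ℝ} (hg : |M.gam t s b| ≤ c)
    (a : Bool) : |M.ratio t b a s| ≤ Real.exp c := by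
  have hc : 0 ≤ c := (abs_nonneg _).trans hg
  unfold ratio
  cases M.link
  · simpa using hc
  · simp only [Real.abs_exp, Real.exp_le_exp]
    cases a
    · simpa [bit] using hc
    · simpa [bit] using (neg_le_abs _).trans hg

theorem abs_center_le {t : Fin T} {b : Vec p} {mu : Hist q t → Bool → ℝ} {h : Hist q t} {c C : ℝ}
    (hg : |M.gam t (M.modr t h) b| ≤ c) (hmu : ∀ a, |mu h a| ≤ C) (hp : 0 ≤ M.prob t h)
    (hp1 : M.prob t h ≤ 1) (a : Bool) :
    |M.center t b mu a h| ≤ c + 2 * (Real.exp c * C) := by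
  have hc : 0 ≤ c := (abs_nonneg _).trans hg
  have hC : 0 ≤ C := (abs_nonneg _).trans (hmu true)
  have he : 1 ≤ Real.exp c := Real.one_le_exp hc
  have hCe : C ≤ Real.exp c * C := le_mul_of_one_le_left hC he
  have hq : |1 - M.prob t h| ≤ 1 := by rw [abs_le]; constructor <;> linarith
  have hp' : |M.prob t h| ≤ 1 := by rw [abs_le]; constructor <;> linarith
  have h2 : |M.prob t h * mu h false| ≤ Real.exp c * C := by
    rw [abs_mul]
    exact (mul_le_mul hp' (hmu false) (abs_nonneg _) zero_le_one).trans (by linarith)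
  unfold center
  cases M.link
  · have h1 : |(1 - M.prob t h) * mu h true| ≤ Real.exp c * C := by
      rw [abs_mul]
      exact (mul_le_mul hq (hmu true) (abs_nonneg _) zero_le_one).trans (by linarith)
    have h3 : |(bit a + M.prob t h - 1) * M.gam t (M.modr t h) b| ≤ c := by
      rw [abs_mul]
      refine (mul_le_mul (b := 1) ?_ hg (abs_nonneg _) zero_le_one).trans (by linarith)
      cases a <;> simp only [bit] <;> rw [abs_le] <;> constructor <;> norm_num <;> linarith
    exact (abs_add_three _ _ _).trans (by linarith)
  · have h1 : |(1 - M.prob t h) * Real.exp (-M.gam t (M.modr t h) b) * mu h true| ≤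
        Real.exp c * C := by
      rw [abs_mul, abs_mul, Real.abs_exp]
      refine mul_le_mul ?_ (hmu true) (abs_nonneg _) (Real.exp_nonneg _)
      calc _ ≤ 1 * Real.exp c := mul_le_mul hq (Real.exp_le_exp.2 ((neg_le_abs _).trans hg))
            (Real.exp_nonneg _) zero_le_one
        _ = _ := one_mul _
    exact (abs_add_le _ _).trans (by linarith)

/-- The terms with `mu` are the same in both arms, so they cancel in the difference of centers: what
remains is γ_t for the identity link and 0 for the log link. The effect model says precisely that
the scaled conditional means differ by this amount. For the log link positivity allows one to
exponentiate. -/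
theorem EffectModel.balance {b : Vec p} (h : M.EffectModel P b) (t : Fin T)
    (mu : Hist q t → Bool → ℝ) : ∀ᵐ o ∂P, avail t o = true →
      M.ratio t b true (M.S t o) * M.meanGivenMod P t true o -
        M.ratio t b false (M.S t o) * M.meanGivenMod P t false o =
        M.center t b mu true (hist t o) - M.center t b mu false (hist t o) := by
  filter_upwards [(ae_cond_iff (measurableSet_avail t)).1 (h t)] with o ho hoa
  obtain ⟨hpos, heq⟩ := ho hoa
  change _ = M.gam t (M.modr t (hist t o)) b at heq
  unfold ratio center S
  cases hl : M.link
  · simp only [hl, Link.fn] at heq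
    simp only [bit, if_true, Bool.false_eq_true, if_false]
    linarith
  · simp only [hl, Link.fn] at heq
    obtain ⟨h1, h0⟩ := hpos hl
    simp only [bit, if_true, Bool.false_eq_true, if_false, neg_zero, zero_mul, Real.exp_zero,
      sub_self, one_mul, ← heq, neg_sub, neg_mul, Real.exp_sub, Real.exp_log h1, Real.exp_log h0]
    field_simp
    ring

/-- The coordinate `∂_{β_k} γ_t(s; β)` of the gradient. -/
noncomputable def dgam (M : Spec T q r p) (t : Fin T) (k : Fin p) (s : Vec r) (b : Vec p) : ℝ :=
  fderiv ℝ (M.gam t s) b (EuclideanSpace.single k 1)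

theorem measurable_dgam (t : Fin T) (k : Fin p) (b : Vec p) :
    Measurable fun s => M.dgam t k s b :=
  measurable_fderiv_apply (f := fun b s => M.gam t s b) (M.gam_meas t)
    (fun s => (M.gam_contDiff t s).differentiable two_ne_zero) b _

theorem abs_dgam_le {t : Fin T} {k : Fin p} {s : Vec r} {b : Vec p} {c : ℝ}
    (h : ‖fderiv ℝ (M.gam t s) b‖ ≤ c) : |M.dgam t k s b| ≤ c := by
  have := (fderiv ℝ (M.gam t s) b).le_opNorm (EuclideanSpace.single k 1)
  rw [PiLp.norm_single, norm_one, mul_one] at this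
  exact this.trans h

theorem gradient_apply (t : Fin T) (s : Vec r) (b : Vec p) (k : Fin p) :
    gradient (M.gam t s) b k = M.dgam t k s b := by
  have h : inner ℝ (gradient (M.gam t s) b) (EuclideanSpace.single k (1 : ℝ)) =
      M.dgam t k s b := by
    rw [gradient, InnerProductSpace.toDual_symm_apply]; rfl
  rw [← h, real_inner_comm, EuclideanSpace.inner_single_left]
  simp

/-- The factor `(A_t - p_t) / {p_t (1 - p_t)} I_t`. -/
noncomputable def wt (M : Spec T q r p) (t : Fin T) (o : Traj T q) : ℝ :=
  (bit (trt t o) - M.prob t (hist t o)) /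
      (M.prob t (hist t o) * (1 - M.prob t (hist t o))) * bit (avail t o)

theorem phi_apply (t : Fin T) (b : Vec p) (mu : Hist q t → Bool → ℝ) (o : Traj T q) (k : Fin p) :
    M.phi t b mu o k = M.wt t o * M.resid t b mu o * M.dgam t k (M.S t o) b := by
  rw [phi, PiLp.smul_apply, smul_eq_mul, gradient_apply]; rfl

theorem Positive.prob_mem {τ : ℝ} (hτ : M.Positive P τ) (t : Fin T) : ∀ᵐ o ∂P,
    avail t o = true → 0 < M.prob t (hist t o) ∧ M.prob t (hist t o) < 1 := by
  filter_upwards [hτ.2 t true, hτ.2 t false] with o h1 h0 ho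
  have h1 := h1 ho
  have h0 := h0 ho
  simp only [armProb, if_true, Bool.false_eq_true, if_false] at h1 h0
  exact ⟨hτ.1.trans h1, by linarith [hτ.1]⟩

/-- (A - p)/{p(1 - p)} equals 1/p when A = 1 and -1/(1 - p) when A = 0. -/
theorem Positive.wt_eq {τ : ℝ} (hτ : M.Positive P τ) (t : Fin T) : ∀ᵐ o ∂P,
    M.wt t o = (if trt t o then 1 else -1) * M.ipw t (trt t o) o := by
  filter_upwards [hτ.prob_mem t] with o ho
  by_cases h : avail t o = true
  · obtain ⟨h1, h2⟩ := ho h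
    have h3 : 1 - M.prob t (hist t o) ≠ 0 := by linarith
    have h4 := h1.ne'
    cases htr : trt t o
    · simp only [wt, ipw, armProb, bit, h, htr, if_true, Bool.false_eq_true, if_false]
      field_simp
      ring
    · simp only [wt, ipw, armProb, bit, h, htr, if_true]
      field_simp
  · simp [wt, ipw, bit, h]

/-- The estimating function has mean zero at the true parameter, whatever the outcome model. -/
theorem Design.integral_weight_mul_phi (hd : M.Design P) (hbd : M.BoundedSupport P) {b : Vec p}
    (hb : M.EffectModel P b) {t : Fin T} {C : ℝ} {mu : Hist q t → Bool → ℝ}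
    (hm : Measurable fun y : Hist q t × Bool => mu y.1 y.2) (hmu : BoundedMu P C t mu)
    {D : Vec r → ℝ} (hD : Measurable D) (hDi : Integrable (fun o => D (M.S t o)) P) (k : Fin p) :
    Integrable (fun o => D (M.S t o) * M.phi t b mu o k) P ∧
      ∫ o, D (M.S t o) * M.phi t b mu o k ∂P = 0 := by
  obtain ⟨τ, hτ⟩ := hd.exists_positive
  obtain ⟨c, hc0, hc⟩ := hbd.exists_bound ‖b‖
  have hg := M.measurable_dgam t k b
  have hDg : Integrable (fun o => D (M.S t o) * M.dgam t k (M.S t o) b) P :=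
    hDi.mul_bdd (c := c) (hg.comp (M.measurable_S t)).aestronglyMeasurable
      ((hc t).mono fun o ho => abs_dgam_le (ho.2 b le_rfl).2.1)
  refine hd.integral_contrast (t := t) ((hc t).mono fun o ho => ho.1)
    -- The weight and the gradient are functions of `S_t`, so they can be absorbed both in the
    -- factor of the outcome and in the center.
    (ρ := fun a s => D s * M.dgam t k s b * M.ratio t b a s)
    (f := fun a h => D (M.modr t h) * M.dgam t k (M.modr t h) b * M.center t b mu a h)
    (fun a => (hD.mul hg).mul (measurable_ratio t b a)) (fun a => ?_)
    (fun a => ((hD.mul hg).comp (M.modr_meas t)).mul (measurable_center t b hm a)) (fun a => ?_)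
    ?_ ?_
  · exact integrableOn_mul_of_bdd (measurableSet_avail t) hDg.integrableOn
      (g := fun o => M.ratio t b a (M.S t o)) ((measurable_ratio t b a).comp (M.measurable_S t))
      ((hc t).mono fun o ho _ => abs_ratio_le (ho.2 b le_rfl).1 a)
  · refine integrableOn_mul_of_bdd (measurableSet_avail t) hDg.integrableOn
      (g := fun o => M.center t b mu a (hist t o)) (C := c + 2 * (Real.exp c * C))
      ((measurable_center t b hm a).comp (measurable_hist t)) ?_
    filter_upwards [hc t, hd.boundedMu hm hmu true, hd.boundedMu hm hmu false, hτ.prob_mem t]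
      with o ho h1 h0 hp hoa
    exact abs_center_le (ho.2 b le_rfl).1 (fun a => by cases a; exacts [h0 hoa, h1 hoa])
      (hp hoa).1.le (hp hoa).2.le a
  · filter_upwards [hb.balance t mu] with o ho hoa
    have h := ho hoa
    simp only [S] at h ⊢
    linear_combination D (M.modr t (hist t o)) * M.dgam t k (M.modr t (hist t o)) b * h
  · filter_upwards [hτ.wt_eq t] with o ho
    rw [phi_apply, resid_eq, ho]
    simp only [S]
    ring

end Spec

namespace Spec

variable {T q r p : ℕ} {M : Spec T q r p} {P : Measure (Traj T q)} [IsProbabilityMeasure P]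

/-! ### The estimating function as a linear combination of fitted features -/

/-- The coefficients of `1`, `μ_t(H_t, 1)` and `μ_t(H_t, 0)` in the residual, as functions of the
value of `γ_t`. -/
noncomputable def resCoef (M : Spec T q r p) (t : Fin T) (m : Fin 3) (o : Traj T q) (g : ℝ) : ℝ :=
  match M.link with
  | .identity => ![outc t o - (bit (trt t o) + M.prob t (hist t o) - 1) * g,
      -(1 - M.prob t (hist t o)), -M.prob t (hist t o)] m
  | .log => ![Real.exp (-bit (trt t o) * g) * outc t o,
      -((1 - M.prob t (hist t o)) * Real.exp (-g)), -M.prob t (hist t o)] m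

/-- The coefficients of the features in the estimating function. -/
noncomputable def phiCoef (M : Spec T q r p) (j : Fin T × Fin p × Fin 3) (b : Vec p)
    (o : Traj T q) : ℝ :=
  M.wt j.1 o * (M.resCoef j.1 j.2.2 o (M.gam j.1 (M.S j.1 o) b) * M.dgam j.1 j.2.1 (M.S j.1 o) b)

/-- The quantities `1`, `I_t μ_t(H_t, 1)` and `I_t μ_t(H_t, 0)`. -/
noncomputable def outcomeFeature {t : Fin T} (mu : Hist q t → Bool → ℝ) (m : Fin 3)
    (o : Traj T q) : ℝ :=
  ![1, bit (avail t o) * mu (hist t o) true, bit (avail t o) * mu (hist t o) false] m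

/-- The features: products of entries of the weights and of `outcomeFeature`. -/
noncomputable def feature (M : Spec T q r p) (d : Fin T → Vec r → Matrix (Fin p) (Fin p) ℝ)
    (mu : ∀ t : Fin T, Hist q t → Bool → ℝ) (j : Fin T × Fin p × Fin 3) (i : Fin p)
    (o : Traj T q) : ℝ :=
  d j.1 (M.S j.1 o) i j.2.1 * outcomeFeature (mu j.1) j.2.2 o

/-- The residual is affine in the two predictions `mu h true` and `mu h false`. Multiplying these by
I_t changes nothing, since the weight already contains I_t, and it makes the features bounded:
predictions are controlled only where treatment is available. -/
theorem phi_apply_eq_sum (t : Fin T) (b : Vec p) (mu : Hist q t → Bool → ℝ) (o : Traj T q)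
    (k : Fin p) :
    M.phi t b mu o k = ∑ m, outcomeFeature mu m o * M.phiCoef (t, k, m) b o := by
  rw [phi_apply, Fin.sum_univ_three]
  cases h : avail t o
  · simp [wt, phiCoef, bit, h]
  · simp only [phiCoef, resid, resCoef, outcomeFeature, bit, h, if_true, one_mul]
    cases M.link <;> simp <;> ring

theorem psi_apply (d : Fin T → Vec r → Matrix (Fin p) (Fin p) ℝ)
    (mu : ∀ t : Fin T, Hist q t → Bool → ℝ) (b : Vec p) (o : Traj T q) (i : Fin p) :
    M.psi d mu b o i = ∑ t, ∑ k, d t (M.S t o) i k * M.phi t b (mu t) o k := by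
  simp only [psi, WithLp.ofLp_sum, Finset.sum_apply, Matrix.mulVec, dotProduct]

theorem psi_apply_eq_sum (d : Fin T → Vec r → Matrix (Fin p) (Fin p) ℝ)
    (mu : ∀ t : Fin T, Hist q t → Bool → ℝ) (b : Vec p) (o : Traj T q) (i : Fin p) :
    M.psi d mu b o i = ∑ j, M.feature d mu j i o * M.phiCoef j b o := by
  simp only [psi_apply, Fintype.sum_prod_type, phi_apply_eq_sum, Finset.mul_sum, feature, mul_assoc]

theorem contDiff_dgam (t : Fin T) (k : Fin p) (s : Vec r) : ContDiff ℝ 1 (M.dgam t k s) :=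
  ((M.gam_contDiff t s).fderiv_right (m := 1) (by norm_num)).clm_apply contDiff_const

theorem contDiff_resCoef (t : Fin T) (m : Fin 3) (o : Traj T q) :
    ContDiff ℝ 1 (M.resCoef t m o) := by
  unfold resCoef
  cases M.link <;> fin_cases m <;> simp <;> fun_prop

theorem contDiff_phiCoef (j : Fin T × Fin p × Fin 3) (o : Traj T q) :
    ContDiff ℝ 1 fun b => M.phiCoef j b o :=
  contDiff_const.mul (((contDiff_resCoef _ _ o).comp
    ((M.gam_contDiff _ _).of_le (by norm_num))).mul (contDiff_dgam _ _ _))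

/-- The features do not involve `b`, so differentiation acts on the coefficients alone. -/
theorem dphi_apply_eq_sum (t : Fin T) (b : Vec p) (mu : Hist q t → Bool → ℝ) (o : Traj T q)
    (k l : Fin p) :
    M.dphi t b mu o k l = ∑ m, outcomeFeature mu m o *
      fderiv ℝ (fun b' => M.phiCoef (t, k, m) b' o) b (EuclideanSpace.single l 1) := by
  have hc : ∀ k, HasFDerivAt (fun b' => M.phi t b' mu o k)
      (∑ m, outcomeFeature mu m o • fderiv ℝ (fun b' => M.phiCoef (t, k, m) b' o) b) b := by
    intro k
    simp only [phi_apply_eq_sum]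
    exact HasFDerivAt.fun_sum fun m _ =>
      ((contDiff_phiCoef (t, k, m) o).differentiable one_ne_zero b).hasFDerivAt.const_mul _
  have hdiff : DifferentiableAt ℝ (fun b' => M.phi t b' mu o) b :=
    differentiableAt_euclidean.2 fun k => (hc k).differentiableAt
  have h := ((EuclideanSpace.proj k : Vec p →L[ℝ] ℝ).hasFDerivAt.comp b hdiff.hasFDerivAt)
  have h2 := h.unique (hc k)
  have h3 := congrArg (fun A : Vec p →L[ℝ] ℝ => A (EuclideanSpace.single l 1)) h2
  simpa [dphi] using h3

theorem dpsi_apply_eq_sum (d : Fin T → Vec r → Matrix (Fin p) (Fin p) ℝ)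
    (mu : ∀ t : Fin T, Hist q t → Bool → ℝ) (b : Vec p) (o : Traj T q) (i l : Fin p) :
    M.dpsi d mu b o i l = ∑ j, M.feature d mu j i o *
      fderiv ℝ (fun b' => M.phiCoef j b' o) b (EuclideanSpace.single l 1) := by
  simp only [dpsi, Matrix.sum_apply, Matrix.mul_apply, Fintype.sum_prod_type, dphi_apply_eq_sum,
    Finset.mul_sum, feature, mul_assoc]

theorem measurable_prob_hist (t : Fin T) : Measurable fun o : Traj T q => M.prob t (hist t o) :=
  (M.prob_meas t).comp (measurable_hist t)

theorem measurable_phiCoef (j : Fin T × Fin p × Fin 3) (b : Vec p) :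
    Measurable (M.phiCoef j b) := by
  obtain ⟨t, k, m⟩ := j
  have hp := M.measurable_prob_hist t
  have hA : Measurable fun o : Traj T q => bit (trt t o) := measurable_bit.comp (measurable_trt t)
  have hI : Measurable fun o : Traj T q => bit (avail t o) :=
    measurable_bit.comp (measurable_avail t)
  have hY := measurable_outc (q := q) t
  have hg : Measurable fun o => M.gam t (M.S t o) b := (M.gam_meas t b).comp (M.measurable_S t)
  have hw : Measurable (M.wt t) := ((hA.sub hp).div (hp.mul (hp.const_sub 1))).mul hI
  refine hw.mul (Measurable.mul ?_ ((M.measurable_dgam t k b).comp (M.measurable_S t)))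
  unfold resCoef
  cases M.link <;> fin_cases m <;> simp <;> fun_prop

/-- The bound is not sharp; it is a common one for both links, the three coefficients and their
derivatives. -/
theorem abs_resCoef_le {t : Fin T} {o : Traj T q} {c g : ℝ} (hY : |outc t o| ≤ c) (hg : |g| ≤ c)
    (hp : 0 ≤ M.prob t (hist t o)) (hp1 : M.prob t (hist t o) ≤ 1) (m : Fin 3) :
    |M.resCoef t m o g| ≤ (2 * c + 1) * Real.exp c ∧
      |deriv (M.resCoef t m o) g| ≤ (2 * c + 1) * Real.exp c := by
  have hc : 0 ≤ c := (abs_nonneg _).trans hg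
  have he : 1 ≤ Real.exp c := Real.one_le_exp hc
  have hce : c ≤ c * Real.exp c := le_mul_of_one_le_right hc he
  have hq : |1 - M.prob t (hist t o)| ≤ 1 := by rw [abs_le]; constructor <;> linarith
  have hp' : |M.prob t (hist t o)| ≤ 1 := by rw [abs_le]; constructor <;> linarith
  have hA : |bit (trt t o)| ≤ 1 := abs_bit_le _
  have hAp : |bit (trt t o) + M.prob t (hist t o) - 1| ≤ 1 := by
    cases trt t o <;> simp only [bit] <;> rw [abs_le] <;> constructor <;> norm_num <;> linarith
  have hexp : Real.exp (-g) ≤ Real.exp c := Real.exp_le_exp.2 ((neg_le_abs _).trans hg)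
  have hexpA : Real.exp (-bit (trt t o) * g) ≤ Real.exp c := by
    cases trt t o
    · simpa [bit] using hc
    · simpa [bit] using (neg_le_abs _).trans hg
  have h1 : |1 - M.prob t (hist t o)| * Real.exp (-g) ≤ Real.exp c :=
    (mul_le_mul hq hexp (Real.exp_nonneg _) zero_le_one).trans (one_mul _).le
  have h2 : Real.exp (-bit (trt t o) * g) * |outc t o| ≤ c * Real.exp c := by
    rw [mul_comm c]; exact mul_le_mul hexpA hY (abs_nonneg _) (Real.exp_nonneg _)
  unfold resCoef
  cases M.link <;> fin_cases m
  · have hder : deriv (fun g => outc t o - (bit (trt t o) + M.prob t (hist t o) - 1) * g) g =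
        -(bit (trt t o) + M.prob t (hist t o) - 1) := by
      simp
    have h3 : |(bit (trt t o) + M.prob t (hist t o) - 1) * g| ≤ c := by
      rw [abs_mul]
      exact (mul_le_mul hAp hg (abs_nonneg _) zero_le_one).trans (one_mul _).le
    simp only [Fin.zero_eta, Matrix.cons_val_zero, hder, abs_neg]
    exact ⟨(abs_sub _ _).trans (by linarith), by linarith⟩
  · simp only [Fin.mk_one, Matrix.cons_val_one, Matrix.cons_val_zero, deriv_const, abs_neg,
      abs_zero]
    constructor <;> nlinarith
  · simp
    constructor <;> nlinarith
  · have hder : deriv (fun g => Real.exp (-bit (trt t o) * g) * outc t o) g =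
        -bit (trt t o) * (Real.exp (-bit (trt t o) * g) * outc t o) := by
      have := ((((hasDerivAt_id g).const_mul (-bit (trt t o))).exp).mul_const (outc t o)).deriv
      simp only [id, mul_one] at this
      rw [this]; ring
    have h3 : |Real.exp (-bit (trt t o) * g) * outc t o| ≤ c * Real.exp c := by
      rwa [abs_mul, Real.abs_exp]
    simp only [Fin.zero_eta, Matrix.cons_val_zero, hder]
    refine ⟨by linarith, ?_⟩
    rw [abs_mul, abs_neg]
    exact (mul_le_mul hA h3 (abs_nonneg _) zero_le_one).trans (by linarith)
  · have hder : deriv (fun g => -((1 - M.prob t (hist t o)) * Real.exp (-g))) g =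
        (1 - M.prob t (hist t o)) * Real.exp (-g) := by
      have := (((hasDerivAt_neg g).exp).const_mul (1 - M.prob t (hist t o))).neg.deriv
      simpa using this
    simp only [Fin.mk_one, Matrix.cons_val_one, Matrix.cons_val_zero, hder, abs_neg]
    rw [abs_mul, Real.abs_exp]
    constructor <;> linarith
  · simp
    constructor <;> nlinarith

/-- A coordinate of the gradient is evaluation at a unit vector, which does not increase operator
norms. -/
theorem norm_fderiv_dgam_le (t : Fin T) (k : Fin p) (s : Vec r) (b : Vec p) :
    ‖fderiv ℝ (M.dgam t k s) b‖ ≤ ‖fderiv ℝ (fderiv ℝ (M.gam t s)) b‖ := by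
  have hd : DifferentiableAt ℝ (fderiv ℝ (M.gam t s)) b :=
    ((M.gam_contDiff t s).fderiv_right (m := 1) (by norm_num)).differentiable one_ne_zero b
  refine ContinuousLinearMap.opNorm_le_bound _
    (norm_nonneg (fderiv ℝ (fderiv ℝ (M.gam t s)) b)) fun w => ?_
  have h := (hd.hasFDerivAt.clm_apply
    (hasFDerivAt_const (EuclideanSpace.single k (1 : ℝ)) b)).fderiv
  have h2 := congrArg (fun A : Vec p →L[ℝ] ℝ => A w) h
  have h3 : fderiv ℝ (M.dgam t k s) b w =
      fderiv ℝ (fderiv ℝ (M.gam t s)) b w (EuclideanSpace.single k 1) := by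
    change fderiv ℝ (fun y => fderiv ℝ (M.gam t s) y (EuclideanSpace.single k 1)) b w = _
    simpa using h2
  rw [h3]
  have := (fderiv ℝ (fderiv ℝ (M.gam t s)) b).le_opNorm₂ w (EuclideanSpace.single k (1 : ℝ))
  rwa [PiLp.norm_single, norm_one, mul_one] at this

theorem Design.phiCoef_bdd (hd : M.Design P) (hbd : M.BoundedSupport P) (R : ℝ) :
    ∃ C : ℝ, ∀ j, ∀ᵐ o ∂P, ∀ b, ‖b‖ ≤ R →
      |M.phiCoef j b o| ≤ C ∧ ‖fderiv ℝ (fun b' => M.phiCoef j b' o) b‖ ≤ C := by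
  obtain ⟨τ, hτ⟩ := hd.exists_positive
  obtain ⟨c, hc0, hc⟩ := hbd.exists_bound R
  have hτ0 : 0 ≤ τ⁻¹ := (inv_pos.2 hτ.1).le
  set B : ℝ := (2 * c + 1) * Real.exp c with hB
  have hB0 : 0 ≤ B := by positivity
  -- `τ⁻¹` bounds the weight, the first `B * c` the value of the product, and the bracket the two
  -- terms of the product rule. One constant serves both claims.
  refine ⟨τ⁻¹ * (B * c + (B * c + c * (B * c))), fun ⟨t, k, m⟩ => ?_⟩
  filter_upwards [hc t, hτ.prob_mem t, hτ.wt_eq t, hτ.ipw_le t true, hτ.ipw_le t false]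
    with o ho hp hw hw1 hw0 b hb
  -- When treatment is unavailable the weight is zero, so no bound on `p_t` is needed.
  by_cases hav : avail t o = true
  swap
  · have hz : ∀ b, M.phiCoef (t, k, m) b o = 0 := fun b => by simp [phiCoef, wt, bit, hav]
    simp only [hz, abs_zero, fderiv_const_apply, norm_zero, and_self]
    positivity
  obtain ⟨hp0, hp1⟩ := hp hav
  obtain ⟨hg, hg1, hg2⟩ := ho.2 b hb
  obtain ⟨ha, ha'⟩ := abs_resCoef_le (M := M) ho.1 hg hp0.le hp1.le m
  have hwt : |M.wt t o| ≤ τ⁻¹ := by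
    rw [hw]
    cases trt t o
    · simpa using hw0
    · simpa using hw1
  have he := abs_dgam_le (k := k) hg1
  have he' := (norm_fderiv_dgam_le (M := M) t k (M.S t o) b).trans hg2
  have hfg : HasFDerivAt (M.gam t (M.S t o)) (fderiv ℝ (M.gam t (M.S t o)) b) b :=
    ((M.gam_contDiff t (M.S t o)).differentiable two_ne_zero b).hasFDerivAt
  have hfa : HasDerivAt (M.resCoef t m o) (deriv (M.resCoef t m o) (M.gam t (M.S t o) b))
      (M.gam t (M.S t o) b) :=
    ((contDiff_resCoef t m o).differentiable one_ne_zero _).hasDerivAt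
  have hfe : HasFDerivAt (M.dgam t k (M.S t o)) (fderiv ℝ (M.dgam t k (M.S t o)) b) b :=
    ((contDiff_dgam t k (M.S t o)).differentiable one_ne_zero b).hasFDerivAt
  have hf := ((hfa.comp_hasFDerivAt b hfg).mul hfe).const_mul (M.wt t o)
  constructor
  · simp only [phiCoef]
    rw [abs_mul, abs_mul]
    refine mul_le_mul hwt ?_ (by positivity) hτ0
    refine (mul_le_mul ha he (abs_nonneg _) hB0).trans ?_
    have : 0 ≤ B * c + c * (B * c) := by positivity
    linarith
  · have hf' := hf.fderiv
    change ‖fderiv ℝ (fun b' => M.wt t o * (M.resCoef t m o (M.gam t (M.S t o) b') *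
      M.dgam t k (M.S t o) b')) b‖ ≤ _
    refine (congrArg norm hf').le.trans ?_
    rw [norm_smul, Real.norm_eq_abs]
    refine mul_le_mul hwt ?_ (norm_nonneg _) hτ0
    have h1 : ‖M.resCoef t m o (M.gam t (M.S t o) b) • fderiv ℝ (M.dgam t k (M.S t o)) b‖ ≤
        B * c := by
      rw [norm_smul]
      exact mul_le_mul ha he' (norm_nonneg _) hB0
    have h2 : ‖M.dgam t k (M.S t o) b • deriv (M.resCoef t m o) (M.gam t (M.S t o) b) •
        fderiv ℝ (M.gam t (M.S t o)) b‖ ≤ c * (B * c) := by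
      rw [norm_smul, norm_smul]
      exact mul_le_mul he (mul_le_mul ha' hg1 (norm_nonneg _) hB0) (by positivity) hc0
    refine (norm_add_le _ _).trans ((add_le_add h1 h2).trans ?_)
    have : 0 ≤ B * c := by positivity
    linarith

end Spec

/-! ### Convergence of products of bounded and square integrable features -/

/-- Multiplication by a fixed integrable function preserves convergence to zero in `L₁` of
uniformly bounded functions. -/
theorem tendsto_lintegral_mul_of_bdd {α 𝒳 : Type*} [MeasurableSpace 𝒳] {μ : Measure 𝒳}
    {l : Filter α} {g : 𝒳 → ℝ≥0∞} (hg : Measurable g) (hgi : ∫⁻ o, g o ∂μ ≠ ⊤)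
    {V : α → 𝒳 → ℝ≥0∞} {c : ℝ≥0∞} (hc : c ≠ ⊤) (hV : ∀ᶠ x in l, ∀ᵐ o ∂μ, V x o ≤ c)
    (h0 : Tendsto (fun x => ∫⁻ o, V x o ∂μ) l (𝓝 0)) :
    Tendsto (fun x => ∫⁻ o, g o * V x o ∂μ) l (𝓝 0) := by
  -- Truncation: the excess of `g` over a level `n`, times the bound `c`, is small for large `n`;
  -- below that level the integral is at most `n` times that of `V`.
  have htail : Tendsto (fun n : ℕ => c * ∫⁻ o, (g o - n) ∂μ) atTop (𝓝 0) := by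
    have h1 : Tendsto (fun n : ℕ => ∫⁻ o, (g o - n) ∂μ) atTop (𝓝 (∫⁻ _, 0 ∂μ)) := by
      refine tendsto_lintegral_of_dominated_convergence g (fun n => hg.sub_const _)
        (fun n => ae_of_all _ fun o => tsub_le_self) hgi ?_
      filter_upwards [ae_lt_top hg hgi] with o ho
      obtain ⟨m, hm⟩ := ENNReal.exists_nat_gt ho.ne
      refine tendsto_const_nhds.congr' ?_
      filter_upwards [eventually_ge_atTop m] with n hn
      exact (tsub_eq_zero_of_le (hm.le.trans (by exact_mod_cast hn))).symm
    have h2 := ENNReal.Tendsto.const_mul h1 (Or.inr hc)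
    simpa using h2
  refine ENNReal.tendsto_nhds_zero.2 fun ε hε => ?_
  have hε2 : 0 < ε / 2 := ENNReal.half_pos hε.ne'
  obtain ⟨n, hn⟩ := (ENNReal.tendsto_nhds_zero.1 htail _ hε2).exists
  have h3 : Tendsto (fun x => (n : ℝ≥0∞) * ∫⁻ o, V x o ∂μ) l (𝓝 0) := by
    simpa using ENNReal.Tendsto.const_mul h0 (Or.inr (ENNReal.natCast_ne_top n))
  filter_upwards [hV, ENNReal.tendsto_nhds_zero.1 h3 _ hε2] with x hx hx0
  calc ∫⁻ o, g o * V x o ∂μ ≤ ∫⁻ o, (c * (g o - n) + n * V x o) ∂μ := by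
        refine lintegral_mono_ae ?_
        filter_upwards [hx] with o ho
        calc g o * V x o ≤ (n + (g o - n)) * V x o := by gcongr; exact le_add_tsub
          _ = (g o - n) * V x o + n * V x o := by ring
          _ ≤ c * (g o - n) + n * V x o := by rw [mul_comm c]; gcongr
    _ = c * ∫⁻ o, (g o - n) ∂μ + n * ∫⁻ o, V x o ∂μ := by
        rw [lintegral_add_left ((hg.sub_const _).const_mul _), lintegral_const_mul' _ _ hc,
          lintegral_const_mul' _ _ (ENNReal.natCast_ne_top n)]
    _ ≤ ε / 2 + ε / 2 := add_le_add hn hx0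
    _ = ε := ENNReal.add_halves ε

/-- Products converge in `L₂` if one factor converges in `L₂` and the other one converges in `L₂`
and is bounded. -/
theorem tendsto_lintegral_sq_mul_sub_mul {α 𝒳 : Type*} [MeasurableSpace 𝒳] {μ : Measure 𝒳}
    {l : Filter α} {F U : α → 𝒳 → ℝ} {f u : 𝒳 → ℝ} (hF : ∀ x, Measurable (F x))
    (hf : Measurable f) (hfi : ∫⁻ o, ENNReal.ofReal (f o ^ 2) ∂μ ≠ ⊤) {c : ℝ}
    (hU : ∀ᶠ x in l, ∀ᵐ o ∂μ, |U x o| ≤ c) (hu : ∀ᵐ o ∂μ, |u o| ≤ c)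
    (hFf : Tendsto (fun x => ∫⁻ o, ENNReal.ofReal ((F x o - f o) ^ 2) ∂μ) l (𝓝 0))
    (hUu : Tendsto (fun x => ∫⁻ o, ENNReal.ofReal ((U x o - u o) ^ 2) ∂μ) l (𝓝 0)) :
    Tendsto (fun x => ∫⁻ o, ENNReal.ofReal ((F x o * U x o - f o * u o) ^ 2) ∂μ) l (𝓝 0) := by
  have h1 := tendsto_lintegral_mul_of_bdd (μ := μ) (l := l) (g := fun o => ENNReal.ofReal (f o ^ 2))
    -- `U` and `u` are both bounded by `c`, so their difference is bounded by `c + c`.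
    (hf.pow_const 2).ennreal_ofReal hfi (c := ENNReal.ofReal ((c + c) ^ 2)) ENNReal.ofReal_ne_top
    (V := fun x o => ENNReal.ofReal ((U x o - u o) ^ 2)) (by
      filter_upwards [hU] with x hx
      filter_upwards [hx, hu] with o h1 h2
      refine ENNReal.ofReal_le_ofReal (sq_le_sq' ?_ ?_) <;>
        linarith [(abs_le.1 h1).1, (abs_le.1 h1).2, (abs_le.1 h2).1,
          (abs_le.1 h2).2]) hUu
  have h2 := (ENNReal.Tendsto.const_mul hFf (Or.inr (ENNReal.ofReal_ne_top (r := 2 * c ^ 2)))).add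
    (ENNReal.Tendsto.const_mul h1 (Or.inr (ENNReal.ofReal_ne_top (r := 2))))
  simp only [mul_zero, add_zero] at h2
  refine tendsto_of_tendsto_of_tendsto_of_le_of_le' tendsto_const_nhds h2
    (Eventually.of_forall fun _ => zero_le) ?_
  filter_upwards [hU] with x hx
  have hm : Measurable fun o => ENNReal.ofReal (2 * c ^ 2) * ENNReal.ofReal ((F x o - f o) ^ 2) :=
    (((hF x).sub hf).pow_const 2).ennreal_ofReal.const_mul _
  rw [← lintegral_const_mul' _ _ ENNReal.ofReal_ne_top,
    ← lintegral_const_mul' _ _ ENNReal.ofReal_ne_top, ← lintegral_add_left hm]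
  refine lintegral_mono_ae ?_
  filter_upwards [hx] with o ho
  rw [← ENNReal.ofReal_mul (sq_nonneg _), ← ENNReal.ofReal_mul (by positivity),
    ← ENNReal.ofReal_mul two_pos.le, ← ENNReal.ofReal_add (by positivity) (by positivity)]
  refine ENNReal.ofReal_le_ofReal ?_
  have hUc : U x o ^ 2 ≤ c ^ 2 := sq_le_sq' (abs_le.1 ho).1 (abs_le.1 ho).2
  -- The error is (F - f) U + f (U - u). The bound on `U` handles the first term; in the second `f`
  -- is only square integrable, which is where the truncation lemma enters.
  have e1 : (F x o * U x o - f o * u o) ^ 2 ≤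
      2 * ((F x o - f o) ^ 2 * U x o ^ 2) + 2 * (f o ^ 2 * (U x o - u o) ^ 2) := by
    nlinarith [sq_nonneg ((F x o - f o) * U x o - f o * (U x o - u o))]
  have e2 := mul_le_mul_of_nonneg_left hUc (sq_nonneg (F x o - f o))
  linarith

/-! ### L₂ distances of weights, arbitrary weights in the mean zero property, and bounds on the
features -/

namespace Spec

variable {T q r p : ℕ} {M : Spec T q r p} {P : Measure (Traj T q)} [IsProbabilityMeasure P]

theorem lintegral_entry_le_sqDistD (t : Fin T) (d₁ d₂ : Vec r → Matrix (Fin p) (Fin p) ℝ)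
    (i k : Fin p) :
    ∫⁻ o, ENNReal.ofReal ((d₁ (M.S t o) i k - d₂ (M.S t o) i k) ^ 2) ∂P ≤ M.sqDistD P t d₁ d₂ := by
  refine lintegral_mono fun o => ENNReal.ofReal_le_ofReal ?_
  exact (Finset.single_le_sum (f := fun k => (d₁ (M.S t o) i k - d₂ (M.S t o) i k) ^ 2)
    (fun _ _ => sq_nonneg _) (Finset.mem_univ k)).trans
    (Finset.single_le_sum (f := fun i => ∑ k, (d₁ (M.S t o) i k - d₂ (M.S t o) i k) ^ 2)
      (fun _ _ => Finset.sum_nonneg fun _ _ => sq_nonneg _) (Finset.mem_univ i))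

theorem sqDistD_le (t : Fin T) {d₁ d₂ d₃ : Vec r → Matrix (Fin p) (Fin p) ℝ}
    (h₁ : ∀ i k, Measurable fun s => d₁ s i k) (h₂ : ∀ i k, Measurable fun s => d₂ s i k) :
    M.sqDistD P t d₁ d₃ ≤ 2 * M.sqDistD P t d₁ d₂ + 2 * M.sqDistD P t d₂ d₃ := by
  unfold sqDistD
  have hm : Measurable fun o => ENNReal.ofReal
      (∑ i, ∑ k, (d₁ (M.S t o) i k - d₂ (M.S t o) i k) ^ 2) :=
    (Finset.measurable_fun_sum _ fun i _ => Finset.measurable_fun_sum _ fun k _ =>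
      ((((h₁ i k).sub (h₂ i k)).comp (M.measurable_S t)).pow_const 2)).ennreal_ofReal
  rw [← lintegral_const_mul' _ _ ENNReal.ofNat_ne_top,
    ← lintegral_const_mul' _ _ ENNReal.ofNat_ne_top,
    ← lintegral_add_left (hm.const_mul _)]
  refine lintegral_mono fun o => ?_
  have h2 : (2 : ℝ≥0∞) = ENNReal.ofReal 2 := by simp
  rw [h2, ← ENNReal.ofReal_mul two_pos.le, ← ENNReal.ofReal_mul two_pos.le,
    ← ENNReal.ofReal_add (by positivity) (by positivity)]
  refine ENNReal.ofReal_le_ofReal ?_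
  simp only [Finset.mul_sum, ← Finset.sum_add_distrib]
  refine Finset.sum_le_sum fun i _ => Finset.sum_le_sum fun k _ => ?_
  nlinarith [sq_nonneg ((d₁ (M.S t o) i k - d₂ (M.S t o) i k) -
    (d₂ (M.S t o) i k - d₃ (M.S t o) i k))]

theorem integrable_entry {t : Fin T} {d : Vec r → Matrix (Fin p) (Fin p) ℝ}
    (hm : ∀ i k, Measurable fun s => d s i k) (h : M.sqDistD P t d 0 < ⊤) (i k : Fin p) :
    Integrable (fun o => d (M.S t o) i k) P := by
  have hdm : Measurable fun o => d (M.S t o) i k := (hm i k).comp (M.measurable_S t)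
  have h1 := (lintegral_entry_le_sqDistD (M := M) (P := P) t d 0 i k).trans_lt h
  refine MemLp.integrable (q := 2) one_le_two
    ((memLp_two_iff_integrable_sq hdm.aestronglyMeasurable).2
      ⟨(hdm.pow_const 2).aestronglyMeasurable, ?_⟩)
  rw [hasFiniteIntegral_iff_ofReal (ae_of_all _ fun o => sq_nonneg _)]
  simpa using h1

/-- The weighted estimating function has mean zero at the true parameter, whatever the weights and
the outcome models. -/
theorem Design.integral_psi_apply (hd : M.Design P) (hbd : M.BoundedSupport P) {b : Vec p}
    (hb : M.EffectModel P b) {C : ℝ} {mu : ∀ t : Fin T, Hist q t → Bool → ℝ}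
    (hm : ∀ t : Fin T, Measurable fun y : Hist q t × Bool => mu t y.1 y.2)
    (hmu : ∀ t, BoundedMu P C t (mu t)) {d : Fin T → Vec r → Matrix (Fin p) (Fin p) ℝ}
    (hdm : ∀ t i k, Measurable fun s => d t s i k) (hd2 : ∀ t, M.sqDistD P t (d t) 0 < ⊤)
    (i : Fin p) :
    Integrable (fun o => M.psi d mu b o i) P ∧ ∫ o, M.psi d mu b o i ∂P = 0 := by
  have h := fun t k => hd.integral_weight_mul_phi hbd hb (hm t) (hmu t) (hdm t i k)
    (integrable_entry (hdm t) (hd2 t) i k) k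
  simp only [psi_apply]
  refine ⟨integrable_finsetSum _ fun t _ => integrable_finsetSum _ fun k _ => (h t k).1, ?_⟩
  rw [integral_finsetSum _ fun t _ => integrable_finsetSum _ fun k _ => (h t k).1]
  refine Finset.sum_eq_zero fun t _ => ?_
  rw [integral_finsetSum _ fun k _ => (h t k).1]
  exact Finset.sum_eq_zero fun k _ => (h t k).2

theorem measurable_outcomeFeature {t : Fin T} {mu : Hist q t → Bool → ℝ}
    (hm : Measurable fun y : Hist q t × Bool => mu y.1 y.2) (m : Fin 3) :
    Measurable (outcomeFeature mu m) := by
  have hI : Measurable fun o : Traj T q => bit (avail t o) :=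
    measurable_bit.comp (measurable_avail t)
  have h : ∀ a, Measurable fun o : Traj T q => mu (hist t o) a := fun a =>
    hm.comp ((measurable_hist t).prodMk measurable_const)
  fin_cases m
  exacts [measurable_const, hI.mul (h true), hI.mul (h false)]

theorem Design.abs_outcomeFeature_le (hd : M.Design P) {t : Fin T} {C : ℝ}
    {mu : Hist q t → Bool → ℝ} (hm : Measurable fun y : Hist q t × Bool => mu y.1 y.2)
    (h : BoundedMu P C t mu) (m : Fin 3) : ∀ᵐ o ∂P, |outcomeFeature mu m o| ≤ max C 1 := by
  filter_upwards [hd.boundedMu hm h true, hd.boundedMu hm h false] with o h1 h0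
  cases hav : avail t o
  · fin_cases m <;> simp [outcomeFeature, bit, hav]
  · have h1 := h1 hav
    have h0 := h0 hav
    fin_cases m <;> simp [outcomeFeature, bit, hav, h1, h0]

/-- The constant feature has no error. The other two carry the factor I_t, so only available
histories count, and there either arm is controlled by positivity. -/
theorem Design.lintegral_outcomeFeature_sub_le (hd : M.Design P) {τ : ℝ} (hτ : M.Positive P τ)
    {t : Fin T} {mu mu' : Hist q t → Bool → ℝ}
    (hm : Measurable fun y : Hist q t × Bool => mu y.1 y.2)
    (hm' : Measurable fun y : Hist q t × Bool => mu' y.1 y.2) (m : Fin 3) :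
    ENNReal.ofReal τ *
      ∫⁻ o, ENNReal.ofReal ((outcomeFeature mu m o - outcomeFeature mu' m o) ^ 2) ∂P ≤
        sqDistMu P t mu mu' := by
  have key : ∀ a, ENNReal.ofReal τ * ∫⁻ o, ENNReal.ofReal
      ((bit (avail t o) * mu (hist t o) a - bit (avail t o) * mu' (hist t o) a) ^ 2) ∂P ≤
        sqDistMu P t mu mu' := by
    intro a
    refine le_trans (le_of_eq ?_) (hd.lintegral_sub_mu_le hτ hm hm' a)
    rw [← lintegral_indicator (measurableSet_avail t)]
    congr 1
    refine lintegral_congr fun o => ?_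
    cases hav : avail t o <;> simp [bit, hav, Set.indicator]
  fin_cases m
  · simp [outcomeFeature]
  · exact key true
  · exact key false

/-! ### The cross-fitted estimating function -/

/-- The cross-fitted estimating function as a combination of fitted features. -/
noncomputable def crossFit {K : ℕ} (M : Spec T q r p) (L : Learner T q r p K)
    (d' : Fin T → Vec r → Matrix (Fin p) (Fin p) ℝ) (mu' : ∀ t : Fin T, Hist q t → Bool → ℝ) :
    Features T q p K (Fin T × Fin p × Fin 3) where
  coef := M.phiCoef
  fit N π k z := M.feature (L.wHat N π k z) (L.muHat N π k z)
  lim := M.feature d' mu'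

section crossFit

variable {Ω : Type*} [MeasurableSpace Ω] {Pr : Measure Ω} {K : ℕ} {O : ℕ → Ω → Traj T q}
  {fold : ∀ N : ℕ, Ω → Fin (K * N) → Fin K} {L : Learner T q r p K}
  {d' : Fin T → Vec r → Matrix (Fin p) (Fin p) ℝ} {mu' : ∀ t : Fin T, Hist q t → Bool → ℝ}

theorem score_crossFit (d : Fin T → Vec r → Matrix (Fin p) (Fin p) ℝ)
    (mu : ∀ t : Fin T, Hist q t → Bool → ℝ) (b : Vec p) (o : Traj T q) :
    (M.crossFit L d' mu').score (M.feature d mu) b o = M.psi d mu b o := by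
  ext i
  exact (psi_apply_eq_sum d mu b o i).symm

theorem jac_crossFit (d : Fin T → Vec r → Matrix (Fin p) (Fin p) ℝ)
    (mu : ∀ t : Fin T, Hist q t → Bool → ℝ) (b : Vec p) (o : Traj T q) :
    (M.crossFit L d' mu').jac (M.feature d mu) b o = M.dpsi d mu b o := by
  ext i l
  exact (dpsi_apply_eq_sum d mu b o i l).symm

theorem fitAt_crossFit (x : ℕ × Ω) (k : Fin K) :
    (M.crossFit L d' mu').fitAt O fold x k =
      M.feature (wFit O fold L x.1 k x.2) (muFit O fold L x.1 k x.2) := rfl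

theorem finalEq_iff (x : ℕ × Ω) (b : Vec p) :
    FinalEq O fold M L x.1 x.2 b ↔ (M.crossFit L d' mu').scoreAvg O fold x b = 0 := by
  simp only [FinalEq, Features.scoreAvg, fitAt_crossFit, score_crossFit]

theorem sandwich_eq (x : ℕ × Ω) (b : Vec p) :
    sandwich O fold M L x.1 x.2 b = ((M.crossFit L d' mu').jacAvg O fold x b)⁻¹ *
      (M.crossFit L d' mu').sqAvg O fold x b * (((M.crossFit L d' mu').jacAvg O fold x b)⁻¹)ᵀ := by
  simp only [sandwich, Features.jacAvg, Features.sqAvg, fitAt_crossFit, score_crossFit,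
    jac_crossFit]

theorem jacMean_crossFit (b : Vec p) :
    (M.crossFit L d' mu').jacMean P b = M.bread P d' mu' b := by
  simp only [Features.jacMean, bread]
  congr 1
  funext i l
  exact integral_congr_ae (ae_of_all _ fun o => congrFun (congrFun (jac_crossFit d' mu' b o) i) l)

theorem asympVar_eq (b : Vec p) :
    M.asympVar P d' mu' b = ((M.crossFit L d' mu').jacMean P b)⁻¹ *
      secondMoment P ((M.crossFit L d' mu').score (M.crossFit L d' mu').lim b) *
        (((M.crossFit L d' mu').jacMean P b)⁻¹)ᵀ := by
  have h : (M.crossFit L d' mu').score (M.crossFit L d' mu').lim b = M.psi d' mu' b :=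
    funext fun o => score_crossFit d' mu' b o
  rw [asympVar, jacMean_crossFit, h]
  rfl

theorem measurable_wFit (hL : L.Meas) (N : ℕ) (k : Fin K) (ω : Ω) (t : Fin T) (i j : Fin p) :
    Measurable fun s => wFit O fold L N k ω t s i j :=
  (hL.wHat N (fold N ω) k t i j).comp measurable_prodMk_left

theorem measurable_muFit (hL : L.Meas) (N : ℕ) (k : Fin K) (ω : Ω) (t : Fin T) :
    Measurable fun y : Hist q t × Bool => muFit O fold L N k ω t y.1 y.2 :=
  (hL.muHat N (fold N ω) k t).comp measurable_prodMk_left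

/-- Each feature is an entry of the weight, convergent merely in L₂, times an outcome feature,
convergent in L₂ and bounded; such products converge in L₂. Smoothness and bounds of the
coefficients come from γ_t being C² with locally bounded derivatives and from positivity. -/
theorem Design.regular_crossFit (hd : M.Design P) (hbd : M.BoundedSupport P) (hL : L.Meas) {C : ℝ}
    (hm : ∀ t : Fin T, Measurable fun y : Hist q t × Bool => mu' t y.1 y.2)
    (ha : ∀ t k, LittleOP Pr fun N ω => sqDistMu P t (muFit O fold L N k ω t) (mu' t))
    (hmu : ∀ t, BoundedMu P C t (mu' t))
    (hmuHat : ∀ N k t, ∀ᵐ ω ∂Pr, BoundedMu P C t (muFit O fold L N k ω t))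
    (hdm : ∀ t i j, Measurable fun s => d' t s i j) (hd2 : ∀ t, M.sqDistD P t (d' t) 0 < ⊤)
    (hw : UsedWeightsConverge O fold M L Pr P d') :
    (M.crossFit L d' mu').Regular Pr P O fold := by
  obtain ⟨τ, hτ⟩ := hd.exists_positive
  have hdS : ∀ t i k, Measurable fun o => d' t (M.S t o) i k := fun t i k =>
    (hdm t i k).comp (M.measurable_S t)
  have hd2' : ∀ t i k, ∫⁻ o, ENNReal.ofReal (d' t (M.S t o) i k ^ 2) ∂P ≠ ⊤ := fun t i k => by
    have := (lintegral_entry_le_sqDistD (M := M) (P := P) t (d' t) 0 i k).trans_lt (hd2 t)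
    simpa using this.ne
  refine ⟨fun j b => measurable_phiCoef j b, fun j o => contDiff_phiCoef j o, hd.phiCoef_bdd hbd,
    ?_, ?_, ?_, ?_⟩
  · rintro N π k ⟨t, l, m⟩ i
    refine ((hL.wHat N π k t i l).comp
      (measurable_fst.prodMk ((M.measurable_S t).comp measurable_snd))).mul ?_
    have hI : Measurable fun x : Train T q K N π k × Traj T q => bit (avail t x.2) :=
      measurable_bit.comp ((measurable_avail t).comp measurable_snd)
    have h : ∀ a, Measurable fun x : Train T q K N π k × Traj T q =>
        L.muHat N π k x.1 t (hist t x.2) a := fun a =>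
      (hL.muHat N π k t).comp (measurable_fst.prodMk
        (((measurable_hist t).comp measurable_snd).prodMk measurable_const))
    fin_cases m
    exacts [measurable_const, hI.mul (h true), hI.mul (h false)]
  · rintro ⟨t, l, m⟩ i
    exact (hdS t i l).mul (measurable_outcomeFeature (hm t) m)
  · rintro ⟨t, l, m⟩ i
    have h1 : ∫⁻ o, ENNReal.ofReal ((max C 1) ^ 2) * ENNReal.ofReal (d' t (M.S t o) i l ^ 2) ∂P
        ≠ ⊤ := by
      rw [lintegral_const_mul' _ _ ENNReal.ofReal_ne_top]
      exact ENNReal.mul_ne_top ENNReal.ofReal_ne_top (hd2' t i l)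
    refine ne_top_of_le_ne_top h1 (lintegral_mono_ae ?_)
    filter_upwards [hd.abs_outcomeFeature_le (hm t) (hmu t) m] with o ho
    rw [← ENNReal.ofReal_mul (sq_nonneg _)]
    refine ENNReal.ofReal_le_ofReal ?_
    change (d' t (M.S t o) i l * outcomeFeature (mu' t) m o) ^ 2 ≤ _
    rw [mul_pow, mul_comm]
    exact mul_le_mul_of_nonneg_right (sq_le_sq' (abs_le.1 ho).1 (abs_le.1 ho).2) (sq_nonneg _)
  · rintro ⟨t, l, m⟩ i k
    have hmuE : ∀ᶠ x : ℕ × Ω in inProb Pr, BoundedMu P C t (muFit O fold L x.1 k x.2 t) :=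
      eventually_inProb_of_ae fun N => hmuHat N k t
    change Tendsto (fun x : ℕ × Ω => ∫⁻ o, ENNReal.ofReal
      ((wFit O fold L x.1 k x.2 t (M.S t o) i l * outcomeFeature (muFit O fold L x.1 k x.2 t) m o -
        d' t (M.S t o) i l * outcomeFeature (mu' t) m o) ^ 2) ∂P) (inProb Pr) (𝓝 0)
    refine tendsto_lintegral_sq_mul_sub_mul (c := max C 1)
      (F := fun (x : ℕ × Ω) o => wFit O fold L x.1 k x.2 t (M.S t o) i l)
      (f := fun o => d' t (M.S t o) i l) (u := outcomeFeature (mu' t) m)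
      (U := fun (x : ℕ × Ω) => outcomeFeature (muFit O fold L x.1 k x.2 t) m)
      (fun x => (measurable_wFit hL x.1 k x.2 t i l).comp (M.measurable_S t)) (hdS t i l)
      (hd2' t i l)
      (hmuE.mono fun x hx => hd.abs_outcomeFeature_le (measurable_muFit hL x.1 k x.2 t) hx m)
      (hd.abs_outcomeFeature_le (hm t) (hmu t) m) ?_ ?_
    · exact tendsto_of_tendsto_of_tendsto_of_le_of_le tendsto_const_nhds
        (littleOP_iff.1 (hw t k)) (fun _ => zero_le)
        fun x => lintegral_entry_le_sqDistD t (wFit O fold L x.1 k x.2 t) (d' t) i l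
    · have hinv : (ENNReal.ofReal τ)⁻¹ ≠ ⊤ := ENNReal.inv_ne_top.2 (ENNReal.ofReal_pos.2 hτ.1).ne'
      have h1 := ENNReal.Tendsto.const_mul (littleOP_iff.1 (ha t k))
        (Or.inr hinv)
      rw [mul_zero] at h1
      refine tendsto_of_tendsto_of_tendsto_of_le_of_le tendsto_const_nhds h1
        (fun _ => zero_le) fun x => ?_
      have := hd.lintegral_outcomeFeature_sub_le hτ
        (measurable_muFit (O := O) (fold := fold) hL x.1 k x.2 t) (hm t) m
      refine le_trans (le_of_eq ?_) (mul_le_mul' (le_refl (ENNReal.ofReal τ)⁻¹) this)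
      rw [← mul_assoc, ENNReal.inv_mul_cancel (ENNReal.ofReal_pos.2 hτ.1).ne' ENNReal.ofReal_ne_top,
        one_mul]

/-- Stochastic equicontinuity transfers convergence of the weights at the limits to the weights
that are used. -/
theorem usedWeightsConverge_of_equicontinuous (hL : L.Meas) {Θ : Set (Vec p)} {C : ℝ} {b : Vec p}
    (hm : ∀ t : Fin T, Measurable fun y : Hist q t × Bool => mu' t y.1 y.2)
    (ha : ∀ t k, LittleOP Pr fun N ω => sqDistMu P t (muFit O fold L N k ω t) (mu' t))
    (hmuHat : ∀ N k t, ∀ᵐ ω ∂Pr, BoundedMu P C t (muFit O fold L N k ω t))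
    (hΘ : ∀ k, Whp Pr fun N ω => initFit O fold L N k ω ∈ Θ)
    (hlim : LimitWeightsConverge O fold M L Pr P d' mu' b)
    (heq : WeightsEquicontinuous O fold M L Pr P Θ C mu' b)
    (hinit : ∀ k, TendstoInMeasure Pr (fun N ω => initFit O fold L N k ω) atTop fun _ => b) :
    UsedWeightsConverge O fold M L Pr P d' := by
  intro t k
  have h1 : Tendsto (fun x : ℕ × Ω => M.sqDistD P t (wFit O fold L x.1 k x.2 t)
      (dFit O fold L x.1 k x.2 t (mu' t) b)) (inProb Pr) (𝓝 0) := by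
    refine ENNReal.tendsto_nhds_zero.2 fun ε hε => eventually_inProb_of_forall_le fun η hη => ?_
    have hη2 : 0 < η / 2 := ENNReal.half_pos hη.ne'
    obtain ⟨δ, hδ, hev⟩ := heq t k ε hε (η / 2) hη2
    have hgood : ∀ᶠ x : ℕ × Ω in inProb Pr, BoundedMu P C t (muFit O fold L x.1 k x.2 t) ∧
        initFit O fold L x.1 k x.2 ∈ Θ ∧
        sqDistMu P t (muFit O fold L x.1 k x.2 t) (mu' t) ≤ ENNReal.ofReal δ ∧
        ‖initFit O fold L x.1 k x.2 - b‖ ≤ δ := by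
      filter_upwards [eventually_inProb_of_ae fun N => hmuHat N k t, whp_iff.1 (hΘ k),
        ENNReal.tendsto_nhds_zero.1 (littleOP_iff.1 (ha t k)) _ (ENNReal.ofReal_pos.2 hδ),
        Metric.tendsto_nhds.1 (tendstoInMeasure_iff_inProb.1 (hinit k)) δ hδ] with x h1 h2 h3 h4
      exact ⟨h1, h2, h3, by rw [← dist_eq_norm]; exact h4.le⟩
    filter_upwards [hev, Eventually.inProb_le hgood hη2] with N hN1 hN2
    refine le_trans (measure_mono fun ω hω => ?_) ((measure_union_le _ _).trans
      ((add_le_add hN1 hN2).trans (ENNReal.add_halves η).le))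
    by_cases hg : BoundedMu P C t (muFit O fold L N k ω t) ∧ initFit O fold L N k ω ∈ Θ ∧
        sqDistMu P t (muFit O fold L N k ω t) (mu' t) ≤ ENNReal.ofReal δ ∧
        ‖initFit O fold L N k ω - b‖ ≤ δ
    -- The random fits themselves witness the exceptional event: equicontinuity is uniform over all
    -- admissible functions and parameters, so it may be used at data-dependent ones.
    · exact Or.inl ⟨muFit O fold L N k ω t, initFit O fold L N k ω, measurable_muFit hL N k ω t,
        hg.1, hg.2.1, hg.2.2.1, hg.2.2.2, (not_le.1 hω).le⟩
    · exact Or.inr hg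
  have h2 := (ENNReal.Tendsto.const_mul h1 (Or.inr (ENNReal.ofNat_ne_top (n := 2)))).add
    (ENNReal.Tendsto.const_mul (littleOP_iff.1 (hlim t k)) (Or.inr (ENNReal.ofNat_ne_top (n := 2))))
  simp only [mul_zero, add_zero] at h2
  refine littleOP_iff.2 (tendsto_of_tendsto_of_tendsto_of_le_of_le tendsto_const_nhds h2
    (fun _ => zero_le) fun x => sqDistD_le t (measurable_wFit hL x.1 k x.2 t) fun i j => ?_)
  exact (hL.dHat x.1 (fold x.1 x.2) k t (mu' t) b i j (hm t)).comp measurable_prodMk_left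

end crossFit

end Spec

end MRT

/-! ### Asymptotic normality for the trial and consistency of its variance estimator -/

theorem theorem4p3 {T q r p K : ℕ} (hK : 2 ≤ K)
    {Ω : Type*} [MeasurableSpace Ω] (Pr : MeasureTheory.Measure Ω)
    [MeasureTheory.IsProbabilityMeasure Pr]
    (P : MeasureTheory.Measure (MRT.Traj T q)) [MeasureTheory.IsProbabilityMeasure P]
    (M : MRT.Spec T q r p) (hdesign : M.Design P)
    -- compact parameter space, bounded observations, and the effect model with true value `bstar`
    (Θ : Set (MRT.Vec p)) (hΘ : IsCompact Θ)
    (hbdd : M.BoundedSupport P)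
    (bstar : MRT.Vec p) (hbstar : bstar ∈ Θ) (hmodel : M.EffectModel P bstar)
    -- the sample, the random folds and the fitting procedures
    (O : ℕ → Ω → MRT.Traj T q) (fold : ∀ N : ℕ, Ω → Fin (K * N) → Fin K)
    (hsample : MRT.Sampling Pr P O fold)
    (L : MRT.Learner T q r p K) (hL : L.Meas)
    -- the preliminary estimators and the final estimator solve their estimating equations
    (hinit : ∀ k, MRT.Whp Pr fun N ω => MRT.initFit O fold L N k ω ∈ Θ ∧
      MRT.InitEq O fold M L N k ω (MRT.initFit O fold L N k ω))
    (bcheck : ℕ → Ω → MRT.Vec p) (hbcheck : ∀ N, Measurable (bcheck N))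
    (hfinal : MRT.Whp Pr fun N ω => bcheck N ω ∈ Θ ∧
      MRT.FinalEq O fold M L N ω (bcheck N ω))
    -- the limits of the fitted outcome models, and boundedness
    (mu' : ∀ t : Fin T, MRT.Hist q t → Bool → ℝ)
    (hmu'_meas : ∀ t : Fin T, Measurable fun y : MRT.Hist q t × Bool => mu' t y.1 y.2)
    (ha : ∀ t k, MRT.LittleOP Pr fun N ω =>
      MRT.sqDistMu P t (MRT.muFit O fold L N k ω t) (mu' t))
    (C : ℝ) (hmu'_bdd : ∀ t, MRT.BoundedMu P C t (mu' t))
    (hmuHat_bdd : ∀ N k t, ∀ᵐ ω ∂Pr, MRT.BoundedMu P C t (MRT.muFit O fold L N k ω t))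
    -- the limits of the fitted weights
    (d' : Fin T → MRT.Vec r → Matrix (Fin p) (Fin p) ℝ)
    (hd'_meas : ∀ t i j, Measurable fun s => d' t s i j)
    (hd'_L2 : ∀ t, M.sqDistD P t (d' t) 0 < ⊤)
    (hb : MRT.UsedWeightsConverge O fold M L Pr P d' ∨
      (MRT.LimitWeightsConverge O fold M L Pr P d' mu' bstar ∧
        MRT.WeightsEquicontinuous O fold M L Pr P Θ C mu' bstar ∧
        ∀ k, MeasureTheory.TendstoInMeasure Pr (fun N ω => MRT.initFit O fold L N k ω)
          Filter.atTop fun _ => bstar))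
    -- unique zero and invertibility
    (hc : M.UniqueZero P Θ d' mu')
    (hd : IsUnit (M.bread P d' mu' bstar)) :
    MeasureTheory.TendstoInDistribution
        (fun N ω => Real.sqrt ((K * N : ℕ) : ℝ) • (bcheck N ω - bstar)) Filter.atTop
        (id : MRT.Vec p → MRT.Vec p) (fun _ => Pr)
        (ProbabilityTheory.multivariateGaussian 0 (M.asympVar P d' mu' bstar)) ∧
      ∀ i j, MeasureTheory.TendstoInMeasure Pr
        (fun N ω => MRT.sandwich O fold M L N ω (bcheck N ω) i j) Filter.atTop
        (fun _ => M.asympVar P d' mu' bstar i j) := by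
  have hK0 : 0 < K := by omega
  -- Both alternatives for the weights reduce to L₂ convergence of the weights that are used.
  have hw : MRT.UsedWeightsConverge O fold M L Pr P d' := by
    rcases hb with hb | ⟨hlim, heq, hin⟩
    · exact hb
    · exact MRT.Spec.usedWeightsConverge_of_equicontinuous hL hmu'_meas ha hmuHat_bdd
        (fun k => MRT.whp_iff.2 ((MRT.whp_iff.1 (hinit k)).mono fun x hx => hx.1)) hlim heq hin
  have hF := hdesign.regular_crossFit hbdd hL hmu'_meas ha hmu'_bdd hmuHat_bdd hd'_meas hd'_L2 hw
  have hscore : ∀ b o, (M.crossFit L d' mu').score (M.crossFit L d' mu').lim b o =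
      M.psi d' mu' b o := fun b o => MRT.Spec.score_crossFit d' mu' b o
  have hzero := fun i => hdesign.integral_psi_apply hbdd hmodel hmu'_meas hmu'_bdd hd'_meas hd'_L2 i
  -- Integrability lets the vector-valued integral be computed coordinate by coordinate.
  have hint : ∀ b, MeasureTheory.Integrable (M.psi d' mu' b) P := fun b =>
    MeasureTheory.Integrable.of_eval_piLp fun i => by
      simpa only [hscore] using (hF.score_memLp b i).integrable one_le_two
  have hcoord : ∀ b, ∫ o, M.psi d' mu' b o ∂P = 0 ↔ ∀ i, ∫ o, M.psi d' mu' b o i ∂P = 0 := by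
    intro b
    have h : ∀ i, (∫ o, M.psi d' mu' b o ∂P) i = ∫ o, M.psi d' mu' b o i ∂P := fun i =>
      MeasureTheory.eval_integral_piLp (fun i => (hint b).eval_piLp i) i
    simp only [← h]
    exact ⟨fun h0 i => by rw [h0]; rfl, fun h0 => by ext i; exact h0 i⟩
  -- The true parameter is a zero by the mean zero property, so it is the unique one in `Θ`.
  have huniq : ∀ b' ∈ Θ, (∀ i, ∫ o, (M.crossFit L d' mu').score
      (M.crossFit L d' mu').lim b' o i ∂P = 0) → b' = bstar := fun b' hb' h0 => by
    simp only [hscore] at h0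
    exact hc.unique ⟨hb', (hcoord b').2 h0⟩ ⟨hbstar, (hcoord bstar).2 fun i => (hzero i).2⟩
  have hfin : ∀ᶠ x in MRT.inProb Pr, bcheck x.1 x.2 ∈ Θ ∧
      (M.crossFit L d' mu').scoreAvg O fold x (bcheck x.1 x.2) = 0 :=
    (MRT.whp_iff.1 hfinal).mono fun x hx => ⟨hx.1, (MRT.Spec.finalEq_iff x _).1 hx.2⟩
  have hcons := hF.tendsto_of_scoreAvg_eq_zero hsample hK0 hΘ huniq hfin
  have hD : IsUnit ((M.crossFit L d' mu').jacMean P bstar) := by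
    rwa [MRT.Spec.jacMean_crossFit]
  have h0 : ∀ i k, ∀ᶠ x in MRT.inProb Pr,
      ∫ o, ((M.crossFit L d' mu').score ((M.crossFit L d' mu').fitAt O fold x k) bstar o i -
        (M.crossFit L d' mu').score (M.crossFit L d' mu').lim bstar o i) ∂P = 0 := by
    intro i k
    have hmu : ∀ᶠ x in MRT.inProb Pr, ∀ t, MRT.BoundedMu P C t (MRT.muFit O fold L x.1 k x.2 t) :=
      Filter.eventually_all.2 fun t => MRT.eventually_inProb_of_ae fun N => hmuHat_bdd N k t
    -- Any finite bound would do: it only ensures that the fitted weights are square integrable, so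
    -- that the mean zero property applies to the fitted estimating function as well as to its
    -- limit.
    have hwt : ∀ᶠ x in MRT.inProb Pr, ∀ t,
        M.sqDistD P t (MRT.wFit O fold L x.1 k x.2 t) (d' t) < 1 :=
      Filter.eventually_all.2 fun t =>
        (MRT.littleOP_iff.1 (hw t k)).eventually_lt_const one_pos
    filter_upwards [hmu, hwt] with x hx1 hx2
    have hx := hdesign.integral_psi_apply hbdd hmodel
      (MRT.Spec.measurable_muFit (O := O) (fold := fold) hL x.1 k x.2) hx1
      (MRT.Spec.measurable_wFit hL x.1 k x.2)
      (fun t => (MRT.Spec.sqDistD_le t (MRT.Spec.measurable_wFit hL x.1 k x.2 t)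
        (hd'_meas t)).trans_lt (ENNReal.add_lt_top.2
          ⟨ENNReal.mul_lt_top (by simp) ((hx2 t).trans ENNReal.one_lt_top),
            ENNReal.mul_lt_top (by simp) (hd'_L2 t)⟩)) i
    simp only [hscore, MRT.Spec.fitAt_crossFit, MRT.Spec.score_crossFit]
    rw [MeasureTheory.integral_sub hx.1 (hzero i).1, hx.2, (hzero i).2, sub_zero]
  rw [MRT.Spec.asympVar_eq (L := L)]
  refine ⟨hF.tendstoInDistribution hsample hK0 h0 (fun i => ?_) hD hbcheck hcons
    (hfin.mono fun x hx => hx.2), fun i j => MRT.tendstoInMeasure_iff_inProb.2 ?_⟩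
  · simp only [hscore]
    exact (hzero i).2
  · simp only [fun x : ℕ × Ω => MRT.Spec.sandwich_eq (M := M) (L := L) (O := O) (fold := fold)
      (d' := d') (mu' := mu') x (bcheck x.1 x.2)]
    exact ((continuous_apply j).comp (continuous_apply i)).continuousAt.tendsto.comp
      (hF.tendsto_sandwich hsample hK0 hD hcons)
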